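/- Let $M$ be a connected (Hausdorff, second countable) smooth $3$-manifold and $\varphi\colon M\to\mathbb R^4$ a smooth immersion, with $\mathbb R^4$ carrying its standard flat connection $D$ and volume form $\det$. A smooth field $\xi\colon M\to\mathbb R^4$ along $\varphi$ that is everywhere transverse to $\varphi$ and has tangential derivatives defines a torsion-free connection $\nabla$, a symmetric bilinear form $h$ (the affine metric) and a shape operator $S$ by $D_XY=\nabla_XY+h(X,Y)\xi$ and $D_X\xi=-SX$. It is a Blaschke normal if $h$ is nondegenerate and $|\det(\varphi_*X_1,\varphi_*X_2,\varphi_*X_3,\xi)|=|\det(h(X_i,X_j))|^{1/2}$ for all tangent vectors $X_1,X_2,X_3$ at a common point. We call $(M,\varphi,\xi)$ an indefinite affine hypersphere if $\xi$ is a Blaschke normal, $h$ is indefinite, and $S=H\,\mathrm{Id}$ for a constant $H\in\mathbb R$. Let $K(X,Y)=\nabla_XY-\widehat\nabla_XY$ be the difference tensor, where $\widehat\nabla$ is the Levi-Civita connection of $h$. The hypersphere admits a pointwise $\mathbb Z_2\times\mathbb Z_2$-symmetry if for every $p\in M$ the group of all linear automorphisms $L$ of $T_pM$ with $\det L=1$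 that preserve $h_p$, $K_p$ and $S_p$ is isomorphic to $\mathbb Z_2\times\mathbb Z_2$ ($S_p$ is preserved automatically for hyperspheres). We say that $\varphi$ is affinely equivalent to an open subset of $Q\subset\mathbb R^4$ if $A(\varphi(M))$ is a relatively open subset of $Q$ for some invertible affine map $A$ of $\mathbb R^4$. Theorem. Let $$Q=\{x\in\mathbb R^4 : (x_1^2+x_2^2)(x_3^2+x_4^2)=1\}.$$ An indefinite affine hypersphere $(M,\varphi,\xi)$ of dimension $3$ admits a pointwise $\mathbb Z_2\times\mathbb Z_2$-symmetry if and only if it is affinely equivalent to an open subset of $Q$. Moreover, every smooth immersion $\varphi\colon M\to\mathbb R^4$ of a connected smooth $3$-manifold that is affinely equivalent to an open subset of $Q$ is an indefinite affine hypersphere for some $\xi$. -/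

import Mathlib

open scoped Manifold ContDiff

noncomputable section

namespace AffineSphere

/-- The model space of three-dimensional manifolds. -/
abbrev E3 : Type := EuclideanSpace ℝ (Fin 3)

/-- The ambient space of hypersurfaces of dimension three. -/
abbrev E4 : Type := EuclideanSpace ℝ (Fin 4)

/-- The standard volume form of the ambient space. -/
def vol (a b c d : E4) : ℝ :=
  Matrix.det !![a 0, a 1, a 2, a 3; b 0, b 1, b 2, b 3; c 0, c 1, c 2, c 3; d 0, d 1, d 2, d 3]

/-! ### Local theory: a parametrization `f` with a transverse field `ν`

The tangent space at the point with coordinates `y` is identified with `E3` by `fderiv ℝ f y`.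
-/

/-- The map `(X, c) ↦ f_* X + c ν` at `y`; it is invertible exactly when `f_*` is injective and
`ν` is transverse to `f` at `y`. -/
def frame (f ν : E3 → E4) (y : E3) : E3 × ℝ →L[ℝ] E4 :=
  (fderiv ℝ f y).coprod (ContinuousLinearMap.toSpanSingleton ℝ (ν y))

/-- The tangential component: `v = f_* (tangential v) + transversal v • ν`. -/
def tangential (f ν : E3 → E4) (y : E3) : E4 →L[ℝ] E3 :=
  (ContinuousLinearMap.fst ℝ E3 ℝ).comp (frame f ν y).inverse

/-- The transversal component: `v = f_* (tangential v) + transversal v • ν`. -/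
def transversal (f ν : E3 → E4) (y : E3) : E4 →L[ℝ] ℝ :=
  (ContinuousLinearMap.snd ℝ E3 ℝ).comp (frame f ν y).inverse

/-- The affine metric `h` in the Gauss formula `D_X Y = ∇_X Y + h(X,Y) ν`. -/
def metric (f ν : E3 → E4) (y : E3) : E3 →L[ℝ] E3 →L[ℝ] ℝ :=
  (ContinuousLinearMap.compL ℝ E3 E4 ℝ (transversal f ν y)).comp (fderiv ℝ (fderiv ℝ f) y)

/-- The Christoffel symbols of the induced connection `∇` of the Gauss formula, that is
`∇_X Y` for constant (coordinate) fields `X`, `Y`. -/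
def inducedChristoffel (f ν : E3 → E4) (y : E3) : E3 →L[ℝ] E3 →L[ℝ] E3 :=
  (ContinuousLinearMap.compL ℝ E3 E4 E3 (tangential f ν y)).comp (fderiv ℝ (fderiv ℝ f) y)

/-- The affine shape operator `S` in the Weingarten formula `D_X ν = - S X`. -/
def shape (f ν : E3 → E4) (y : E3) : E3 →L[ℝ] E3 :=
  -(tangential f ν y).comp (fderiv ℝ ν y)

/-- The linear form `Z ↦ g(∇̂_X Y, Z) = (X g(Y,Z) + Y g(X,Z) - Z g(X,Y)) / 2` for constant
(coordinate) fields, where `∇̂` is the Levi-Civita connection of the metric `g`. -/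
def koszul (g : E3 → E3 →L[ℝ] E3 →L[ℝ] ℝ) (y X Y : E3) : E3 →L[ℝ] ℝ :=
  (1 / 2 : ℝ) • (fderiv ℝ g y X Y + fderiv ℝ g y Y X - ((fderiv ℝ g y).flip X).flip Y)

/-- The Christoffel symbols of the Levi-Civita connection of a metric `g`. -/
def leviCivitaChristoffel (g : E3 → E3 →L[ℝ] E3 →L[ℝ] ℝ) (y X Y : E3) : E3 :=
  (g y).inverse (koszul g y X Y)

/-- The difference tensor `K(X,Y) = ∇_X Y - ∇̂_X Y`. -/
def differenceTensor (f ν : E3 → E4) (y X Y : E3) : E3 :=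
  inducedChristoffel f ν y X Y - leviCivitaChristoffel (metric f ν) y X Y

/-- `ν` is the affine (Blaschke) normal (up to sign) of `f` at `y`: it is transverse, its
derivative is tangential, and the volume form induced by it agrees with the volume of the affine
metric up to orientation. -/
structure IsBlaschkeNormalAt (f ν : E3 → E4) (y : E3) : Prop where
  transverse : ν y ∉ (fderiv ℝ f y).range
  tangent : ∀ X : E3, fderiv ℝ ν y X ∈ (fderiv ℝ f y).range
  volume_eq : ∀ X : Fin 3 → E3,
    |vol (fderiv ℝ f y (X 0)) (fderiv ℝ f y (X 1)) (fderiv ℝ f y (X 2)) (ν y)| =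
      Real.sqrt |(Matrix.of fun i j => metric f ν y (X i) (X j)).det|

/-- The affine metric is nondegenerate and indefinite at `y`. -/
structure IsIndefiniteAt (f ν : E3 → E4) (y : E3) : Prop where
  nondegenerate : ∀ X : E3, (∀ Y : E3, metric f ν y X Y = 0) → X = 0
  exists_pos : ∃ X : E3, 0 < metric f ν y X X
  exists_neg : ∃ X : E3, metric f ν y X X < 0

/-- The stabilizer in the special isometry group of the affine metric of the difference tensor
and the shape operator at `y`. -/
def stabilizer (f ν : E3 → E4) (y : E3) : Subgroup (E3 ≃ₗ[ℝ] E3) where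
  carrier := {L | LinearMap.det (L : E3 →ₗ[ℝ] E3) = 1 ∧
    (∀ X Y, metric f ν y (L X) (L Y) = metric f ν y X Y) ∧
    (∀ X Y, differenceTensor f ν y (L X) (L Y) = L (differenceTensor f ν y X Y)) ∧
    (∀ X, shape f ν y (L X) = L (shape f ν y X))}
  one_mem' := by
    refine ⟨?_, fun X Y => rfl, fun X Y => rfl, fun X => rfl⟩
    exact LinearMap.det_id
  mul_mem' := by
    rintro L N ⟨d, h, k, s⟩ ⟨d', h', k', s'⟩
    refine ⟨?_, fun X Y => ?_, fun X Y => ?_, fun X => ?_⟩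
    · have : ((L * N : E3 ≃ₗ[ℝ] E3) : E3 →ₗ[ℝ] E3) = (L : E3 →ₗ[ℝ] E3) ∘ₗ (N : E3 →ₗ[ℝ] E3) := rfl
      rw [this, LinearMap.det_comp, d, d', one_mul]
    · simp only [LinearEquiv.mul_apply, h, h']
    · simp only [LinearEquiv.mul_apply, k, k']
    · simp only [LinearEquiv.mul_apply, s, s']
  inv_mem' := by
    rintro L ⟨d, h, k, s⟩
    have e : ∀ X, L (L⁻¹ X) = X := fun X => L.apply_symm_apply X
    refine ⟨?_, fun X Y => ?_, fun X Y => ?_, fun X => ?_⟩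
    · have h1 := L.det_mul_det_symm
      rw [d, one_mul] at h1
      exact h1
    · rw [← h, e, e]
    · apply L.injective
      rw [← k, e, e, e]
    · apply L.injective
      rw [← s, e, e]

/-! ### Immersed hypersurfaces -/

section Global

variable {M : Type*} [TopologicalSpace M] [ChartedSpace E3 M]

/-- A smooth immersion of a three-dimensional manifold. -/
structure IsSmoothImmersion (φ : M → E4) : Prop where
  smooth : ContMDiff (𝓡 3) 𝓘(ℝ, E4) ∞ φ
  immersive : ∀ p : M, Function.Injective (mfderiv (𝓡 3) 𝓘(ℝ, E4) φ p)

/-- A local property of a hypersurface with a transverse field holds everywhere, that is at each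
point of each smooth chart. (All properties used below are independent of the chart.) -/
def Everywhere (P : (E3 → E4) → (E3 → E4) → E3 → Prop) (φ ξ : M → E4) : Prop :=
  ∀ e ∈ IsManifold.maximalAtlas (𝓡 3) ∞ M, ∀ y ∈ e.target, P (φ ∘ e.symm) (ξ ∘ e.symm) y

/-- The immersion `φ` with the affine normal `ξ` is an indefinite affine hypersphere. -/
structure IsIndefiniteAffineHypersphere (φ ξ : M → E4) : Prop where
  immersion : IsSmoothImmersion φ
  smooth_normal : ContMDiff (𝓡 3) 𝓘(ℝ, E4) ∞ ξ
  blaschke : Everywhere IsBlaschkeNormalAt φ ξ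
  indefinite : Everywhere IsIndefiniteAt φ ξ
  shape_eq : ∃ H : ℝ, Everywhere (fun f ν y => ∀ X, shape f ν y X = H • X) φ ξ

/-- The hypersurface admits a pointwise `G`-symmetry: at each point the stabilizer is isomorphic
to `G`. -/
def HasPointwiseSymmetry (G : Type*) [Group G] (φ ξ : M → E4) : Prop :=
  Everywhere (fun f ν y => Nonempty (stabilizer f ν y ≃* G)) φ ξ

/-- The hypersurface is affinely equivalent to an open subset of the subset `Q` of `ℝ⁴`. -/
def IsAffinelyEquivalentToOpenSubsetOf (φ : M → E4) (Q : Set E4) : Prop :=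
  ∃ (A : E4 ≃ᵃ[ℝ] E4) (U : Set E4), IsOpen U ∧ A '' Set.range φ = Q ∩ U

end Global

/-- The hypersurface `(x₁² + x₂²)(x₃² + x₄²) = 1`. -/
def model : Set E4 := {x | (x 0 ^ 2 + x 1 ^ 2) * (x 2 ^ 2 + x 3 ^ 2) = 1}

end AffineSphere

end

open AffineSphere

open scoped Manifold ContDiff Topology
open Filter

noncomputable section

namespace AffineSphere

/-! ### The Gauss and Weingarten decompositions -/

section Decomposition

variable {f ν : E3 → E4} {y : E3}

/-! From symmetry to the model. An involution of determinant one other than the identity has trace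
-1, so two commuting symmetries have a joint eigenbasis belonging to the three nontrivial characters
of the Klein group. Invariance makes this basis orthogonal and forces `K` of two members to be a
multiple of the third and `K` of a member with itself to vanish; since the cubic form is totally
symmetric, a single factor `l` remains. If `l` were zero, a quarter turn would be a further
symmetry, so `l ≠ 0` (`exists_adapted`). The implicit function theorem extends this frame smoothly
(`exists_smooth_adapted`). The Codazzi equation then says that the frame is parallel for the
Levi-Civita connection and that `l` is locally constant, and the Gauss equation gives `H = -(σ * l ^
2)`, which is not zero (`codazzi_algebra`, `gauss_algebra`). Hence the normals meet in a center `c`,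
and the coordinates of a fixed ambient vector in the moving frame satisfy a linear system with
constant coefficients. Its matrices are multiplications in the algebra ℂ × ℂ by elements whose two
real parts cancel, so the product of the two squared moduli is a first integral. For the vector `f w
- c` its value is 1, which is the equation of the model (`exists_local_model`). The local equations
patch together: the cone over a piece of the hypersurface is open and the quartic is homogeneous and
analytic, so the quartics found at neighbouring points coincide, and `M` is connected
(`equivalent_of_symmetry`). From the model to symmetry. With complex coordinates `p`, `q`, the
logarithmic derivatives of `p (f - c)` and `q (f - c)` form a closed one-form `logForm` with values
in the hyperplane of ℂ × ℂ on which the real parts cancel. Products of its values split into a part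
in the hyperplane and a multiple of the unit: these are the difference tensor `mul3` and, up to a
factor, the metric `eta`. Their common special isometries are the diagonal sign matrices of
determinant one (`exists_signMap`). Finally, the volume condition fixes the size of the transversal
part of any Blaschke normal and tangency of its derivative removes the tangential part, so the
normal is locally a multiple of the position vector (`exists_normal_eq`); conversely the multiple
with the right constant is a Blaschke normal (`exists_hypersphere`). -/

lemma frame_apply (f ν : E3 → E4) (y : E3) (p : E3 × ℝ) :
    frame f ν y p = fderiv ℝ f y p.1 + p.2 • ν y := by
  simp [frame]

lemma tangential_frame (hi : (frame f ν y).IsInvertible) (X : E3) (c : ℝ) :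
    tangential f ν y (fderiv ℝ f y X + c • ν y) = X := by
  have := hi.inverse_apply_self (X, c)
  rw [frame_apply] at this
  simp only at this
  simp [tangential, -map_add, this]

lemma transversal_frame (hi : (frame f ν y).IsInvertible) (X : E3) (c : ℝ) :
    transversal f ν y (fderiv ℝ f y X + c • ν y) = c := by
  have := hi.inverse_apply_self (X, c)
  rw [frame_apply] at this
  simp only at this
  simp [transversal, -map_add, this]

lemma tangential_fderiv (hi : (frame f ν y).IsInvertible) (X : E3) :
    tangential f ν y (fderiv ℝ f y X) = X := by
  simpa using tangential_frame hi X 0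

lemma transversal_fderiv (hi : (frame f ν y).IsInvertible) (X : E3) :
    transversal f ν y (fderiv ℝ f y X) = 0 := by
  simpa using transversal_frame hi X 0

lemma tangential_normal (hi : (frame f ν y).IsInvertible) : tangential f ν y (ν y) = 0 := by
  simpa using tangential_frame hi 0 1

lemma transversal_normal (hi : (frame f ν y).IsInvertible) : transversal f ν y (ν y) = 1 := by
  simpa using transversal_frame hi 0 1

lemma fderiv_tangential_add (hi : (frame f ν y).IsInvertible) (v : E4) :
    fderiv ℝ f y (tangential f ν y v) + transversal f ν y v • ν y = v := by
  have := hi.self_apply_inverse v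
  rwa [frame_apply] at this

lemma metric_apply (f ν : E3 → E4) (y X Y : E3) :
    metric f ν y X Y = transversal f ν y (fderiv ℝ (fderiv ℝ f) y X Y) := rfl

lemma inducedChristoffel_apply (f ν : E3 → E4) (y X Y : E3) :
    inducedChristoffel f ν y X Y = tangential f ν y (fderiv ℝ (fderiv ℝ f) y X Y) := rfl

lemma gauss_formula (hi : (frame f ν y).IsInvertible) (X Y : E3) :
    fderiv ℝ (fderiv ℝ f) y X Y =
      fderiv ℝ f y (inducedChristoffel f ν y X Y) + metric f ν y X Y • ν y :=
  (fderiv_tangential_add hi _).symm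

/-- The inverse of a noninvertible map is zero by convention, and then so is the metric. A single
nonzero value therefore certifies transversality and immersivity, which is why `IsLocalSphere` does
not list them. -/
lemma frame_isInvertible_of_metric_ne_zero {X Y : E3} (h : metric f ν y X Y ≠ 0) :
    (frame f ν y).IsInvertible := by
  by_contra hc
  apply h
  rw [metric_apply, transversal, ContinuousLinearMap.inverse_of_not_isInvertible hc]
  simp

lemma frame_isInvertible (hinj : Function.Injective (fderiv ℝ f y))
    (ht : ν y ∉ (fderiv ℝ f y).range) : (frame f ν y).IsInvertible := by
  have hi : Function.Injective (frame f ν y) := by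
    rw [injective_iff_map_eq_zero]
    rintro ⟨X, c⟩ h
    rw [frame_apply] at h
    have hc : c = 0 := by
      by_contra hc
      apply ht
      refine ⟨-(c⁻¹ • X), ?_⟩
      have h' : fderiv ℝ f y X = -(c • ν y) := eq_neg_of_add_eq_zero_left h
      simp only [ContinuousLinearMap.coe_coe, map_neg, map_smul, h', smul_neg, neg_neg, smul_smul]
      rw [inv_mul_cancel₀ hc, one_smul]
    subst hc
    have hX : X = 0 := hinj (by simpa using h)
    rw [hX]; rfl
  let F : (E3 × ℝ) →ₗ[ℝ] E4 := (frame f ν y : (E3 × ℝ) →ₗ[ℝ] E4)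
  have hd : Module.finrank ℝ (E3 × ℝ) = Module.finrank ℝ E4 := by simp
  exact ⟨(F.linearEquivOfInjective hi hd).toContinuousLinearEquiv, by ext <;> rfl⟩

end Decomposition

/-! ### Smoothness -/

section Smoothness

variable {f ν : E3 → E4} {y : E3}

lemma contDiffAt_fderiv {E F : Type*} [NormedAddCommGroup E] [NormedSpace ℝ E]
    [NormedAddCommGroup F] [NormedSpace ℝ F] {g : E → F} {x : E} (h : ContDiffAt ℝ ∞ g x) :
    ContDiffAt ℝ ∞ (fderiv ℝ g) x :=
  h.fderiv_right (by simp)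

lemma differentiableAt_of_smooth {E F : Type*} [NormedAddCommGroup E] [NormedSpace ℝ E]
    [NormedAddCommGroup F] [NormedSpace ℝ F] {g : E → F} {x : E} (h : ContDiffAt ℝ ∞ g x) :
    DifferentiableAt ℝ g x :=
  h.differentiableAt (by simp)

lemma contDiffAt_frame (hf : ContDiffAt ℝ ∞ f y) (hν : ContDiffAt ℝ ∞ ν y) :
    ContDiffAt ℝ ∞ (frame f ν) y := by
  have h1 : ContDiffAt ℝ ∞ (fun z => (fderiv ℝ f z).comp (ContinuousLinearMap.fst ℝ E3 ℝ)) y :=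
    (contDiffAt_fderiv hf).clm_comp contDiffAt_const
  have h2 : ContDiffAt ℝ ∞ (fun z => (ContinuousLinearMap.toSpanSingletonCLE (𝕜 := ℝ) (ν z)).comp
      (ContinuousLinearMap.snd ℝ E3 ℝ)) y :=
    ((ContinuousLinearEquiv.contDiff _).contDiffAt.comp y hν).clm_comp contDiffAt_const
  refine (h1.add h2).congr_of_eventuallyEq (Eventually.of_forall fun z => ?_)
  ext p <;> simp [frame]

lemma contDiffAt_frame_inverse (hf : ContDiffAt ℝ ∞ f y) (hν : ContDiffAt ℝ ∞ ν y)
    (hi : (frame f ν y).IsInvertible) :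
    ContDiffAt ℝ ∞ (fun z => (frame f ν z).inverse) y :=
  hi.contDiffAt_map_inverse.comp y (contDiffAt_frame hf hν)

lemma contDiffAt_tangential (hf : ContDiffAt ℝ ∞ f y) (hν : ContDiffAt ℝ ∞ ν y)
    (hi : (frame f ν y).IsInvertible) : ContDiffAt ℝ ∞ (tangential f ν) y :=
  contDiffAt_const.clm_comp (contDiffAt_frame_inverse hf hν hi)

lemma contDiffAt_transversal (hf : ContDiffAt ℝ ∞ f y) (hν : ContDiffAt ℝ ∞ ν y)
    (hi : (frame f ν y).IsInvertible) : ContDiffAt ℝ ∞ (transversal f ν) y :=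
  contDiffAt_const.clm_comp (contDiffAt_frame_inverse hf hν hi)

lemma contDiffAt_metric (hf : ContDiffAt ℝ ∞ f y) (hν : ContDiffAt ℝ ∞ ν y)
    (hi : (frame f ν y).IsInvertible) : ContDiffAt ℝ ∞ (metric f ν) y :=
  ((ContinuousLinearMap.contDiff _).contDiffAt.comp y (contDiffAt_transversal hf hν hi)).clm_comp
    (contDiffAt_fderiv (contDiffAt_fderiv hf))

lemma contDiffAt_inducedChristoffel (hf : ContDiffAt ℝ ∞ f y) (hν : ContDiffAt ℝ ∞ ν y)
    (hi : (frame f ν y).IsInvertible) : ContDiffAt ℝ ∞ (inducedChristoffel f ν) y :=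
  ((ContinuousLinearMap.contDiff _).contDiffAt.comp y (contDiffAt_tangential hf hν hi)).clm_comp
    (contDiffAt_fderiv (contDiffAt_fderiv hf))

/-- Evaluation on a basis identifies maps out of a finite-dimensional space with tuples. This suits
`koszul`, which is bundled only in its last slot. -/
lemma contDiffAt_of_forall_apply {E D F : Type*} [NormedAddCommGroup E] [NormedSpace ℝ E]
    [NormedAddCommGroup D] [NormedSpace ℝ D] [FiniteDimensional ℝ D]
    [NormedAddCommGroup F] [NormedSpace ℝ F] {g : E → D →L[ℝ] F} {p : E}
    (h : ∀ Z, ContDiffAt ℝ ∞ (fun q => g q Z) p) : ContDiffAt ℝ ∞ g p := by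
  let d := Module.finrank ℝ D
  have hd : d = Module.finrank ℝ (Fin d → ℝ) := (Module.finrank_fin_fun ℝ).symm
  let e₁ := ContinuousLinearEquiv.ofFinrankEq hd
  let e₂ := (e₁.arrowCongr (1 : F ≃L[ℝ] F)).trans (ContinuousLinearEquiv.piRing (Fin d))
  rw [← Function.id_comp g, ← e₂.symm_comp_self]
  exact e₂.symm.contDiff.contDiffAt.comp p (contDiffAt_pi.mpr fun i => h _)

lemma contDiffAt_koszul {E : Type*} [NormedAddCommGroup E] [NormedSpace ℝ E]
    {g : E3 → E3 →L[ℝ] E3 →L[ℝ] ℝ} {a u v : E → E3} {p : E}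
    (hg : ContDiffAt ℝ ∞ g (a p)) (ha : ContDiffAt ℝ ∞ a p) (hu : ContDiffAt ℝ ∞ u p)
    (hv : ContDiffAt ℝ ∞ v p) : ContDiffAt ℝ ∞ (fun q => koszul g (a q) (u q) (v q)) p := by
  refine contDiffAt_of_forall_apply fun Z => ?_
  have hD := (contDiffAt_fderiv hg).comp p ha
  have hZ : ContDiffAt ℝ ∞ (fun _ : E => Z) p := contDiffAt_const
  have := (((hD.clm_apply hu).clm_apply hv).clm_apply hZ).add
    (((hD.clm_apply hv).clm_apply hu).clm_apply hZ) |>.sub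
    (((hD.clm_apply hZ).clm_apply hu).clm_apply hv)
  refine (contDiffAt_const (c := (1 / 2 : ℝ)).mul this).congr_of_eventuallyEq
    (Eventually.of_forall fun q => ?_)
  simp [koszul]

lemma metric_isInvertible (hn : ∀ X : E3, (∀ Y : E3, metric f ν y X Y = 0) → X = 0) :
    (metric f ν y).IsInvertible := by
  have hi : Function.Injective (metric f ν y) := by
    rw [injective_iff_map_eq_zero]
    intro X hX
    exact hn X fun Y => by rw [hX]; rfl
  have e : (E3 →L[ℝ] ℝ) ≃ₗ[ℝ] (E3 →ₗ[ℝ] ℝ) := LinearMap.toContinuousLinearMap.symm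
  have hd : Module.finrank ℝ E3 = Module.finrank ℝ (E3 →L[ℝ] ℝ) := by
    rw [e.finrank_eq]; exact (Subspace.dual_finrank_eq (K := ℝ) (V := E3)).symm
  have : FiniteDimensional ℝ (E3 →L[ℝ] ℝ) := e.symm.finiteDimensional
  let F : E3 →ₗ[ℝ] (E3 →L[ℝ] ℝ) := (metric f ν y : E3 →ₗ[ℝ] (E3 →L[ℝ] ℝ))
  exact ⟨(F.linearEquivOfInjective hi hd).toContinuousLinearEquiv, by ext; rfl⟩

/-- Base point and arguments vary together, because the implicit function theorem will be applied to
an expression in both. -/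
lemma contDiffAt_differenceTensor {E : Type*} [NormedAddCommGroup E] [NormedSpace ℝ E]
    {a u v : E → E3} {p : E} (hf : ContDiffAt ℝ ∞ f (a p)) (hν : ContDiffAt ℝ ∞ ν (a p))
    (hi : (frame f ν (a p)).IsInvertible)
    (hn : ∀ X : E3, (∀ Y : E3, metric f ν (a p) X Y = 0) → X = 0)
    (ha : ContDiffAt ℝ ∞ a p) (hu : ContDiffAt ℝ ∞ u p) (hv : ContDiffAt ℝ ∞ v p) :
    ContDiffAt ℝ ∞ (fun q => differenceTensor f ν (a q) (u q) (v q)) p := by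
  have hm := contDiffAt_metric hf hν hi
  have h1 := (((contDiffAt_inducedChristoffel hf hν hi).comp p ha).clm_apply hu).clm_apply hv
  have h2 : ContDiffAt ℝ ∞ (fun q => (metric f ν (a q)).inverse) p :=
    ((metric_isInvertible hn).contDiffAt_map_inverse.comp (a p) hm).comp p ha
  exact h1.sub (h2.clm_apply (contDiffAt_koszul hm ha hu hv))

end Smoothness

/-! ### Symmetries -/

section Symmetry

variable {f ν : E3 → E4} {y : E3}

lemma fderiv_fderiv_symm {E F : Type*} [NormedAddCommGroup E] [NormedSpace ℝ E]
    [NormedAddCommGroup F] [NormedSpace ℝ F] {g : E → F} {x : E} (h : ContDiffAt ℝ ∞ g x)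
    (X Y : E) : fderiv ℝ (fderiv ℝ g) x X Y = fderiv ℝ (fderiv ℝ g) x Y X :=
  (h.isSymmSndFDerivAt (by simpa using WithTop.coe_le_coe.2 (le_top : (2 : ℕ∞) ≤ ⊤))).eq X Y

lemma metric_symm (hf : ContDiffAt ℝ ∞ f y) (X Y : E3) :
    metric f ν y X Y = metric f ν y Y X := by
  rw [metric_apply, metric_apply, fderiv_fderiv_symm hf]

lemma inducedChristoffel_symm (hf : ContDiffAt ℝ ∞ f y) (X Y : E3) :
    inducedChristoffel f ν y X Y = inducedChristoffel f ν y Y X := by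
  rw [inducedChristoffel_apply, inducedChristoffel_apply, fderiv_fderiv_symm hf]

lemma koszul_apply (g : E3 → E3 →L[ℝ] E3 →L[ℝ] ℝ) (y X Y Z : E3) :
    koszul g y X Y Z = 1 / 2 * (fderiv ℝ g y X Y Z + fderiv ℝ g y Y X Z - fderiv ℝ g y Z X Y) := by
  simp [koszul]

lemma metric_leviCivita (hn : ∀ X : E3, (∀ Y : E3, metric f ν y X Y = 0) → X = 0) (X Y Z : E3) :
    metric f ν y (leviCivitaChristoffel (metric f ν) y X Y) Z = koszul (metric f ν) y X Y Z := by
  rw [leviCivitaChristoffel, (metric_isInvertible hn).self_apply_inverse]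

/-- The difference tensor as a bilinear map. -/
def differenceBilin (f ν : E3 → E4) (y : E3) : E3 →ₗ[ℝ] E3 →ₗ[ℝ] E3 :=
  LinearMap.mk₂ ℝ (differenceTensor f ν y)
    (fun X X' Y => by
      have : koszul (metric f ν) y (X + X') Y =
          koszul (metric f ν) y X Y + koszul (metric f ν) y X' Y := by
        ext Z; simp only [koszul_apply, map_add, add_apply]; ring
      simp only [differenceTensor, leviCivitaChristoffel, this, map_add, add_apply]; abel)
    (fun c X Y => by
      have : koszul (metric f ν) y (c • X) Y = c • koszul (metric f ν) y X Y := by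
        ext Z
        simp only [koszul_apply, map_smul, smul_apply, smul_eq_mul]; ring
      simp only [differenceTensor, leviCivitaChristoffel, this, map_smul, smul_apply, smul_sub])
    (fun X Y Y' => by
      have : koszul (metric f ν) y X (Y + Y') =
          koszul (metric f ν) y X Y + koszul (metric f ν) y X Y' := by
        ext Z; simp only [koszul_apply, map_add, add_apply]; ring
      simp only [differenceTensor, leviCivitaChristoffel, this, map_add]; abel)
    (fun c X Y => by
      have : koszul (metric f ν) y X (c • Y) = c • koszul (metric f ν) y X Y := by
        ext Z
        simp only [koszul_apply, map_smul, smul_apply, smul_eq_mul]; ring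
      simp only [differenceTensor, leviCivitaChristoffel, this, map_smul, smul_sub])

lemma differenceBilin_apply (f ν : E3 → E4) (y X Y : E3) :
    differenceBilin f ν y X Y = differenceTensor f ν y X Y := rfl

lemma fderiv_metric_arg_symm (hf : ∀ᶠ z in 𝓝 y, ContDiffAt ℝ ∞ f z)
    (hν : ContDiffAt ℝ ∞ ν y) (hi : (frame f ν y).IsInvertible) (X Y Z : E3) :
    fderiv ℝ (metric f ν) y X Y Z = fderiv ℝ (metric f ν) y X Z Y := by
  have hm := differentiableAt_of_smooth (contDiffAt_metric hf.self_of_nhds hν hi)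
  have h1 : ∀ A B : E3, HasFDerivAt (fun z => metric f ν z A B)
      (((fderiv ℝ (metric f ν) y).flip A).flip B) y := fun A B => by
    convert! (hm.hasFDerivAt.clm_apply (hasFDerivAt_const A y)).clm_apply (hasFDerivAt_const B y)
      using 1
    ext W; simp
  have h2 : (fun z => metric f ν z Y Z) =ᶠ[𝓝 y] fun z => metric f ν z Z Y := by
    filter_upwards [hf] with z hz using metric_symm hz Y Z
  have := (h1 Y Z).unique ((h1 Z Y).congr_of_eventuallyEq h2)
  simpa using congrArg (fun L => L X) this

/-- The derivative of the metric is expressed by its Levi-Civita connection. -/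
lemma fderiv_metric (hf : ∀ᶠ z in 𝓝 y, ContDiffAt ℝ ∞ f z)
    (hν : ContDiffAt ℝ ∞ ν y) (hi : (frame f ν y).IsInvertible)
    (hn : ∀ X : E3, (∀ Y : E3, metric f ν y X Y = 0) → X = 0) (X Y Z : E3) :
    fderiv ℝ (metric f ν) y X Y Z =
      metric f ν y (leviCivitaChristoffel (metric f ν) y X Y) Z +
      metric f ν y Y (leviCivitaChristoffel (metric f ν) y X Z) := by
  have hs := fderiv_metric_arg_symm hf hν hi
  rw [metric_symm hf.self_of_nhds Y, metric_leviCivita hn, metric_leviCivita hn, koszul_apply,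
    koszul_apply, hs X Z Y, hs Y X Z, hs Z X Y]
  ring

/-- Both connections are torsion-free. -/
lemma differenceTensor_symm (hf : ∀ᶠ z in 𝓝 y, ContDiffAt ℝ ∞ f z)
    (hν : ContDiffAt ℝ ∞ ν y) (hi : (frame f ν y).IsInvertible) (X Y : E3) :
    differenceTensor f ν y X Y = differenceTensor f ν y Y X := by
  have : koszul (metric f ν) y X Y = koszul (metric f ν) y Y X := by
    ext Z
    rw [koszul_apply, koszul_apply, fderiv_metric_arg_symm hf hν hi Z X Y]
    ring
  rw [differenceTensor, differenceTensor, leviCivitaChristoffel, leviCivitaChristoffel, this,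
    inducedChristoffel_symm hf.self_of_nhds]

/-- This is the derivative of the Gauss formula. It needs an invertible frame on a neighbourhood,
since the formula is differentiated. -/
lemma third_derivative (hf : ∀ᶠ z in 𝓝 y, ContDiffAt ℝ ∞ f z)
    (hν : ContDiffAt ℝ ∞ ν y) (hi : ∀ᶠ z in 𝓝 y, (frame f ν z).IsInvertible) (X Y Z : E3) :
    fderiv ℝ (fderiv ℝ (fderiv ℝ f)) y X Y Z =
      fderiv ℝ (fderiv ℝ f) y X (inducedChristoffel f ν y Y Z) +
      fderiv ℝ f y (fderiv ℝ (inducedChristoffel f ν) y X Y Z) +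
      fderiv ℝ (metric f ν) y X Y Z • ν y + metric f ν y Y Z • fderiv ℝ ν y X := by
  have hf0 := hf.self_of_nhds
  have hi0 := hi.self_of_nhds
  have d1 := differentiableAt_of_smooth (contDiffAt_fderiv hf0)
  have d2 := differentiableAt_of_smooth (contDiffAt_fderiv (contDiffAt_fderiv hf0))
  have dm := differentiableAt_of_smooth (contDiffAt_metric hf0 hν hi0)
  have dΓ := differentiableAt_of_smooth (contDiffAt_inducedChristoffel hf0 hν hi0)
  have dν := differentiableAt_of_smooth hν
  have hY := hasFDerivAt_const (𝕜 := ℝ) Y y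
  have hZ := hasFDerivAt_const (𝕜 := ℝ) Z y
  have e1 := (d2.hasFDerivAt.clm_apply hY).clm_apply hZ
  have e2 := (d1.hasFDerivAt.clm_apply ((dΓ.hasFDerivAt.clm_apply hY).clm_apply hZ)).add
    (((dm.hasFDerivAt.clm_apply hY).clm_apply hZ).smul dν.hasFDerivAt)
  have h2 : (fun z => fderiv ℝ (fderiv ℝ f) z Y Z) =ᶠ[𝓝 y] fun z =>
      fderiv ℝ f z (inducedChristoffel f ν z Y Z) + metric f ν z Y Z • ν z := by
    filter_upwards [hi] with z hz using gauss_formula hz Y Z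
  have := congrArg (fun L => L X) (e1.unique (e2.congr_of_eventuallyEq h2))
  simp at this
  rw [this]
  abel

/-- Take the transversal part of the third derivative, which is symmetric in `X` and `Y`; the term
with the derivative of `ν` is tangential and disappears. -/
lemma codazzi_metric (hf : ∀ᶠ z in 𝓝 y, ContDiffAt ℝ ∞ f z)
    (hν : ContDiffAt ℝ ∞ ν y) (hi : ∀ᶠ z in 𝓝 y, (frame f ν z).IsInvertible)
    (ht : ∀ X : E3, fderiv ℝ ν y X ∈ (fderiv ℝ f y).range) (X Y Z : E3) :
    fderiv ℝ (metric f ν) y X Y Z + metric f ν y X (inducedChristoffel f ν y Y Z) =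
      fderiv ℝ (metric f ν) y Y X Z + metric f ν y Y (inducedChristoffel f ν y X Z) := by
  have hi0 := hi.self_of_nhds
  have key : ∀ A B : E3, transversal f ν y (fderiv ℝ (fderiv ℝ (fderiv ℝ f)) y A B Z) =
      fderiv ℝ (metric f ν) y A B Z + metric f ν y A (inducedChristoffel f ν y B Z) := by
    intro A B
    obtain ⟨W, hW⟩ := ht A
    have hW' : fderiv ℝ f y W = fderiv ℝ ν y A := hW
    rw [third_derivative hf hν hi, ← hW']
    simp only [map_add, map_smul, transversal_fderiv hi0, transversal_normal hi0, ← metric_apply,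
      smul_eq_mul]
    ring
  rw [← key, ← key, fderiv_fderiv_symm (contDiffAt_fderiv hf.self_of_nhds) X Y]

/-- The cubic form is totally symmetric. -/
lemma metric_differenceTensor_symm (hf : ∀ᶠ z in 𝓝 y, ContDiffAt ℝ ∞ f z)
    (hν : ContDiffAt ℝ ∞ ν y) (hi : ∀ᶠ z in 𝓝 y, (frame f ν z).IsInvertible)
    (hn : ∀ X : E3, (∀ Y : E3, metric f ν y X Y = 0) → X = 0)
    (ht : ∀ X : E3, fderiv ℝ ν y X ∈ (fderiv ℝ f y).range) (X Y Z : E3) :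
    metric f ν y (differenceTensor f ν y X Y) Z = metric f ν y (differenceTensor f ν y X Z) Y := by
  have hf0 := hf.self_of_nhds
  have hi0 := hi.self_of_nhds
  have hs := fderiv_metric_arg_symm hf hν hi0
  have hc := codazzi_metric hf hν hi ht
  have hm := metric_symm (ν := ν) hf0
  simp only [differenceTensor, map_sub, sub_apply, metric_leviCivita hn, koszul_apply]
  -- The two Koszul forms differ exactly by the antisymmetrized derivative of the metric that
  -- appears in this instance of the Codazzi equation.
  have h1 := hc Y Z X
  rw [inducedChristoffel_symm hf0 Z X, inducedChristoffel_symm hf0 Y X, hm Y, hm Z] at h1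
  linarith [hs X Y Z, hs Y X Z, hs Z X Y]

end Symmetry

/-! ### The model tensors -/

/-- The signs of the model metric. -/
def sgn : Fin 3 → ℝ := ![1, -1, -1]

/-- The structure constants of the model difference tensor. -/
def structConst : Fin 3 → Fin 3 → Fin 3 → ℝ :=
  ![![![0, 0, 0], ![0, 0, -1], ![0, -1, 0]],
    ![![0, 0, -1], ![0, 0, 0], ![1, 0, 0]],
    ![![0, -1, 0], ![1, 0, 0], ![0, 0, 0]]]

/-- A frame in which the metric and the difference tensor are multiples of the model tensors. -/
structure IsAdapted (h : E3 →L[ℝ] E3 →L[ℝ] ℝ) (K : E3 → E3 → E3) (σ l : ℝ) (e : Fin 3 → E3) :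
    Prop where
  metric_eq : ∀ i j, h (e i) (e j) = if i = j then σ * sgn i else 0
  diff_eq : ∀ i j, K (e i) (e j) = l • ∑ k, structConst i j k • e k

/-! ### Involutions of determinant one -/

/-- In dimension three, adj M = M² - (tr M) M + (tr adj M) 1. Here M is its own inverse and hence
its own adjugate, so this reads (tr M + 1)(M - 1) = 0; the proof checks it entry by entry. -/
lemma trace_of_involution_matrix {M : Matrix (Fin 3) (Fin 3) ℝ} (h2 : M * M = 1) (hd : M.det = 1)
    (h1 : M ≠ 1) : M.trace = -1 := by
  have ha : M.adjugate = M := by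
    have := M.mul_adjugate
    rw [hd, one_smul] at this
    calc M.adjugate = (M * M) * M.adjugate := by rw [h2, one_mul]
      _ = M := by rw [mul_assoc, this, mul_one]
  have ht : M.trace = M 0 0 + M 1 1 + M 2 2 := by simp [Matrix.trace, Fin.sum_univ_three]
  by_contra hne
  have hne' : M 0 0 + M 1 1 + M 2 2 + 1 ≠ 0 := fun h => hne (by rw [ht]; linarith)
  apply h1
  have hm : ∀ i j, M i 0 * M 0 j + M i 1 * M 1 j + M i 2 * M 2 j = if i = j then 1 else 0 := by
    intro i j
    have := congrFun (congrFun h2 i) j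
    rw [Matrix.mul_apply, Fin.sum_univ_three, Matrix.one_apply] at this
    exact this
  have haij : ∀ i j, M.adjugate i j = M i j := fun i j => by rw [ha]
  rw [Matrix.adjugate_fin_three] at haij
  have key : ∀ i j, (M 0 0 + M 1 1 + M 2 2 + 1) * (M i j - if i = j then 1 else 0) = 0 := by
    have a00 := haij 0 0
    have a01 := haij 0 1
    have a02 := haij 0 2
    have a10 := haij 1 0
    have a11 := haij 1 1
    have a12 := haij 1 2
    have a20 := haij 2 0
    have a21 := haij 2 1
    have a22 := haij 2 2
    simp at a00 a01 a02 a10 a11 a12 a20 a21 a22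
    intro i j
    have hij := hm i j
    fin_cases i <;> fin_cases j <;> simp [-mul_eq_zero] at hij ⊢ <;> linarith
  ext i j
  rw [Matrix.one_apply]
  have := (mul_eq_zero.1 (key i j)).resolve_left hne'
  linarith

lemma trace_of_involution {L : E3 ≃ₗ[ℝ] E3} (h2 : L * L = 1)
    (hd : LinearMap.det (L : E3 →ₗ[ℝ] E3) = 1) (h1 : L ≠ 1) :
    LinearMap.trace ℝ E3 (L : E3 →ₗ[ℝ] E3) = -1 := by
  let b := (EuclideanSpace.basisFun (Fin 3) ℝ).toBasis
  rw [LinearMap.trace_eq_matrix_trace ℝ b]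
  apply trace_of_involution_matrix
  · rw [← LinearMap.toMatrix_comp, ← LinearMap.toMatrix_id b]
    congr 1
    ext x : 1
    exact congrArg (fun N : E3 ≃ₗ[ℝ] E3 => N x) h2
  · rw [LinearMap.det_toMatrix, hd]
  · intro h
    apply h1
    rw [← LinearMap.toMatrix_id b] at h
    have := (LinearMap.toMatrix b b).injective h
    ext x : 1
    exact congrArg (fun N : E3 →ₗ[ℝ] E3 => N x) this

/-! ### Existence of adapted frames at a point -/

/-- An orthogonal frame that diagonalizes the difference tensor in the sense that products of
distinct members are multiples of the third one. -/
structure IsOrthogonalFrame (h : E3 →L[ℝ] E3 →L[ℝ] ℝ) (K : E3 →ₗ[ℝ] E3 →ₗ[ℝ] E3)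
    (v : Fin 3 → E3) : Prop where
  indep : LinearIndependent ℝ v
  orth : ∀ i j, i ≠ j → h (v i) (v j) = 0
  ne_zero : ∀ i, h (v i) (v i) ≠ 0
  diag : ∀ i, K (v i) (v i) = 0
  off_diag : ∀ i j k, i ≠ j → j ≠ k → i ≠ k → ∃ c : ℝ, K (v i) (v j) = c • v k

lemma IsOrthogonalFrame.perm {h : E3 →L[ℝ] E3 →L[ℝ] ℝ} {K : E3 →ₗ[ℝ] E3 →ₗ[ℝ] E3}
    {v : Fin 3 → E3} (H : IsOrthogonalFrame h K v) (π : Equiv.Perm (Fin 3)) :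
    IsOrthogonalFrame h K (v ∘ π) where
  indep := H.indep.comp π π.injective
  orth _ _ hij := H.orth _ _ (π.injective.ne hij)
  ne_zero _ := H.ne_zero _
  diag _ := H.diag _
  off_diag _ _ _ h1 h2 h3 :=
    H.off_diag _ _ _ (π.injective.ne h1) (π.injective.ne h2) (π.injective.ne h3)

lemma exists_combination {v : Fin 3 → E3} (hv : LinearIndependent ℝ v) (X : E3) :
    ∃ a : Fin 3 → ℝ, X = ∑ i, a i • v i := by
  let b := basisOfLinearIndependentOfCardEqFinrank hv (by simp)
  refine ⟨fun i => b.repr X i, ?_⟩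
  conv_lhs => rw [← b.sum_repr X]
  simp [b]

/-- The operator 1 + aL + bN + abLN is four times the projection onto the joint eigenspace, and its
trace is 3 - a - b - ab. Only the trivial character a = b = 1 gives zero. -/
lemma exists_common_eigenvector {L N : E3 ≃ₗ[ℝ] E3} {a b : ℝ} (ha : a * a = 1) (hb : b * b = 1)
    (hL : L * L = 1) (hN : N * N = 1) (hc : L * N = N * L)
    (ht : LinearMap.trace ℝ E3 (L : E3 →ₗ[ℝ] E3) = -1)
    (ht' : LinearMap.trace ℝ E3 (N : E3 →ₗ[ℝ] E3) = -1)
    (ht'' : LinearMap.trace ℝ E3 ((L * N : E3 ≃ₗ[ℝ] E3) : E3 →ₗ[ℝ] E3) = -1)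
    (hne : 3 - a - b - a * b ≠ 0) : ∃ v : E3, v ≠ 0 ∧ L v = a • v ∧ N v = b • v := by
  let P : E3 →ₗ[ℝ] E3 := LinearMap.id + a • (L : E3 →ₗ[ℝ] E3) + b • (N : E3 →ₗ[ℝ] E3) +
    (a * b) • ((L * N : E3 ≃ₗ[ℝ] E3) : E3 →ₗ[ℝ] E3)
  have hP : LinearMap.trace ℝ E3 P ≠ 0 := by
    simp only [P, map_add, map_smul, ht, ht', ht'', LinearMap.trace_id]
    simp only [finrank_euclideanSpace, Fintype.card_fin, smul_eq_mul]
    intro h; apply hne; push_cast at h; linarith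
  have hP' : P ≠ 0 := fun h => hP (by rw [h, map_zero])
  obtain ⟨x, hx⟩ : ∃ x, P x ≠ 0 := by
    by_contra! h
    exact hP' (LinearMap.ext h)
  have hLx : ∀ x, L (L x) = x := fun x => congrArg (fun M : E3 ≃ₗ[ℝ] E3 => M x) hL
  have hNx : ∀ x, N (N x) = x := fun x => congrArg (fun M : E3 ≃ₗ[ℝ] E3 => M x) hN
  have hcx : ∀ x, N (L x) = L (N x) := fun x =>
    congrArg (fun M : E3 ≃ₗ[ℝ] E3 => M x) hc.symm
  have hPx : P x = x + a • L x + b • N x + (a * b) • L (N x) := rfl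
  refine ⟨P x, hx, ?_, ?_⟩
  · rw [hPx]
    simp only [map_add, map_smul, hLx, smul_add, smul_smul, ← mul_assoc, ha, one_mul, one_smul]
    abel
  · rw [hPx]
    simp only [map_add, map_smul, hNx, hcx, smul_add, smul_smul]
    rw [show b * (a * b) = a by linear_combination a * hb, hb, mul_comm b a, one_smul]
    abel

/-- Two commuting symmetries of order two give an orthogonal frame. -/
lemma exists_orthogonalFrame {h : E3 →L[ℝ] E3 →L[ℝ] ℝ} {K : E3 →ₗ[ℝ] E3 →ₗ[ℝ] E3}
    (hn : ∀ X, (∀ Y, h X Y = 0) → X = 0) {L N : E3 ≃ₗ[ℝ] E3}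
    (hL : L * L = 1) (hN : N * N = 1) (hc : L * N = N * L)
    (hL1 : L ≠ 1) (hN1 : N ≠ 1) (hLN : L * N ≠ 1)
    (dL : LinearMap.det (L : E3 →ₗ[ℝ] E3) = 1) (dN : LinearMap.det (N : E3 →ₗ[ℝ] E3) = 1)
    (mL : ∀ X Y, h (L X) (L Y) = h X Y) (mN : ∀ X Y, h (N X) (N Y) = h X Y)
    (kL : ∀ X Y, K (L X) (L Y) = L (K X Y)) (kN : ∀ X Y, K (N X) (N Y) = N (K X Y)) :
    ∃ v, IsOrthogonalFrame h K v := by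
  have dLN : LinearMap.det ((L * N : E3 ≃ₗ[ℝ] E3) : E3 →ₗ[ℝ] E3) = 1 := by
    rw [show ((L * N : E3 ≃ₗ[ℝ] E3) : E3 →ₗ[ℝ] E3) = (L : E3 →ₗ[ℝ] E3) ∘ₗ (N : E3 →ₗ[ℝ] E3) from
      rfl, LinearMap.det_comp, dL, dN, one_mul]
  have hLN2 : (L * N) * (L * N) = 1 := by
    nth_rewrite 2 [hc]
    rw [mul_assoc, ← mul_assoc N N, hN, one_mul, hL]
  have tL := trace_of_involution hL dL hL1
  have tN := trace_of_involution hN dN hN1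
  have tLN := trace_of_involution hLN2 dLN hLN
  -- The three nontrivial characters each occur, so by dimension each occurs once and the trivial
  -- one does not.
  obtain ⟨v0, h0, L0, N0⟩ := exists_common_eigenvector (a := 1) (b := -1) (by norm_num)
    (by norm_num) hL hN hc tL tN tLN (by norm_num)
  obtain ⟨v1, h1, L1, N1⟩ := exists_common_eigenvector (a := -1) (b := 1) (by norm_num)
    (by norm_num) hL hN hc tL tN tLN (by norm_num)
  obtain ⟨v2, h2, L2, N2⟩ := exists_common_eigenvector (a := -1) (b := -1) (by norm_num)
    (by norm_num) hL hN hc tL tN tLN (by norm_num)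
  simp only [one_smul, neg_smul] at L0 L1 L2 N0 N1 N2
  have indep : LinearIndependent ℝ ![v0, v1, v2] := by
    rw [Fintype.linearIndependent_iff]
    intro g hg
    rw [Fin.sum_univ_three] at hg
    change g 0 • v0 + g 1 • v1 + g 2 • v2 = 0 at hg
    have eL := congrArg L hg
    have eN := congrArg N hg
    simp only [map_add, map_smul, L0, L1, L2, N0, N1, N2, map_zero] at eL eN
    have g0 : g 0 • v0 = 0 := by
      have : (2 : ℝ) • (g 0 • v0) = 0 := by
        linear_combination (norm := module) hg + eL
      simpa using this
    have g1 : g 1 • v1 = 0 := by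
      have : (2 : ℝ) • (g 1 • v1) = 0 := by
        linear_combination (norm := module) hg + eN
      simpa using this
    have g2 : g 2 • v2 = 0 := by rw [g0, g1] at hg; simpa using hg
    have := (smul_eq_zero.1 g0).resolve_right h0
    have := (smul_eq_zero.1 g1).resolve_right h1
    have := (smul_eq_zero.1 g2).resolve_right h2
    intro i; fin_cases i <;> assumption
  have comb : ∀ X, ∃ a b c : ℝ, X = a • v0 + b • v1 + c • v2 := by
    intro X
    obtain ⟨a, ha⟩ := exists_combination indep X
    exact ⟨a 0, a 1, a 2, by simpa [Fin.sum_univ_three] using ha⟩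
  have zero_of : ∀ {a : ℝ} {w : E3}, w ≠ 0 → a • w = 0 → a = 0 := fun hw h =>
    (smul_eq_zero.1 h).resolve_right hw
  -- joint eigenspaces
  have E0 : ∀ X, L X = X → N X = X → X = 0 := by
    intro X hX hX'
    obtain ⟨a, b, c, rfl⟩ := comb X
    simp only [map_add, map_smul, L0, L1, L2, N0, N1, N2] at hX hX'
    have e := Fintype.linearIndependent_iff.1 indep ![0, -2 * b, -2 * c] (by
      simp [Fin.sum_univ_three]; linear_combination (norm := module) hX)
    have e' := Fintype.linearIndependent_iff.1 indep ![-2 * a, 0, -2 * c] (by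
      simp [Fin.sum_univ_three]; linear_combination (norm := module) hX')
    have q0 := e' 0; have q1 := e 1; have q2 := e 2
    simp at q0 q1 q2
    simp [q0, q1, q2]
  have E1 : ∀ X, L X = X → N X = -X → ∃ c : ℝ, X = c • v0 := by
    intro X hX hX'
    obtain ⟨a, b, c, rfl⟩ := comb X
    simp only [map_add, map_smul, L0, L1, L2, N0, N1, N2] at hX hX'
    have e := Fintype.linearIndependent_iff.1 indep ![0, -2 * b, -2 * c] (by
      simp [Fin.sum_univ_three]; linear_combination (norm := module) hX)
    have q1 := e 1; have q2 := e 2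
    simp at q1 q2
    exact ⟨a, by simp [q1, q2]⟩
  have E2 : ∀ X, L X = -X → N X = X → ∃ c : ℝ, X = c • v1 := by
    intro X hX hX'
    obtain ⟨a, b, c, rfl⟩ := comb X
    simp only [map_add, map_smul, L0, L1, L2, N0, N1, N2] at hX hX'
    have e := Fintype.linearIndependent_iff.1 indep ![-2 * a, 0, -2 * c] (by
      simp [Fin.sum_univ_three]; linear_combination (norm := module) hX')
    have q1 := e 0; have q2 := e 2
    simp at q1 q2
    exact ⟨b, by simp [q1, q2]⟩
  have E3' : ∀ X, L X = -X → N X = -X → ∃ c : ℝ, X = c • v2 := by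
    intro X hX hX'
    obtain ⟨a, b, c, rfl⟩ := comb X
    simp only [map_add, map_smul, L0, L1, L2, N0, N1, N2] at hX hX'
    have e := Fintype.linearIndependent_iff.1 indep ![2 * a, 0, 0] (by
      simp [-smul_eq_zero, -mul_eq_zero, Fin.sum_univ_three]
      linear_combination (norm := module) hX)
    have e' := Fintype.linearIndependent_iff.1 indep ![0, 2 * b, 0] (by
      simp [-smul_eq_zero, -mul_eq_zero, Fin.sum_univ_three]
      linear_combination (norm := module) hX')
    have q1 := e 0; have q2 := e' 1
    simp at q1 q2
    exact ⟨c, by simp [q1, q2]⟩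
  have o01 : h v0 v1 = 0 ∧ h v1 v0 = 0 := by
    have := mL v0 v1; have := mL v1 v0
    simp only [L0, L1, map_neg, neg_apply] at *
    constructor <;> linarith
  have o02 : h v0 v2 = 0 ∧ h v2 v0 = 0 := by
    have := mL v0 v2; have := mL v2 v0
    simp only [L0, L2, map_neg, neg_apply] at *
    constructor <;> linarith
  have o12 : h v1 v2 = 0 ∧ h v2 v1 = 0 := by
    have := mN v1 v2; have := mN v2 v1
    simp only [N1, N2, map_neg, neg_apply] at *
    constructor <;> linarith
  refine ⟨![v0, v1, v2], indep, ?_, ?_, ?_, ?_⟩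
  · intro i j hij
    fin_cases i <;> fin_cases j <;> simp [o01, o02, o12] at hij ⊢
  · intro i hi
    have hall : ∀ Y, h (![v0, v1, v2] i) Y = 0 := by
      intro Y
      obtain ⟨a, b, c, rfl⟩ := comb Y
      fin_cases i <;> simp [o01, o02, o12] at hi ⊢ <;> simp [hi]
    have := hn _ hall
    fin_cases i <;> simp at this <;> contradiction
  · intro i
    -- The signs square away, so the product is fixed by both symmetries.
    apply E0
    · rw [← kL]; fin_cases i <;> simp [L0, L1, L2]
    · rw [← kN]; fin_cases i <;> simp [N0, N1, N2]
  · intro i j k hij hjk hik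
    -- The product of two distinct nontrivial characters is the third, so the image lies in the
    -- third eigenline.
    fin_cases i <;> fin_cases j <;> fin_cases k <;> first
      | (exfalso; revert hij hjk hik; decide)
      | (apply E1 <;> [rw [← kL]; rw [← kN]] <;> simp [L1, L2, N1, N2])
      | (apply E2 <;> [rw [← kL]; rw [← kN]] <;> simp [L0, L2, N0, N2])
      | (apply E3' <;> [rw [← kL]; rw [← kN]] <;> simp [L0, L1, N0, N1])

lemma bilin_ext_of_indep {K K' : E3 →ₗ[ℝ] E3 →ₗ[ℝ] E3} {v : Fin 3 → E3}
    (hv : LinearIndependent ℝ v) (h : ∀ i j, K (v i) (v j) = K' (v i) (v j)) : K = K' := by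
  let b := basisOfLinearIndependentOfCardEqFinrank hv (by simp)
  refine b.ext fun i => b.ext fun j => ?_
  simpa [b] using h i j

lemma clm_bilin_ext_of_indep {h h' : E3 →L[ℝ] E3 →L[ℝ] ℝ} {v : Fin 3 → E3}
    (hv : LinearIndependent ℝ v) (hh : ∀ i j, h (v i) (v j) = h' (v i) (v j)) (X Y : E3) :
    h X Y = h' X Y := by
  obtain ⟨a, rfl⟩ := exists_combination hv X
  obtain ⟨b, rfl⟩ := exists_combination hv Y
  simp only [map_sum, map_smul, sum_apply, smul_apply, hh]

lemma IsOrthogonalFrame.smul {h : E3 →L[ℝ] E3 →L[ℝ] ℝ} {K : E3 →ₗ[ℝ] E3 →ₗ[ℝ] E3}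
    {v : Fin 3 → E3} (H : IsOrthogonalFrame h K v) {a : Fin 3 → ℝ} (ha : ∀ i, a i ≠ 0) :
    IsOrthogonalFrame h K fun i => a i • v i where
  indep := H.indep.units_smul fun i => Units.mk0 (a i) (ha i)
  orth i j hij := by simp [H.orth i j hij]
  ne_zero i := by simp [H.ne_zero i, ha i]
  diag i := by simp [H.diag i]
  off_diag i j k h1 h2 h3 := by
    obtain ⟨c, hc⟩ := H.off_diag i j k h1 h2 h3
    refine ⟨a i * (a j * c) * (a k)⁻¹, ?_⟩
    simp only [map_smul, LinearMap.smul_apply, hc, smul_smul]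
    rw [inv_mul_cancel_right₀ (ha k), mul_left_comm]

/-- A normalized orthogonal frame is adapted. -/
lemma IsOrthogonalFrame.isAdapted {h : E3 →L[ℝ] E3 →L[ℝ] ℝ} {K : E3 →ₗ[ℝ] E3 →ₗ[ℝ] E3}
    (hKs : ∀ X Y, K X Y = K Y X) (hC : ∀ X Y Z, h (K X Y) Z = h (K X Z) Y)
    {e : Fin 3 → E3} (H : IsOrthogonalFrame h K e) {σ : ℝ} (hσ2 : σ * σ = 1)
    (hs : ∀ i, h (e i) (e i) = σ * sgn i) :
    ∃ l, IsAdapted h (fun X Y => K X Y) σ l e := by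
  have hm : ∀ i j, h (e i) (e j) = if i = j then σ * sgn i else 0 := by
    intro i j
    split_ifs with hij
    · subst hij; exact hs i
    · exact H.orth i j hij
  obtain ⟨l, hl⟩ := H.off_diag 1 2 0 (by decide) (by decide) (by decide)
  obtain ⟨l1, hl1⟩ := H.off_diag 0 1 2 (by decide) (by decide) (by decide)
  obtain ⟨l2, hl2⟩ := H.off_diag 0 2 1 (by decide) (by decide) (by decide)
  have e1 : l1 = -l := by
    -- Total symmetry compares the components along `e 2` and `e 0`; these have opposite signs in
    -- the metric, hence the minus.
    have := hC (e 1) (e 0) (e 2)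
    rw [hKs (e 1) (e 0), hl, hl1] at this
    simp only [map_smul, smul_apply, hm] at this
    simp [sgn] at this
    linear_combination (-σ) * this + (-l1 - l) * hσ2
  have e2 : l2 = -l := by
    have := hC (e 2) (e 0) (e 1)
    rw [hKs (e 2) (e 0), hKs (e 2) (e 1), hl, hl2] at this
    simp only [map_smul, smul_apply, hm] at this
    simp [sgn] at this
    linear_combination (-σ) * this + (-l2 - l) * hσ2
  subst e1 e2
  refine ⟨l, hm, ?_⟩
  intro i j
  have hl' := (hKs (e 2) (e 1)).trans hl
  have hl1' := (hKs (e 1) (e 0)).trans hl1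
  have hl2' := (hKs (e 2) (e 0)).trans hl2
  fin_cases i <;> fin_cases j <;>
    simp [structConst, Fin.sum_univ_three, H.diag, hl, hl1, hl2, hl', hl1', hl2']

/-- Normalization of an orthogonal frame with the right signs. -/
lemma exists_adapted_of_signs {h : E3 →L[ℝ] E3 →L[ℝ] ℝ} {K : E3 →ₗ[ℝ] E3 →ₗ[ℝ] E3}
    (hKs : ∀ X Y, K X Y = K Y X) (hC : ∀ X Y Z, h (K X Y) Z = h (K X Z) Y)
    {v : Fin 3 → E3} (H : IsOrthogonalFrame h K v) {σ : ℝ} (hσ : σ = 1 ∨ σ = -1)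
    (s0 : 0 < σ * h (v 0) (v 0)) (s1 : σ * h (v 1) (v 1) < 0) (s2 : σ * h (v 2) (v 2) < 0) :
    ∃ l e, IsAdapted h (fun X Y => K X Y) σ l e := by
  have hσ2 : σ * σ = 1 := by rcases hσ with rfl | rfl <;> norm_num
  let a : Fin 3 → ℝ := fun i => (Real.sqrt |h (v i) (v i)|)⁻¹
  have ha : ∀ i, a i ≠ 0 := fun i =>
    inv_ne_zero (Real.sqrt_ne_zero'.2 (abs_pos.2 (H.ne_zero i)))
  have ha2 : ∀ i, a i * a i * |h (v i) (v i)| = 1 := fun i => by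
    have := Real.mul_self_sqrt (abs_nonneg (h (v i) (v i)))
    simp only [a]
    rw [← mul_inv, this, inv_mul_cancel₀ (abs_ne_zero.2 (H.ne_zero i))]
  have habs : ∀ i, |h (v i) (v i)| = σ * sgn i * h (v i) (v i) := by
    have h1 : ∀ x : ℝ, |x| = |σ * x| := fun x => by
      rw [abs_mul]; rcases hσ with rfl | rfl <;> simp
    intro i
    rw [h1]
    fin_cases i
    · simp [sgn, abs_of_pos s0]
    · simp [sgn, abs_of_neg s1]
    · simp [sgn, abs_of_neg s2]
  have hs : ∀ i, h (a i • v i) (a i • v i) = σ * sgn i := by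
    intro i
    simp only [map_smul, smul_apply, smul_eq_mul]
    have h1 := ha2 i
    rw [habs] at h1
    have h2 : sgn i * sgn i = 1 := by fin_cases i <;> simp [sgn]
    linear_combination (σ * sgn i) * h1 - (a i * a i * h (v i) (v i)) * sgn i * sgn i * hσ2 -
      (a i * a i * h (v i) (v i)) * h2
  obtain ⟨l, hl⟩ := (H.smul ha).isAdapted hKs hC hσ2 hs
  exact ⟨l, _, hl⟩

lemma IsAdapted.linearIndependent {h : E3 →L[ℝ] E3 →L[ℝ] ℝ} {K : E3 → E3 → E3} {σ l : ℝ}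
    {e : Fin 3 → E3} (H : IsAdapted h K σ l e) (hσ : σ ≠ 0) : LinearIndependent ℝ e := by
  rw [Fintype.linearIndependent_iff]
  intro g hg i
  have := congrArg (fun X => h X (e i)) hg
  simp only [map_sum, map_smul, sum_apply, smul_apply, H.metric_eq, map_zero, zero_apply,
    smul_eq_mul, mul_ite, mul_zero, Finset.sum_ite_eq', Finset.mem_univ, if_true] at this
  have h0 : σ * sgn i ≠ 0 := mul_ne_zero hσ (by fin_cases i <;> simp [sgn])
  exact (mul_eq_zero.1 this).resolve_right h0

lemma IsAdapted.isOrthogonalFrame {h : E3 →L[ℝ] E3 →L[ℝ] ℝ} {K : E3 →ₗ[ℝ] E3 →ₗ[ℝ] E3} {σ l : ℝ}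
    {e : Fin 3 → E3} (H : IsAdapted h (fun X Y => K X Y) σ l e) (hσ : σ ≠ 0) :
    IsOrthogonalFrame h K e where
  indep := H.linearIndependent hσ
  orth i j hij := by rw [H.metric_eq, if_neg hij]
  ne_zero i := by
    rw [H.metric_eq, if_pos rfl]
    exact mul_ne_zero hσ (by fin_cases i <;> simp [sgn])
  diag i := by
    have : K (e i) (e i) = _ := H.diff_eq i i
    rw [this]
    fin_cases i <;> simp [structConst, Fin.sum_univ_three]
  off_diag i j k h1 h2 h3 := by
    refine ⟨l * structConst i j k, ?_⟩
    have : K (e i) (e j) = _ := H.diff_eq i j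
    rw [this, Fin.sum_univ_three]
    fin_cases i <;> fin_cases j <;> fin_cases k <;> first
      | (exfalso; revert h1 h2 h3; decide)
      | simp [structConst]

/-- If the difference tensor vanishes there is a symmetry of order four. -/
lemma exists_rotation {h : E3 →L[ℝ] E3 →L[ℝ] ℝ} {K : E3 →ₗ[ℝ] E3 →ₗ[ℝ] E3} {σ : ℝ} (hσ : σ ≠ 0)
    {e : Fin 3 → E3} (H : IsAdapted h (fun X Y => K X Y) σ 0 e) :
    ∃ R : E3 ≃ₗ[ℝ] E3, LinearMap.det (R : E3 →ₗ[ℝ] E3) = 1 ∧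
      (∀ X Y, h (R X) (R Y) = h X Y) ∧ (∀ X Y, K (R X) (R Y) = R (K X Y)) ∧ R * R ≠ 1 := by
  have he := H.linearIndependent hσ
  let b := basisOfLinearIndependentOfCardEqFinrank he (by simp)
  have hb : ∀ i, b i = e i := fun i => by simp [b]
  -- A quarter turn of the plane of `e 1` and `e 2`, on which the metric is definite.
  let N : Matrix (Fin 3) (Fin 3) ℝ := !![1, 0, 0; 0, 0, -1; 0, 1, 0]
  let R₀ := Matrix.toLin b b N
  have hdet : LinearMap.det R₀ = 1 := by
    rw [LinearMap.det_toLin]; simp [N, Matrix.det_fin_three]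
  have hR : ∀ j, R₀ (e j) = ∑ i, N i j • e i := fun j => by
    rw [← hb, Matrix.toLin_self]; simp [hb]
  have R0 : R₀ (e 0) = e 0 := by rw [hR]; simp [N, Fin.sum_univ_three]
  have R1 : R₀ (e 1) = e 2 := by rw [hR]; simp [N, Fin.sum_univ_three]
  have R2 : R₀ (e 2) = -e 1 := by rw [hR]; simp [N, Fin.sum_univ_three]
  let R := LinearMap.equivOfDetNeZero R₀ (by rw [hdet]; exact one_ne_zero)
  have hRR : ∀ X, R X = R₀ X := fun X => rfl
  have hK : K = 0 := bilin_ext_of_indep he fun i j => by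
    rw [show K (e i) (e j) = _ from H.diff_eq i j]; simp
  refine ⟨R, ?_, ?_, ?_, ?_⟩
  · exact hdet
  · intro X Y
    have := clm_bilin_ext_of_indep (h := (h.bilinearComp (LinearMap.toContinuousLinearMap R₀)
      (LinearMap.toContinuousLinearMap R₀))) (h' := h) he (fun i j => by
        simp only [ContinuousLinearMap.bilinearComp_apply, LinearMap.coe_toContinuousLinearMap']
        fin_cases i <;> fin_cases j <;> simp [R0, R1, R2, H.metric_eq, sgn]) X Y
    change h (R₀ X) (R₀ Y) = h X Y
    simpa using this
  · intro X Y; simp [hK]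
  · intro hRR1
    have h1 : R (R (e 1)) = e 1 := congrArg (fun M : E3 ≃ₗ[ℝ] E3 => M (e 1)) hRR1
    rw [hRR, hRR, R1, R2] at h1
    have h2 : (2 : ℝ) • e 1 = 0 := by
      rw [two_smul]; nth_rewrite 1 [← h1]; simp
    have h3 : e 1 = 0 := by simpa using h2
    exact he.ne_zero 1 h3

/-- Pointwise classification of symmetric cubic forms with symmetry group `ℤ₂ × ℤ₂`. -/
theorem exists_adapted {h : E3 →L[ℝ] E3 →L[ℝ] ℝ} {K : E3 →ₗ[ℝ] E3 →ₗ[ℝ] E3}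
    (hn : ∀ X, (∀ Y, h X Y = 0) → X = 0) (hpos : ∃ X, 0 < h X X) (hneg : ∃ X, h X X < 0)
    (hKs : ∀ X Y, K X Y = K Y X) (hC : ∀ X Y Z, h (K X Y) Z = h (K X Z) Y)
    (G : Subgroup (E3 ≃ₗ[ℝ] E3))
    (hG : ∀ L : E3 ≃ₗ[ℝ] E3, L ∈ G ↔ LinearMap.det (L : E3 →ₗ[ℝ] E3) = 1 ∧
      (∀ X Y, h (L X) (L Y) = h X Y) ∧ (∀ X Y, K (L X) (L Y) = L (K X Y)))
    (hiso : Nonempty (G ≃* Multiplicative (ZMod 2) × Multiplicative (ZMod 2))) :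
    ∃ σ l e, (σ = 1 ∨ σ = -1) ∧ l ≠ 0 ∧ IsAdapted h (fun X Y => K X Y) σ l e := by
  obtain ⟨ψ⟩ := hiso
  have hsq : ∀ L ∈ G, L * L = 1 := by
    intro L hL
    have h1 : ∀ z : Multiplicative (ZMod 2) × Multiplicative (ZMod 2), z * z = 1 := by decide
    have h2 : (⟨L, hL⟩ : G) * ⟨L, hL⟩ = 1 := ψ.injective (by rw [map_mul, h1, map_one])
    exact congrArg Subtype.val h2
  obtain ⟨a, b, hab, ha, hb⟩ : ∃ a b : Multiplicative (ZMod 2) × Multiplicative (ZMod 2),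
    a * b ≠ 1 ∧ a ≠ 1 ∧ b ≠ 1 := by decide
  have hne : ∀ z, z ≠ 1 → ((ψ.symm z : G) : E3 ≃ₗ[ℝ] E3) ≠ 1 := by
    intro z hz h1
    apply hz
    have : ψ.symm z = 1 := Subtype.ext h1
    simpa using this
  have hL := (hG _).1 (ψ.symm a).2
  have hN := (hG _).1 (ψ.symm b).2
  obtain ⟨v, hv⟩ := exists_orthogonalFrame hn (hsq _ (ψ.symm a).2) (hsq _ (ψ.symm b).2)
    (by
      have : ψ.symm a * ψ.symm b = ψ.symm b * ψ.symm a := by rw [← map_mul, mul_comm, map_mul]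
      exact congrArg Subtype.val this)
    (hne a ha) (hne b hb)
    (by have := hne _ hab; rwa [map_mul] at this) hL.1 hN.1 hL.2.1 hN.2.1 hL.2.2 hN.2.2
  have hquad : ∀ X, ∃ a : Fin 3 → ℝ, h X X = a 0 ^ 2 * h (v 0) (v 0) + a 1 ^ 2 * h (v 1) (v 1) +
      a 2 ^ 2 * h (v 2) (v 2) := by
    intro X
    obtain ⟨a, rfl⟩ := exists_combination hv.indep X
    refine ⟨a, ?_⟩
    simp only [Fin.sum_univ_three, map_add, map_smul, add_apply, smul_apply, smul_eq_mul,
      hv.orth 0 1 (by decide), hv.orth 0 2 (by decide), hv.orth 1 0 (by decide),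
      hv.orth 1 2 (by decide), hv.orth 2 0 (by decide), hv.orth 2 1 (by decide)]
    ring
  -- One of the three signs differs from the other two. The permutation moves it to the front and
  -- `σ` makes it positive.
  have key : ∃ (σ : ℝ) (π : Equiv.Perm (Fin 3)), (σ = 1 ∨ σ = -1) ∧
      0 < σ * h (v (π 0)) (v (π 0)) ∧ σ * h (v (π 1)) (v (π 1)) < 0 ∧
      σ * h (v (π 2)) (v (π 2)) < 0 := by
    obtain ⟨P, hP⟩ := hpos
    obtain ⟨M, hM⟩ := hneg
    obtain ⟨p, hp⟩ := hquad P
    obtain ⟨m, hm⟩ := hquad M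
    rcases lt_or_gt_of_ne (hv.ne_zero 0) with h0 | h0 <;>
    rcases lt_or_gt_of_ne (hv.ne_zero 1) with h1 | h1 <;>
    rcases lt_or_gt_of_ne (hv.ne_zero 2) with h2 | h2
    · exfalso; nlinarith [sq_nonneg (p 0), sq_nonneg (p 1), sq_nonneg (p 2)]
    · exact ⟨1, Equiv.swap 0 2, Or.inl rfl, by simpa using h2, by
        rw [Equiv.swap_apply_of_ne_of_ne (by decide) (by decide)]; simpa using h1,
        by simpa using h0⟩
    · exact ⟨1, Equiv.swap 0 1, Or.inl rfl, by simpa using h1, by simpa using h0, by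
        rw [Equiv.swap_apply_of_ne_of_ne (by decide) (by decide)]; simpa using h2⟩
    · exact ⟨-1, 1, Or.inr rfl, by simpa using h0, by simpa using h1, by simpa using h2⟩
    · exact ⟨1, 1, Or.inl rfl, by simpa using h0, by simpa using h1, by simpa using h2⟩
    · exact ⟨-1, Equiv.swap 0 1, Or.inr rfl, by simpa using h1, by simpa using h0, by
        rw [Equiv.swap_apply_of_ne_of_ne (by decide) (by decide)]; simpa using h2⟩
    · exact ⟨-1, Equiv.swap 0 2, Or.inr rfl, by simpa using h2, by
        rw [Equiv.swap_apply_of_ne_of_ne (by decide) (by decide)]; simpa using h1,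
        by simpa using h0⟩
    · exfalso; nlinarith [sq_nonneg (m 0), sq_nonneg (m 1), sq_nonneg (m 2)]
  obtain ⟨σ, π, hσ, t0, t1, t2⟩ := key
  obtain ⟨l, e, he⟩ := exists_adapted_of_signs hKs hC (hv.perm π) hσ t0 t1 t2
  refine ⟨σ, l, e, hσ, ?_, he⟩
  -- With `l = 0` the quarter turn would lie in `G`, where every element squares to the identity.
  rintro rfl
  obtain ⟨R, r1, r2, r3, r4⟩ := exists_rotation (by rcases hσ with rfl | rfl <;> norm_num) he
  exact r4 (hsq R ((hG R).2 ⟨r1, r2, r3⟩))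

/-! ### Smooth adapted frames -/

/-- The local data of an indefinite affine hypersphere with shape operator `H • id`. -/
structure IsLocalSphere (f ν : E3 → E4) (U : Set E3) (H : ℝ) : Prop where
  isOpen : IsOpen U
  smooth : ∀ y ∈ U, ContDiffAt ℝ ∞ f y
  smooth_normal : ∀ y ∈ U, ContDiffAt ℝ ∞ ν y
  indefinite : ∀ y ∈ U, IsIndefiniteAt f ν y
  weingarten : ∀ y ∈ U, ∀ X, fderiv ℝ ν y X = -(H • fderiv ℝ f y X)

namespace IsLocalSphere

variable {f ν : E3 → E4} {U : Set E3} {H : ℝ} {y : E3}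

lemma eventually_mem (S : IsLocalSphere f ν U H) (hy : y ∈ U) : ∀ᶠ z in 𝓝 y, z ∈ U :=
  S.isOpen.mem_nhds hy

lemma eventually_smooth (S : IsLocalSphere f ν U H) (hy : y ∈ U) :
    ∀ᶠ z in 𝓝 y, ContDiffAt ℝ ∞ f z :=
  (S.eventually_mem hy).mono S.smooth

lemma frame_invertible (S : IsLocalSphere f ν U H) (hy : y ∈ U) : (frame f ν y).IsInvertible := by
  obtain ⟨X, hX⟩ := (S.indefinite y hy).exists_pos
  exact frame_isInvertible_of_metric_ne_zero hX.ne'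

lemma eventually_invertible (S : IsLocalSphere f ν U H) (hy : y ∈ U) :
    ∀ᶠ z in 𝓝 y, (frame f ν z).IsInvertible :=
  (S.eventually_mem hy).mono fun _ h => S.frame_invertible h

lemma tangent (S : IsLocalSphere f ν U H) (hy : y ∈ U) (X : E3) :
    fderiv ℝ ν y X ∈ (fderiv ℝ f y).range :=
  ⟨-(H • X), by simp [S.weingarten y hy]⟩

lemma differenceTensor_symm (S : IsLocalSphere f ν U H) (hy : y ∈ U) (X Y : E3) :
    differenceTensor f ν y X Y = differenceTensor f ν y Y X :=
  AffineSphere.differenceTensor_symm (S.eventually_smooth hy) (S.smooth_normal y hy)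
    (S.frame_invertible hy) X Y

lemma cubic_symm (S : IsLocalSphere f ν U H) (hy : y ∈ U) (X Y Z : E3) :
    metric f ν y (differenceTensor f ν y X Y) Z = metric f ν y (differenceTensor f ν y X Z) Y :=
  metric_differenceTensor_symm (S.eventually_smooth hy) (S.smooth_normal y hy)
    (S.eventually_invertible hy) (S.indefinite y hy).nondegenerate (S.tangent hy) X Y Z

end IsLocalSphere

/-- The implicit function theorem for maps `E3 × E3 → E3`. -/
lemma exists_implicit_zero {Φ : E3 × E3 → E3} {y v : E3} (hΦ : ContDiffAt ℝ ∞ Φ (y, v))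
    (h0 : Φ (y, v) = 0) (hi : ∀ X, fderiv ℝ Φ (y, v) (0, X) = 0 → X = 0) :
    ∃ e : E3 → E3, e y = v ∧ ContDiffAt ℝ ∞ e y ∧ ∀ᶠ z in 𝓝 y, Φ (z, e z) = 0 := by
  -- Adjoining the parameter turns the problem into an inverse function problem; the solution is the
  -- second component of the local inverse at `(z, 0)`.
  let Ψ : E3 × E3 → E3 × E3 := fun p => (p.1, Φ p)
  have hΨ : ContDiffAt ℝ ∞ Ψ (y, v) := contDiffAt_fst.prodMk hΦ
  let D : E3 × E3 →L[ℝ] E3 × E3 := (ContinuousLinearMap.fst ℝ E3 E3).prod (fderiv ℝ Φ (y, v))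
  have hD : HasFDerivAt Ψ D (y, v) :=
    hasFDerivAt_fst.prodMk (differentiableAt_of_smooth hΦ).hasFDerivAt
  have hinj : Function.Injective (D : E3 × E3 →ₗ[ℝ] E3 × E3) := by
    rw [injective_iff_map_eq_zero]
    rintro ⟨Y, X⟩ h
    have h' : (Y, fderiv ℝ Φ (y, v) (Y, X)) = (0, 0) := h
    obtain ⟨rfl, h2⟩ := Prod.mk.inj h'
    rw [hi X h2]; rfl
  let D' : (E3 × E3) ≃L[ℝ] (E3 × E3) :=
    (LinearEquiv.ofInjectiveEndo _ hinj).toContinuousLinearEquiv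
  have hD' : HasFDerivAt Ψ (D' : E3 × E3 →L[ℝ] E3 × E3) (y, v) := by
    convert! hD using 1
  have hval : Ψ (y, v) = (y, 0) := by simp [Ψ, h0]
  have hn : (∞ : WithTop ℕ∞) ≠ 0 := by simp
  have hg := hΨ.to_localInverse hD' hn
  have hg1 := hΨ.localInverse_apply_image hD' hn
  have hg2 := (hΨ.hasStrictFDerivAt' hD' hn).eventually_right_inverse
  have hg2' : ∀ᶠ q in 𝓝 (Ψ (y, v)), Ψ (hΨ.localInverse hD' hn q) = q := hg2
  rw [hval] at hg hg1 hg2'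
  have hin : ContDiffAt ℝ ∞ (fun z : E3 => (z, (0 : E3))) y := contDiffAt_id.prodMk contDiffAt_const
  refine ⟨fun z => (hΨ.localInverse hD' hn (z, 0)).2, congrArg Prod.snd hg1, ?_, ?_⟩
  · exact contDiffAt_snd.comp y (hg.comp y hin)
  · have := hin.continuousAt.eventually hg2'
    filter_upwards [this] with z hz
    have e1 := congrArg Prod.fst hz
    have e2 := congrArg Prod.snd hz
    have e3 : hΨ.localInverse hD' hn (z, 0) = (z, (hΨ.localInverse hD' hn (z, 0)).2) :=
      Prod.ext e1 rfl
    rw [← e3]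
    exact e2

/-- A zero of `X ↦ K(X,X) + (h(X,X) - s) X` is isotropic for `K` and normalized for `h`. -/
lemma IsAdapted.eq_zero_of_indefinite {h : E3 →L[ℝ] E3 →L[ℝ] ℝ} {K : E3 →ₗ[ℝ] E3 →ₗ[ℝ] E3}
    {σ l : ℝ} {e : Fin 3 → E3} (A : IsAdapted h (fun X Y => K X Y) σ l e) (hσ : σ ≠ 0) {X : E3}
    {q : ℝ} (hX : X ≠ 0) (h0 : K X X + q • X = 0) : q = 0 ∧ K X X = 0 := by
  have hq : q = 0 := by
    by_contra hq
    apply hX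
    have hi := A.linearIndependent hσ
    obtain ⟨x, rfl⟩ := exists_combination hi X
    have hA : ∀ i j, K (e i) (e j) = _ := A.diff_eq
    have := Fintype.linearIndependent_iff.1 hi ![2 * l * (x 1 * x 2) + q * x 0,
      -(2 * l * (x 0 * x 2)) + q * x 1, -(2 * l * (x 0 * x 1)) + q * x 2] (by
        rw [← h0]
        simp only [Fin.sum_univ_three, map_add, map_smul, LinearMap.add_apply,
          LinearMap.smul_apply, hA]
        simp [structConst]
        module)
    have q0 := this 0; have q1 := this 1; have q2 := this 2
    simp at q0 q1 q2
    -- The coefficients of `l` have opposite signs in the first two equations, so this combination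
    -- leaves a sum of squares.
    have a1 : q * (x 0 * x 0 + x 1 * x 1) = 0 := by linear_combination x 0 * q0 + x 1 * q1
    have a2 := (mul_eq_zero.1 a1).resolve_left hq
    have x0 : x 0 = 0 := by nlinarith [mul_self_nonneg (x 0), mul_self_nonneg (x 1)]
    have x1 : x 1 = 0 := by nlinarith [mul_self_nonneg (x 0), mul_self_nonneg (x 1)]
    have x2 : x 2 = 0 := by simpa [x0, x1, hq] using q2
    simp [Fin.sum_univ_three, x0, x1, x2]
  subst hq
  exact ⟨rfl, by simpa using h0⟩

/-- Isotropic vectors of the difference tensor are multiples of the frame vectors. -/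
lemma IsAdapted.exists_smul_of_isotropic {h : E3 →L[ℝ] E3 →L[ℝ] ℝ} {K : E3 →ₗ[ℝ] E3 →ₗ[ℝ] E3}
    {σ l : ℝ} {e : Fin 3 → E3} (A : IsAdapted h (fun X Y => K X Y) σ l e) (hσ : σ ≠ 0)
    (hl : l ≠ 0) {X : E3} (h0 : K X X = 0) : ∃ (i : Fin 3) (a : ℝ), X = a • e i := by
  have hi := A.linearIndependent hσ
  obtain ⟨x, rfl⟩ := exists_combination hi X
  have hA : ∀ i j, K (e i) (e j) = _ := A.diff_eq
  have := Fintype.linearIndependent_iff.1 hi ![2 * l * (x 1 * x 2),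
    -(2 * l * (x 0 * x 2)), -(2 * l * (x 0 * x 1))] (by
      rw [← h0]
      simp only [Fin.sum_univ_three, map_add, map_smul, LinearMap.add_apply,
        LinearMap.smul_apply, hA]
      simp [structConst]
      module)
  have q0 := this 0; have q1 := this 1; have q2 := this 2
  simp [hl] at q0 q1 q2
  by_cases x0 : x 0 = 0
  · rcases q0 with x1 | x2
    · exact ⟨2, x 2, by simp [Fin.sum_univ_three, x0, x1]⟩
    · exact ⟨1, x 1, by simp [Fin.sum_univ_three, x0, x2]⟩
  · exact ⟨0, x 0, by simp [Fin.sum_univ_three, q1.resolve_left x0, q2.resolve_left x0]⟩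

/-- Extension of a vector of an adapted frame to a smooth isotropic field. -/
lemma exists_smooth_isotropic {f ν : E3 → E4} {U : Set E3} {H : ℝ} (S : IsLocalSphere f ν U H)
    (hA : ∀ y ∈ U, ∃ σ l e, (σ = 1 ∨ σ = -1) ∧ l ≠ 0 ∧
      IsAdapted (metric f ν y) (differenceTensor f ν y) σ l e)
    {y : E3} (hy : y ∈ U) {σ l : ℝ} {v : Fin 3 → E3} (hσ : σ ≠ 0) (hl : l ≠ 0)
    (hv : IsAdapted (metric f ν y) (differenceTensor f ν y) σ l v) (i : Fin 3) :
    ∃ e : E3 → E3, e y = v i ∧ ContDiffAt ℝ ∞ e y ∧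
      ∀ᶠ z in 𝓝 y, differenceTensor f ν z (e z) (e z) = 0 ∧
        metric f ν z (e z) (e z) = σ * sgn i := by
  -- One equation in as many unknowns encodes isotropy and normalization at once: by
  -- `IsAdapted.eq_zero_of_indefinite`, both terms vanish separately at a nonzero zero.
  let Φ : E3 × E3 → E3 := fun p => differenceTensor f ν p.1 p.2 p.2 +
    (metric f ν p.1 p.2 p.2 - σ * sgn i) • p.2
  have hK0 : differenceTensor f ν y (v i) (v i) = 0 := by
    rw [hv.diff_eq]; fin_cases i <;> simp [structConst, Fin.sum_univ_three]
  have hm0 : metric f ν y (v i) (v i) = σ * sgn i := by rw [hv.metric_eq, if_pos rfl]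
  have hΦ0 : Φ (y, v i) = 0 := by simp [Φ, hK0, hm0]
  have hsm := S.smooth y hy
  have hsn := S.smooth_normal y hy
  have hin := S.frame_invertible hy
  have hΦ : ContDiffAt ℝ ∞ Φ (y, v i) := by
    have h1 : ContDiffAt ℝ ∞ (fun p : E3 × E3 => metric f ν p.1) (y, v i) :=
      ContDiffAt.comp (y, v i) (g := metric f ν) (f := Prod.fst)
        (contDiffAt_metric hsm hsn hin) contDiffAt_fst
    have h2 : ContDiffAt ℝ ∞ (fun p : E3 × E3 => p.2) (y, v i) := contDiffAt_snd
    have h3 : ContDiffAt ℝ ∞ (fun p : E3 × E3 => differenceTensor f ν p.1 p.2 p.2) (y, v i) :=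
      contDiffAt_differenceTensor (a := fun p : E3 × E3 => p.1) (u := fun p => p.2)
        (v := fun p => p.2) (p := (y, v i)) hsm hsn hin
        (S.indefinite y hy).nondegenerate contDiffAt_fst h2 h2
    have h4 : ContDiffAt ℝ ∞ (fun p : E3 × E3 => metric f ν p.1 p.2 p.2) (y, v i) :=
      (h1.clm_apply h2).clm_apply h2
    exact h3.add ((h4.sub contDiffAt_const).smul h2)
  have hder : ∀ X, fderiv ℝ Φ (y, v i) (0, X) =
      (2 : ℝ) • differenceTensor f ν y (v i) X + (2 * metric f ν y (v i) X) • v i := by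
    intro X
    have hγ : HasDerivAt (fun t : ℝ => (y, v i + t • X)) (0, X) 0 := by
      have h2 : HasDerivAt (fun t : ℝ => v i + t • X) X 0 := by
        simpa using ((hasDerivAt_id (0 : ℝ)).smul_const X).const_add (v i)
      exact (hasDerivAt_const (0 : ℝ) y).prodMk h2
    have hΦd := (differentiableAt_of_smooth hΦ).hasFDerivAt
    have hγ0 : (fun t : ℝ => (y, v i + t • X)) 0 = (y, v i) := by simp
    rw [← hγ0] at hΦd
    have h1 := hΦd.comp_hasDerivAt (0 : ℝ) hγ
    rw [hγ0] at h1
    let A := (2 : ℝ) • differenceTensor f ν y (v i) X + (2 * metric f ν y (v i) X) • v i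
    let B := differenceTensor f ν y X X + metric f ν y X X • v i +
      (2 * metric f ν y (v i) X) • X
    have h2 : (Φ ∘ fun t : ℝ => (y, v i + t • X)) = fun t : ℝ => t • A + t ^ 2 • B +
        t ^ 3 • (metric f ν y X X • X) := by
      funext t
      have e1 : differenceTensor f ν y (v i + t • X) (v i + t • X) =
          (2 * t) • differenceTensor f ν y (v i) X + t ^ 2 • differenceTensor f ν y X X := by
        simp only [← differenceBilin_apply] at hK0 ⊢
        simp only [map_add, map_smul, LinearMap.add_apply, LinearMap.smul_apply, hK0]
        rw [differenceBilin_apply f ν y X (v i), S.differenceTensor_symm hy X,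
          ← differenceBilin_apply]
        module
      have e2 : metric f ν y (v i + t • X) (v i + t • X) = σ * sgn i +
          2 * t * metric f ν y (v i) X + t ^ 2 * metric f ν y X X := by
        simp only [map_add, map_smul, add_apply, smul_apply, hm0, smul_eq_mul,
          metric_symm hsm X (v i)]
        ring
      simp only [Function.comp, Φ, e1, e2, A, B]
      module
    have h3 : HasDerivAt (fun t : ℝ => t • A + t ^ 2 • B + t ^ 3 • (metric f ν y X X • X)) A 0 := by
      have := (((hasDerivAt_id (0 : ℝ)).smul_const A).add
        ((hasDerivAt_pow 2 (0 : ℝ)).smul_const B)).add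
        ((hasDerivAt_pow 3 (0 : ℝ)).smul_const (metric f ν y X X • X))
      convert! this using 1
      simp
    rw [h2] at h1
    exact h1.unique h3
  -- The fibre derivative is injective: the metric term detects the component along `v i`, and `K (v
  -- i)` exchanges the other two axes up to a factor `±l`.
  obtain ⟨e, he, hes, hez⟩ := exists_implicit_zero hΦ hΦ0 (by
    intro X hX
    rw [hder] at hX
    obtain ⟨x, rfl⟩ := exists_combination (hv.linearIndependent hσ) X
    have hA : ∀ i j, differenceBilin f ν y (v i) (v j) = _ := hv.diff_eq
    simp only [← differenceBilin_apply, map_sum, map_smul, hA, hv.metric_eq] at hX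
    have hind := Fintype.linearIndependent_iff.1 (hv.linearIndependent hσ)
    fin_cases i
    · have := hind ![2 * σ * x 0, -(2 * l * x 2), -(2 * l * x 1)] (by
        rw [← hX]; simp [Fin.sum_univ_three, structConst, sgn]; module)
      have q0 := this 0; have q1 := this 1; have q2 := this 2
      simp [hl, hσ] at q0 q1 q2
      simp [Fin.sum_univ_three, q0, q1, q2]
    · have := hind ![2 * l * x 2, -(2 * σ * x 1), -(2 * l * x 0)] (by
        rw [← hX]; simp [Fin.sum_univ_three, structConst, sgn]; module)
      have q0 := this 0; have q1 := this 1; have q2 := this 2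
      simp [hl, hσ] at q0 q1 q2
      simp [Fin.sum_univ_three, q0, q1, q2]
    · have := hind ![2 * l * x 1, -(2 * l * x 0), -(2 * σ * x 2)] (by
        rw [← hX]; simp [Fin.sum_univ_three, structConst, sgn]; module)
      have q0 := this 0; have q1 := this 1; have q2 := this 2
      simp [hl, hσ] at q0 q1 q2
      simp [Fin.sum_univ_three, q0, q1, q2])
  refine ⟨e, he, hes, ?_⟩
  have hne : ∀ᶠ z in 𝓝 y, e z ≠ 0 :=
    hes.continuousAt.eventually_ne (by rw [he]; exact (hv.linearIndependent hσ).ne_zero i)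
  filter_upwards [hez, hne, S.eventually_mem hy] with z hz hz0 hzU
  -- The frame at the neighbouring point is unrelated to the fields constructed; it only serves to
  -- split the equation.
  obtain ⟨σ', l', e', hσ', -, hz'⟩ := hA z hzU
  obtain ⟨q1, q2⟩ := IsAdapted.eq_zero_of_indefinite (K := differenceBilin f ν z) hz'
    (by rcases hσ' with rfl | rfl <;> norm_num) hz0 hz
  exact ⟨q2, by linarith⟩

/-- Smooth adapted frames exist locally. -/
theorem exists_smooth_adapted {f ν : E3 → E4} {U : Set E3} {H : ℝ} (S : IsLocalSphere f ν U H)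
    (hA : ∀ y ∈ U, ∃ σ l e, (σ = 1 ∨ σ = -1) ∧ l ≠ 0 ∧
      IsAdapted (metric f ν y) (differenceTensor f ν y) σ l e) {y : E3} (hy : y ∈ U) :
    ∃ (σ : ℝ) (l : E3 → ℝ) (e : Fin 3 → E3 → E3), (σ = 1 ∨ σ = -1) ∧
      ∀ᶠ z in 𝓝 y, z ∈ U ∧ (∀ i, ContDiffAt ℝ 2 (e i) z) ∧ DifferentiableAt ℝ l z ∧ l z ≠ 0 ∧
        IsAdapted (metric f ν z) (differenceTensor f ν z) σ (l z) (fun i => e i z) := by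
  obtain ⟨σ, l, v, hσ, hl, hv⟩ := hA y hy
  have hσ0 : σ ≠ 0 := by rcases hσ with rfl | rfl <;> norm_num
  have hσ2 : σ * σ = 1 := by rcases hσ with rfl | rfl <;> norm_num
  choose e he hes hez using fun i => exists_smooth_isotropic S hA hy hσ0 hl hv i
  -- This expression recovers the factor of the difference tensor from a frame adapted with sign
  -- `σ`, which makes it smooth.
  let L : E3 → ℝ := fun z => σ * metric f ν z (differenceTensor f ν z (e 1 z) (e 2 z)) (e 0 z)
  have hLs : ContDiffAt ℝ ∞ L y := by
    have hsm := S.smooth y hy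
    have hsn := S.smooth_normal y hy
    have hin := S.frame_invertible hy
    exact contDiffAt_const.mul (((contDiffAt_metric hsm hsn hin).clm_apply
      (contDiffAt_differenceTensor (a := fun z => z) hsm hsn hin
        (S.indefinite y hy).nondegenerate contDiffAt_id (hes 1) (hes 2))).clm_apply (hes 0))
  have hind : ∀ᶠ z in 𝓝 y, LinearIndependent ℝ fun i => e i z := by
    have hc : ContinuousAt (fun z => fun i => e i z) y :=
      continuousAt_pi.2 fun i => (hes i).continuousAt
    refine hc.eventually (isOpen_setOfPred_linearIndependent.mem_nhds ?_)
    simp only [he]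
    exact hv.linearIndependent hσ0
  refine ⟨σ, L, e, hσ, ?_⟩
  have h2 : ∀ i, ∀ᶠ z in 𝓝 y, ContDiffAt ℝ 2 (e i) z := fun i =>
    ((hes i).of_le (m := 2) (WithTop.coe_le_coe.2 (le_top : (2 : ℕ∞) ≤ ⊤))).eventually (by simp)
  have h3 : ∀ᶠ z in 𝓝 y, ContDiffAt ℝ 1 L z :=
    (hLs.of_le (m := 1) (WithTop.coe_le_coe.2 (le_top : (1 : ℕ∞) ≤ ⊤))).eventually (by simp)
  filter_upwards [S.eventually_mem hy, eventually_all.2 h2, h3, eventually_all.2 hez, hind]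
    with z hzU hz2 hz3 hzz hzi
  obtain ⟨σ', l', e', hσ', hl', hz'⟩ := hA z hzU
  have hσ'0 : σ' ≠ 0 := by rcases hσ' with rfl | rfl <;> norm_num
  have hO := IsAdapted.isOrthogonalFrame (K := differenceBilin f ν z) hz' hσ'0
  -- The fields are isotropic, so each is a multiple of a member of the pointwise frame;
  -- independence makes `π` a permutation, and the orthogonality relations carry over.
  choose π a hπ using fun i => IsAdapted.exists_smul_of_isotropic (K := differenceBilin f ν z)
    hz' hσ'0 hl' (hzz i).1
  have ha : ∀ i, a i ≠ 0 := fun i h0 => by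
    have := hzi.ne_zero i
    rw [hπ i, h0, zero_smul] at this
    exact this rfl
  have hπi : Function.Injective π := by
    intro i j hij
    by_contra hne
    have h1 := Fintype.linearIndependent_iff.1 hzi
      (fun k => (if k = i then a j else 0) - (if k = j then a i else 0)) (by
        simp only [sub_smul, ite_smul, zero_smul, Finset.sum_sub_distrib, Finset.sum_ite_eq',
          Finset.mem_univ, if_true]
        rw [hπ i, hπ j, hij, smul_smul, smul_smul, mul_comm, sub_self]) i
    simp [hne] at h1
    exact ha j h1
  let ρ : Equiv.Perm (Fin 3) := Equiv.ofBijective π (Finite.injective_iff_bijective.1 hπi)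
  have hO' : IsOrthogonalFrame (metric f ν z) (differenceBilin f ν z) fun i => e i z := by
    convert! (hO.perm ρ).smul ha using 2 with i
    exact hπ i
  obtain ⟨m, hm⟩ := hO'.isAdapted (fun X Y => S.differenceTensor_symm hzU X Y)
    (fun X Y Z => S.cubic_symm hzU X Y Z) hσ2 (fun i => (hzz i).2)
  have hLm : L z = m := by
    have : differenceTensor f ν z (e 1 z) (e 2 z) = _ := hm.diff_eq 1 2
    simp only [L, this]
    simp [structConst, Fin.sum_univ_three, hm.metric_eq, sgn]
    linear_combination m * hσ2
  refine ⟨hzU, hz2, hz3.differentiableAt (by simp), ?_, hLm ▸ hm⟩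
  rw [hLm]
  rintro rfl
  apply hl'
  -- A zero factor would annihilate the whole difference tensor, against `l' ≠ 0`.
  have hK : differenceBilin f ν z = 0 := bilin_ext_of_indep hzi fun i j => by
    rw [show differenceBilin f ν z (e i z) (e j z) = _ from hm.diff_eq i j]; simp
  have h12 : differenceBilin f ν z (e' 1) (e' 2) = _ := hz'.diff_eq 1 2
  rw [hK] at h12
  simp [structConst, Fin.sum_univ_three] at h12
  exact (smul_eq_zero.1 h12.symm).resolve_right ((hz'.linearIndependent hσ'0).ne_zero 0)

/-! ### The structure equations of an adapted frame -/

/-- The algebraic content of the Codazzi equation for the difference tensor: an adapted frame is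
parallel and the factor of the difference tensor is constant. -/
lemma codazzi_algebra {A : Fin 3 → Fin 3 → Fin 3 → ℝ} {dA : Fin 3 → Fin 3 → Fin 3 → Fin 3 → ℝ}
    {dl : Fin 3 → ℝ} {l σ H : ℝ} (hl : l ≠ 0)
    (skew : ∀ i j k, sgn k * (A i j k - l * structConst i j k) +
      sgn j * (A i k j - l * structConst i k j) = 0)
    (dskew : ∀ m i j k, sgn k * (dA m i j k - dl m * structConst i j k) +
      sgn j * (dA m i k j - dl m * structConst i k j) = 0)
    (eq : ∀ m i j k, dA m i j k + ∑ s, A i j s * A m s k -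
        H * (if i = j then σ * sgn i else 0) * (if m = k then 1 else 0) -
      (dA i m j k + ∑ s, A m j s * A i s k -
        H * (if m = j then σ * sgn m else 0) * (if i = k then 1 else 0)) =
      ∑ s, (A m i s - A i m s) * A s j k) :
    (∀ i j k, A i j k = l * structConst i j k) ∧ ∀ i, dl i = 0 := by
  -- The part of the integrability condition without derivatives of the coefficients.
  let R : Fin 3 → Fin 3 → Fin 3 → Fin 3 → ℝ := fun m i j k =>
    ∑ s, ((A m i s - A i m s) * A s j k - A i j s * A m s k + A m j s * A i s k) +
      H * (if i = j then σ * sgn i else 0) * (if m = k then 1 else 0) -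
      H * (if m = j then σ * sgn m else 0) * (if i = k then 1 else 0)
  -- Symmetrizing in `j` and `k` with respect to the metric removes the derivatives of the skew
  -- Levi-Civita part; only derivatives of `l` survive. This is the Codazzi equation for `K`.
  have S : ∀ m i j k, sgn k * (dl m * structConst i j k - dl i * structConst m j k) +
      sgn j * (dl m * structConst i k j - dl i * structConst m k j) =
      sgn k * R m i j k + sgn j * R m i k j := fun m i j k => by
    simp only [R, Finset.sum_add_distrib, Finset.sum_sub_distrib]
    linear_combination sgn k * eq m i j k + sgn j * eq m i k j - dskew m i j k +
      dskew i m j k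
  -- Skewness leaves nine unknown Levi-Civita coefficients, three for each direction of
  -- differentiation.
  obtain ⟨p, q, r, rfl⟩ : ∃ p q r : Fin 3 → ℝ, A = fun i j k =>
      (![![0, p i, q i], ![p i, 0, r i], ![q i, -r i, 0]] : Fin 3 → Fin 3 → ℝ) j k +
        l * structConst i j k := by
    refine ⟨fun i => A i 0 1 - l * structConst i 0 1, fun i => A i 0 2 - l * structConst i 0 2,
      fun i => A i 1 2 - l * structConst i 1 2, ?_⟩
    funext i j k
    have h1 := skew i j k
    have h2 := skew i k j
    fin_cases j <;> fin_cases k <;> simp [sgn] at h1 h2 ⊢ <;> linarith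
  have T : ∀ m i j k, _ := fun m i j k => S m i j k
  simp only [R, Fin.sum_univ_three] at T
  -- The curvature of the Levi-Civita part, the commutators of `K` and the terms in `H` are all skew
  -- and cancel. What is left is linear in `dl` and in the products of `l` with `p`, `q`, `r`.
  have t1 := T 0 1 0 0
  have t2 := T 0 1 0 1
  have t3 := T 0 1 0 2
  have t4 := T 0 1 1 1
  have t5 := T 0 1 1 2
  have t6 := T 0 1 2 2
  have t7 := T 0 2 0 0
  have t8 := T 0 2 0 1
  have t9 := T 0 2 0 2
  have t10 := T 0 2 1 1
  have t11 := T 0 2 1 2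
  have t12 := T 0 2 2 2
  have t13 := T 1 2 0 0
  have t14 := T 1 2 0 1
  have t15 := T 1 2 0 2
  have t16 := T 1 2 1 1
  have t17 := T 1 2 1 2
  have t18 := T 1 2 2 2
  clear T S R skew dskew eq
  simp [structConst, sgn, -mul_eq_zero] at t1 t2 t3 t4 t5 t6 t7 t8 t9
  simp [structConst, sgn, -mul_eq_zero] at t10 t11 t12 t13 t14 t15 t16 t17 t18
  have p0 : p 0 = 0 := by
    have : l * p 0 = 0 := by linarith
    exact (mul_eq_zero.1 this).resolve_left hl
  have p1 : p 1 = 0 := by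
    have : l * p 1 = 0 := by linarith
    exact (mul_eq_zero.1 this).resolve_left hl
  have p2 : p 2 = 0 := by
    have : l * p 2 = 0 := by linarith
    exact (mul_eq_zero.1 this).resolve_left hl
  have q0 : q 0 = 0 := by
    have : l * q 0 = 0 := by linarith
    exact (mul_eq_zero.1 this).resolve_left hl
  have q1 : q 1 = 0 := by
    have : l * q 1 = 0 := by linarith
    exact (mul_eq_zero.1 this).resolve_left hl
  have q2 : q 2 = 0 := by
    have : l * q 2 = 0 := by linarith
    exact (mul_eq_zero.1 this).resolve_left hl
  have r0 : r 0 = 0 := by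
    have : l * r 0 = 0 := by linarith
    exact (mul_eq_zero.1 this).resolve_left hl
  have r1 : r 1 = 0 := by
    have : l * r 1 = 0 := by linarith
    exact (mul_eq_zero.1 this).resolve_left hl
  have r2 : r 2 = 0 := by
    have : l * r 2 = 0 := by linarith
    exact (mul_eq_zero.1 this).resolve_left hl
  have d0 : dl 0 = 0 := by linarith
  have d1 : dl 1 = 0 := by linarith
  have d2 : dl 2 = 0 := by linarith
  constructor
  · intro i j k
    fin_cases i <;> fin_cases j <;> fin_cases k <;>
      simp [p0, p1, p2, q0, q1, q2, r0, r1, r2]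
  · intro i
    fin_cases i <;> simp [d0, d1, d2]

/-- The algebraic content of the Gauss equation for a flat metric. -/
lemma gauss_algebra {A : Fin 3 → Fin 3 → Fin 3 → ℝ} {dA : Fin 3 → Fin 3 → Fin 3 → Fin 3 → ℝ}
    {l σ H : ℝ} (hσ : σ * σ = 1) (hA : ∀ i j k, A i j k = l * structConst i j k)
    (hdA : ∀ m i j k, dA m i j k = 0)
    (eq : ∀ m i j k, dA m i j k + ∑ s, A i j s * A m s k -
        H * (if i = j then σ * sgn i else 0) * (if m = k then 1 else 0) -
      (dA i m j k + ∑ s, A m j s * A i s k -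
        H * (if m = j then σ * sgn m else 0) * (if i = k then 1 else 0)) =
      ∑ s, (A m i s - A i m s) * A s j k) : H = -(σ * l ^ 2) := by
  -- One component of the Gauss equation, for the plane of the first two frame vectors, already
  -- determines `H`.
  have := eq 0 1 1 0
  simp only [hA, hdA, Fin.sum_univ_three] at this
  simp [structConst, sgn] at this
  linear_combination σ * this - H * hσ

/-- A smooth adapted frame on an open set of an indefinite affine hypersphere. -/
structure IsAdaptedOn (f ν : E3 → E4) (V : Set E3) (H σ : ℝ) (l : E3 → ℝ) (e : Fin 3 → E3 → E3) :
    Prop where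
  sphere : IsLocalSphere f ν V H
  sign : σ * σ = 1
  smooth : ∀ z ∈ V, ∀ i, ContDiffAt ℝ 2 (e i) z
  diff : ∀ z ∈ V, DifferentiableAt ℝ l z
  ne_zero : ∀ z ∈ V, l z ≠ 0
  adapted : ∀ z ∈ V, IsAdapted (metric f ν z) (differenceTensor f ν z) σ (l z) (fun i => e i z)

/-- The coefficients of the induced connection in a frame. -/
def connCoeff (f ν : E3 → E4) (σ : ℝ) (e : Fin 3 → E3 → E3) (i j k : Fin 3) (z : E3) : ℝ :=
  σ * sgn k * metric f ν z (fderiv ℝ (e j) z (e i z) +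
    inducedChristoffel f ν z (e i z) (e j z)) (e k z)

lemma sgn_mul_self (i : Fin 3) : sgn i * sgn i = 1 := by fin_cases i <;> simp [sgn]

lemma IsAdapted.expand {h : E3 →L[ℝ] E3 →L[ℝ] ℝ} {K : E3 → E3 → E3} {σ l : ℝ}
    {e : Fin 3 → E3} (A : IsAdapted h K σ l e) (hσ : σ * σ = 1) (X : E3) :
    X = ∑ k, (σ * sgn k * h X (e k)) • e k := by
  have hσ0 : σ ≠ 0 := by rintro rfl; simp at hσ
  obtain ⟨x, rfl⟩ := exists_combination (A.linearIndependent hσ0) X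
  refine Finset.sum_congr rfl fun k _ => ?_
  congr 1
  simp only [map_sum, map_smul, sum_apply, smul_apply, A.metric_eq, smul_eq_mul, mul_ite,
    mul_zero, Finset.sum_ite_eq', Finset.mem_univ, if_true]
  linear_combination (-x k * sgn k * sgn k) * hσ - x k * sgn_mul_self k

/-! ### Connection coefficients of an adapted frame and their integrability. -/

namespace IsAdaptedOn

variable {f ν : E3 → E4} {V : Set E3} {H σ : ℝ} {l : E3 → ℝ} {e : Fin 3 → E3 → E3} {z : E3}

lemma eventually_mem (S : IsAdaptedOn f ν V H σ l e) (hz : z ∈ V) : ∀ᶠ w in 𝓝 z, w ∈ V :=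
  S.sphere.eventually_mem hz

lemma differentiableAt_frame (S : IsAdaptedOn f ν V H σ l e) (hz : z ∈ V) (i : Fin 3) :
    DifferentiableAt ℝ (e i) z :=
  (S.smooth z hz i).differentiableAt (by simp)

lemma differentiableAt_fderiv_frame (S : IsAdaptedOn f ν V H σ l e) (hz : z ∈ V) (i : Fin 3) :
    DifferentiableAt ℝ (fderiv ℝ (e i)) z :=
  ((S.smooth z hz i).fderiv_right (m := 1) (by norm_num)).differentiableAt (by simp)

lemma differentiableAt_metric (S : IsAdaptedOn f ν V H σ l e) (hz : z ∈ V) :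
    DifferentiableAt ℝ (metric f ν) z :=
  differentiableAt_of_smooth (contDiffAt_metric (S.sphere.smooth z hz) (S.sphere.smooth_normal z hz)
    (S.sphere.frame_invertible hz))

lemma differentiableAt_christoffel (S : IsAdaptedOn f ν V H σ l e) (hz : z ∈ V) :
    DifferentiableAt ℝ (inducedChristoffel f ν) z :=
  differentiableAt_of_smooth (contDiffAt_inducedChristoffel (S.sphere.smooth z hz)
    (S.sphere.smooth_normal z hz) (S.sphere.frame_invertible hz))

lemma differentiableAt_connCoeff (S : IsAdaptedOn f ν V H σ l e) (hz : z ∈ V) (i j k : Fin 3) :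
    DifferentiableAt ℝ (connCoeff f ν σ e i j k) z := by
  have h1 := (S.differentiableAt_fderiv_frame hz j).clm_apply (S.differentiableAt_frame hz i)
  have h2 := ((S.differentiableAt_christoffel hz).clm_apply
    (S.differentiableAt_frame hz i)).clm_apply (S.differentiableAt_frame hz j)
  exact ((((S.differentiableAt_metric hz).clm_apply (h1.add h2)).clm_apply
    (S.differentiableAt_frame hz k)).const_mul (σ * sgn k))

lemma covariant_frame (S : IsAdaptedOn f ν V H σ l e) (hz : z ∈ V) (i j : Fin 3) :
    fderiv ℝ (e j) z (e i z) + inducedChristoffel f ν z (e i z) (e j z) =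
      ∑ k, connCoeff f ν σ e i j k z • e k z :=
  (S.adapted z hz).expand S.sign _

/-- After subtraction of the difference tensor, the Levi-Civita coefficients remain. They are skew
because the scalar products of the frame are constant and the connection is metric. -/
lemma skew (S : IsAdaptedOn f ν V H σ l e) (hz : z ∈ V) (i j k : Fin 3) :
    sgn k * (connCoeff f ν σ e i j k z - l z * structConst i j k) +
      sgn j * (connCoeff f ν σ e i k j z - l z * structConst i k j) = 0 := by
  have hA := S.adapted z hz
  have W : ∀ j k, σ * (sgn k * (connCoeff f ν σ e i j k z - l z * structConst i j k)) =
      metric f ν z (fderiv ℝ (e j) z (e i z)) (e k z) +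
      metric f ν z (leviCivitaChristoffel (metric f ν) z (e i z) (e j z)) (e k z) := by
    intro j k
    have h1 : metric f ν z (inducedChristoffel f ν z (e i z) (e j z)) (e k z) =
        metric f ν z (leviCivitaChristoffel (metric f ν) z (e i z) (e j z)) (e k z) +
        metric f ν z (differenceTensor f ν z (e i z) (e j z)) (e k z) := by
      simp [differenceTensor]
    have h2 : metric f ν z (differenceTensor f ν z (e i z) (e j z)) (e k z) =
        l z * (σ * (sgn k * structConst i j k)) := by
      rw [hA.diff_eq]
      simp only [map_smul, map_sum, sum_apply, smul_apply, hA.metric_eq, smul_eq_mul, mul_ite,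
        mul_zero, Finset.sum_ite_eq', Finset.mem_univ, if_true]
      ring
    rw [connCoeff, map_add, add_apply, h1, h2]
    have h3 := sgn_mul_self k
    have h4 := S.sign
    linear_combination (σ * σ * (metric f ν z (fderiv ℝ (e j) z (e i z)) (e k z) +
      metric f ν z (leviCivitaChristoffel (metric f ν) z (e i z) (e j z)) (e k z) +
      l z * (σ * (sgn k * structConst i j k)))) * h3 +
      (metric f ν z (fderiv ℝ (e j) z (e i z)) (e k z) +
      metric f ν z (leviCivitaChristoffel (metric f ν) z (e i z) (e j z)) (e k z) +
      l z * (σ * (sgn k * structConst i j k))) * h4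
  have hconst : (fun w => metric f ν w (e j w) (e k w)) =ᶠ[𝓝 z]
      fun _ => if j = k then σ * sgn j else 0 := by
    filter_upwards [S.eventually_mem hz] with w hw using (S.adapted w hw).metric_eq j k
  have hd := ((S.differentiableAt_metric hz).hasFDerivAt.clm_apply
    (S.differentiableAt_frame hz j).hasFDerivAt).clm_apply
    (S.differentiableAt_frame hz k).hasFDerivAt
  have h0 := hd.unique ((hasFDerivAt_const _ z).congr_of_eventuallyEq hconst)
  have h1 := congrArg (fun L => L (e i z)) h0
  have hf := S.sphere.eventually_smooth hz
  have hν := S.sphere.smooth_normal z hz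
  have hi := S.sphere.frame_invertible hz
  simp [fderiv_metric hf hν hi (S.sphere.indefinite z hz).nondegenerate] at h1
  have hσ0 : σ ≠ 0 := by rintro rfl; simpa using S.sign
  apply mul_left_cancel₀ hσ0
  rw [mul_add, W j k, W k j, mul_zero]
  have hm := metric_symm (ν := ν) (S.sphere.smooth z hz)
  rw [hm _ (e j z), hm (leviCivitaChristoffel (metric f ν) z (e i z) (e k z))]
  linarith

lemma fderiv_skew (S : IsAdaptedOn f ν V H σ l e) (hz : z ∈ V) (X : E3) (i j k : Fin 3) :
    sgn k * (fderiv ℝ (connCoeff f ν σ e i j k) z X - fderiv ℝ l z X * structConst i j k) +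
      sgn j * (fderiv ℝ (connCoeff f ν σ e i k j) z X - fderiv ℝ l z X * structConst i k j) =
      0 := by
  have h : (fun w => sgn k * (connCoeff f ν σ e i j k w - l w * structConst i j k) +
      sgn j * (connCoeff f ν σ e i k j w - l w * structConst i k j)) =ᶠ[𝓝 z] fun _ => 0 := by
    filter_upwards [S.eventually_mem hz] with w hw using S.skew hw i j k
  have hl := (S.diff z hz).hasFDerivAt
  have h1 := (S.differentiableAt_connCoeff hz i j k).hasFDerivAt
  have h2 := (S.differentiableAt_connCoeff hz i k j).hasFDerivAt
  have := (((h1.sub (hl.mul_const (structConst i j k))).const_mul (sgn k)).add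
    ((h2.sub (hl.mul_const (structConst i k j))).const_mul (sgn j))).unique
    ((hasFDerivAt_const (0 : ℝ) z).congr_of_eventuallyEq h)
  have := congrArg (fun L => L X) this
  simp at this
  linear_combination this

/-- The frame pushed forward to the ambient space. -/
lemma hasFDerivAt_push (S : IsAdaptedOn f ν V H σ l e) (hz : z ∈ V) (j : Fin 3) :
    HasFDerivAt (fun w => fderiv ℝ f w (e j w))
      ((fderiv ℝ f z).comp (fderiv ℝ (e j) z) + (fderiv ℝ (fderiv ℝ f) z).flip (e j z)) z :=
  (differentiableAt_of_smooth (contDiffAt_fderiv (S.sphere.smooth z hz))).hasFDerivAt.clm_apply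
    (S.differentiableAt_frame hz j).hasFDerivAt

lemma fderiv_push (S : IsAdaptedOn f ν V H σ l e) (hz : z ∈ V) (i j : Fin 3) :
    fderiv ℝ (fun w => fderiv ℝ f w (e j w)) z (e i z) =
      ∑ k, connCoeff f ν σ e i j k z • fderiv ℝ f z (e k z) +
        (if i = j then σ * sgn i else 0) • ν z := by
  rw [(S.hasFDerivAt_push hz j).fderiv]
  simp only [add_apply, ContinuousLinearMap.comp_apply, ContinuousLinearMap.flip_apply]
  rw [gauss_formula (S.sphere.frame_invertible hz), (S.adapted z hz).metric_eq, ← add_assoc,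
    ← map_add, S.covariant_frame hz, map_sum]
  simp only [map_smul]

lemma contDiffAt_push (S : IsAdaptedOn f ν V H σ l e) (hz : z ∈ V) (j : Fin 3) :
    ContDiffAt ℝ 2 (fun w => fderiv ℝ f w (e j w)) z :=
  ((contDiffAt_fderiv (S.sphere.smooth z hz)).of_le
    (WithTop.coe_le_coe.2 (le_top : (2 : ℕ∞) ≤ ⊤))).clm_apply (S.smooth z hz j)

/-- The derivative of the Gauss formula of the frame, projected to the frame. -/
lemma second_derivative_push (S : IsAdaptedOn f ν V H σ l e) (hz : z ∈ V) (m i j : Fin 3) :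
    fderiv ℝ (fderiv ℝ (fun w => fderiv ℝ f w (e j w))) z (e m z) (e i z) +
      fderiv ℝ (fun w => fderiv ℝ f w (e j w)) z (fderiv ℝ (e i) z (e m z)) =
    ∑ k, (fderiv ℝ (connCoeff f ν σ e i j k) z (e m z) • fderiv ℝ f z (e k z) +
      connCoeff f ν σ e i j k z • fderiv ℝ (fun w => fderiv ℝ f w (e k w)) z (e m z)) -
      (H * (if i = j then σ * sgn i else 0)) • fderiv ℝ f z (e m z) := by
  set c : ℝ := if i = j then σ * sgn i else 0
  have h : (fun w => fderiv ℝ (fun w => fderiv ℝ f w (e j w)) w (e i w)) =ᶠ[𝓝 z] fun w =>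
      ∑ k, connCoeff f ν σ e i j k w • fderiv ℝ f w (e k w) + c • ν w := by
    filter_upwards [S.eventually_mem hz] with w hw using S.fderiv_push hw i j
  have h1 := (((S.contDiffAt_push hz j).fderiv_right (m := 1) (by norm_num)).differentiableAt
    (by simp)).hasFDerivAt.clm_apply (S.differentiableAt_frame hz i).hasFDerivAt
  have h2 : ∀ k, HasFDerivAt (fun w => connCoeff f ν σ e i j k w • fderiv ℝ f w (e k w)) _ z :=
    fun k => (S.differentiableAt_connCoeff hz i j k).hasFDerivAt.smul
      (((S.contDiffAt_push hz k).differentiableAt (by simp)).hasFDerivAt)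
  have h3 := (HasFDerivAt.fun_sum (u := Finset.univ) fun k _ => h2 k).add
    ((differentiableAt_of_smooth (S.sphere.smooth_normal z hz)).hasFDerivAt.const_smul c)
  have := congrArg (fun L => L (e m z)) (h1.unique (h3.congr_of_eventuallyEq h))
  simp only [add_apply, ContinuousLinearMap.comp_apply, ContinuousLinearMap.flip_apply,
    sum_apply, smul_apply, ContinuousLinearMap.smulRight_apply, S.sphere.weingarten z hz] at this
  rw [add_comm, this, sub_eq_add_neg]
  congr 1
  · exact Finset.sum_congr rfl fun k _ => add_comm _ _
  · module

/-- The induced connection is torsion-free, so the bracket is the antisymmetrized covariant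
derivative. -/
lemma bracket (S : IsAdaptedOn f ν V H σ l e) (hz : z ∈ V) (m i : Fin 3) :
    fderiv ℝ (e i) z (e m z) - fderiv ℝ (e m) z (e i z) =
      ∑ s, (connCoeff f ν σ e m i s z - connCoeff f ν σ e i m s z) • e s z := by
  simp only [sub_smul, Finset.sum_sub_distrib]
  rw [← S.covariant_frame hz, ← S.covariant_frame hz,
    inducedChristoffel_symm (S.sphere.smooth z hz) (e i z)]
  abel

/-- The integrability condition of the structure equations. -/
lemma integrability (S : IsAdaptedOn f ν V H σ l e) (hz : z ∈ V) (m i j k : Fin 3) :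
    fderiv ℝ (connCoeff f ν σ e i j k) z (e m z) +
      ∑ s, connCoeff f ν σ e i j s z * connCoeff f ν σ e m s k z -
        H * (if i = j then σ * sgn i else 0) * (if m = k then 1 else 0) -
      (fderiv ℝ (connCoeff f ν σ e m j k) z (e i z) +
        ∑ s, connCoeff f ν σ e m j s z * connCoeff f ν σ e i s k z -
        H * (if m = j then σ * sgn m else 0) * (if i = k then 1 else 0)) =
      ∑ s, (connCoeff f ν σ e m i s z - connCoeff f ν σ e i m s z) *
        connCoeff f ν σ e s j k z := by
  -- `Λ` reads off the coefficient of the pushed-forward `e k`, and vanishes on the normal.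
  let Λ : E4 →ₗ[ℝ] ℝ := (σ * sgn k) •
    ((metric f ν z).flip (e k z) ∘L tangential f ν z : E4 →L[ℝ] ℝ).toLinearMap
  have hi := S.sphere.frame_invertible hz
  have hΛ : ∀ v, Λ v = σ * sgn k * metric f ν z (tangential f ν z v) (e k z) := fun v => rfl
  have hΛE : ∀ s, Λ (fderiv ℝ f z (e s z)) = if s = k then 1 else 0 := by
    intro s
    rw [hΛ, tangential_fderiv hi, (S.adapted z hz).metric_eq]
    split_ifs with h
    · subst h
      linear_combination (sgn s * sgn s) * S.sign + sgn_mul_self s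
    · ring
  have hΛν : Λ (ν z) = 0 := by rw [hΛ, tangential_normal hi]; simp
  have hΛD : ∀ i j, Λ (fderiv ℝ (fun w => fderiv ℝ f w (e j w)) z (e i z)) =
      connCoeff f ν σ e i j k z := by
    intro i j
    rw [S.fderiv_push hz]
    simp only [map_add, map_sum, map_smul, hΛE, hΛν, smul_eq_mul, mul_ite, mul_one, mul_zero,
      add_zero, Finset.sum_ite_eq', Finset.mem_univ, if_true]
  -- The only analytic input: second derivatives of the pushed-forward field commute. The
  -- first-order corrections combine to the bracket.
  have hsymm := ((S.contDiffAt_push hz j).isSymmSndFDerivAt (by simp)).eq (e m z) (e i z)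
  have e1 := congrArg Λ (S.second_derivative_push hz m i j)
  have e2 := congrArg Λ (S.second_derivative_push hz i m j)
  have e3 := congrArg (fun X => Λ (fderiv ℝ (fun w => fderiv ℝ f w (e j w)) z X)) (S.bracket hz m i)
  rw [hsymm] at e1
  simp only [map_add, map_sub, map_sum, map_smul, hΛE, hΛD, smul_eq_mul, mul_ite, mul_one,
    mul_zero, Finset.sum_add_distrib, Finset.sum_ite_eq', Finset.mem_univ,
    if_true] at e1 e2 e3 ⊢
  linarith

/-- The frame is parallel and the factor of the difference tensor is constant. -/
theorem parallel (S : IsAdaptedOn f ν V H σ l e) (hz : z ∈ V) :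
    (∀ i j k, connCoeff f ν σ e i j k z = l z * structConst i j k) ∧ fderiv ℝ l z = 0 := by
  obtain ⟨h1, h2⟩ := codazzi_algebra (A := fun i j k => connCoeff f ν σ e i j k z)
    (dA := fun m i j k => fderiv ℝ (connCoeff f ν σ e i j k) z (e m z))
    (dl := fun m => fderiv ℝ l z (e m z)) (S.ne_zero z hz) (fun i j k => S.skew hz i j k)
    (fun m i j k => S.fderiv_skew hz (e m z) i j k) (fun m i j k => S.integrability hz m i j k)
  refine ⟨h1, ?_⟩
  ext X
  rw [(S.adapted z hz).expand S.sign X]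
  simp [h2]

/-- By `parallel` all connection coefficients are locally constant, so the Gauss equation is purely
algebraic. -/
theorem mean_curvature_eq (S : IsAdaptedOn f ν V H σ l e) (hz : z ∈ V) :
    H = -(σ * l z ^ 2) := by
  have h : ∀ m i j k, fderiv ℝ (connCoeff f ν σ e i j k) z (e m z) = 0 := by
    intro m i j k
    have : connCoeff f ν σ e i j k =ᶠ[𝓝 z] fun w => l w * structConst i j k := by
      filter_upwards [S.eventually_mem hz] with w hw using (S.parallel hw).1 i j k
    rw [this.fderiv_eq, fderiv_mul_const (S.diff z hz), (S.parallel hz).2]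
    simp
  exact gauss_algebra S.sign (S.parallel hz).1 h fun m i j k => S.integrability hz m i j k

end IsAdaptedOn

/-! ### Local equivalence with the model -/

namespace IsAdaptedOn

variable {f ν : E3 → E4} {V : Set E3} {H σ : ℝ} {l : E3 → ℝ} {e : Fin 3 → E3 → E3} {z : E3}

/-- The tangential coordinates of an ambient vector in the rescaled frame. -/
def coord (f ν : E3 → E4) (σ l : ℝ) (e : Fin 3 → E3 → E3) (k : Fin 3) (z : E3) : E4 →ₗ[ℝ] ℝ :=
  (l * (σ * sgn k)) • ((metric f ν z).flip (e k z) ∘L tangential f ν z : E4 →L[ℝ] ℝ).toLinearMap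

/-- The radial coordinate of an ambient vector. -/
def radial (f ν : E3 → E4) (H : ℝ) (z : E3) : E4 →ₗ[ℝ] ℝ :=
  (-H) • (transversal f ν z : E4 →L[ℝ] ℝ).toLinearMap

lemma coord_apply (f ν : E3 → E4) (σ l : ℝ) (e : Fin 3 → E3 → E3) (k : Fin 3) (z : E3) (v : E4) :
    coord f ν σ l e k z v = l * (σ * sgn k) * metric f ν z (tangential f ν z v) (e k z) := rfl

lemma radial_apply (f ν : E3 → E4) (H : ℝ) (z : E3) (v : E4) :
    radial f ν H z v = -H * transversal f ν z v := rfl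

lemma coord_push (S : IsAdaptedOn f ν V H σ l e) (hz : z ∈ V) (t : ℝ) (k s : Fin 3) :
    coord f ν σ t e k z (fderiv ℝ f z (e s z)) = if s = k then t else 0 := by
  rw [coord_apply, tangential_fderiv (S.sphere.frame_invertible hz), (S.adapted z hz).metric_eq]
  split_ifs with h
  · subst h
    linear_combination (t * sgn s * sgn s) * S.sign + t * sgn_mul_self s
  · ring

lemma curvature_ne_zero (S : IsAdaptedOn f ν V H σ l e) (hz : z ∈ V) : H ≠ 0 := by
  rw [S.mean_curvature_eq hz, neg_ne_zero]
  have hσ0 : σ ≠ 0 := by rintro rfl; simpa using S.sign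
  exact mul_ne_zero hσ0 (pow_ne_zero 2 (S.ne_zero z hz))

/-- The factor `-H` in `radial` is chosen for this normalization. -/
lemma radial_center (S : IsAdaptedOn f ν V H σ l e) (hz : z ∈ V) {c : E4}
    (hc : ν z = -(H • (f z - c))) : radial f ν H z (f z - c) = 1 := by
  have h1 := transversal_normal (S.sphere.frame_invertible hz)
  rw [hc, map_neg, map_smul, smul_eq_mul] at h1
  rw [radial_apply]
  linarith

lemma coord_center (S : IsAdaptedOn f ν V H σ l e) (hz : z ∈ V) {c : E4}
    (hc : ν z = -(H • (f z - c))) (t : ℝ) (k : Fin 3) : coord f ν σ t e k z (f z - c) = 0 := by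
  have h1 := tangential_normal (S.sphere.frame_invertible hz)
  rw [hc, map_neg, map_smul, neg_eq_zero, smul_eq_zero] at h1
  rw [coord_apply, h1.resolve_left (S.curvature_ne_zero hz)]
  simp

lemma expand_coord (S : IsAdaptedOn f ν V H σ l e) (hz : z ∈ V) {c : E4}
    (hc : ν z = -(H • (f z - c))) {t : ℝ} (ht : t ≠ 0) (v : E4) :
    v = ∑ k, (t⁻¹ * coord f ν σ t e k z v) • fderiv ℝ f z (e k z) +
      radial f ν H z v • (f z - c) := by
  have h1 := fderiv_tangential_add (S.sphere.frame_invertible hz) v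
  rw [(S.adapted z hz).expand S.sign (tangential f ν z v), hc, map_sum] at h1
  conv_lhs => rw [← h1]
  congr 1
  · refine Finset.sum_congr rfl fun k _ => ?_
    rw [map_smul, coord_apply]
    congr 1
    field_simp
  · rw [radial_apply]
    module

lemma differentiableAt_coord (S : IsAdaptedOn f ν V H σ l e) (hz : z ∈ V) (t : ℝ) (k : Fin 3)
    (v : E4) : DifferentiableAt ℝ (fun w => coord f ν σ t e k w v) z := by
  have h1 := differentiableAt_of_smooth (contDiffAt_tangential (S.sphere.smooth z hz)
    (S.sphere.smooth_normal z hz) (S.sphere.frame_invertible hz))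
  exact (((S.differentiableAt_metric hz).clm_apply (h1.clm_apply
    (differentiableAt_const v))).clm_apply (S.differentiableAt_frame hz k)).const_mul _

lemma differentiableAt_radial (S : IsAdaptedOn f ν V H σ l e) (hz : z ∈ V) (v : E4) :
    DifferentiableAt ℝ (fun w => radial f ν H w v) z :=
  ((differentiableAt_of_smooth (contDiffAt_transversal (S.sphere.smooth z hz)
    (S.sphere.smooth_normal z hz) (S.sphere.frame_invertible hz))).clm_apply
    (differentiableAt_const v)).const_mul _

/-- The coordinates of a fixed vector satisfy a linear system with constant coefficients. -/
lemma fderiv_coord (S : IsAdaptedOn f ν V H σ l e) (hz : z ∈ V) {c : E4}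
    (hc : ∀ w ∈ V, ν w = -(H • (f w - c))) (v : E4) (m : Fin 3) :
    (∀ s, fderiv ℝ (fun w => coord f ν σ (l z) e s w v) z (e m z) =
      -(l z * (∑ k, coord f ν σ (l z) e k z v * structConst m k s +
        if m = s then radial f ν H z v else 0))) ∧
    fderiv ℝ (fun w => radial f ν H w v) z (e m z) =
      -(l z * (sgn m * coord f ν σ (l z) e m z v)) := by
  -- The scale is frozen at its value in `z`, so that only the frame is differentiated. Rescaling by
  -- it gives all equations the common factor `-t`, in view of `H = -(σ * t ^ 2)`.
  set t := l z with htdef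
  have ht : t ≠ 0 := S.ne_zero z hz
  -- A constant vector expanded in a moving frame: the derivative of the expansion is zero, and its
  -- components are the system.
  have hE : (fun _ => v) =ᶠ[𝓝 z] fun w => ∑ k, (t⁻¹ * coord f ν σ t e k w v) •
      fderiv ℝ f w (e k w) + radial f ν H w v • (f w - c) := by
    filter_upwards [S.eventually_mem hz] with w hw using S.expand_coord hw (hc w hw) ht v
  have h1 : ∀ k, HasFDerivAt (fun w => (t⁻¹ * coord f ν σ t e k w v) • fderiv ℝ f w (e k w)) _ z :=
    fun k => ((S.differentiableAt_coord hz t k v).hasFDerivAt.const_mul t⁻¹).smul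
      (((S.contDiffAt_push hz k).differentiableAt (by simp)).hasFDerivAt)
  have h2 := (HasFDerivAt.fun_sum (u := Finset.univ) fun k _ => h1 k).add
    ((S.differentiableAt_radial hz v).hasFDerivAt.smul
      ((differentiableAt_of_smooth (S.sphere.smooth z hz)).hasFDerivAt.sub_const c))
  have h3 := congrArg (fun L => L (e m z))
    ((hasFDerivAt_const v z).unique (h2.congr_of_eventuallyEq hE))
  simp only [add_apply, zero_apply, sum_apply, smul_apply,
    ContinuousLinearMap.smulRight_apply, S.fderiv_push hz, (S.parallel hz).1,
    hc z hz, ← htdef, smul_eq_mul] at h3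
  have hH := S.mean_curvature_eq hz
  rw [← htdef] at hH
  constructor
  · intro s
    have h4 := congrArg (coord f ν σ 1 e s z) h3
    simp only [map_zero, map_add, map_sum, map_smul, map_neg, S.coord_push hz,
      S.coord_center hz (hc z hz), smul_eq_mul, mul_ite, mul_one, mul_zero, neg_zero, add_zero,
      Finset.sum_add_distrib, Finset.sum_ite_eq', Finset.mem_univ, if_true] at h4
    have h5 : ∑ k, t⁻¹ * coord f ν σ t e k z v * (t * structConst m k s) =
        ∑ k, coord f ν σ t e k z v * structConst m k s :=
      Finset.sum_congr rfl fun k _ => by field_simp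
    rw [h5] at h4
    field_simp at h4
    split_ifs at h4 ⊢ <;> linarith
  · have h4 := congrArg (radial f ν H z) h3
    have hrE : ∀ s, radial f ν H z (fderiv ℝ f z (e s z)) = 0 := fun s => by
      rw [radial_apply, transversal_fderiv (S.sphere.frame_invertible hz), mul_zero]
    simp only [map_zero, map_add, map_sum, map_smul, map_neg, hrE,
      S.radial_center hz (hc z hz), smul_eq_mul, mul_one, mul_zero, add_zero, zero_add,
      Finset.sum_const_zero, mul_ite, ite_mul, zero_mul, mul_neg, Finset.sum_ite_eq,
      Finset.sum_neg_distrib, Finset.mem_univ, if_true] at h4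
    apply mul_left_cancel₀ ht
    field_simp at h4
    linear_combination -h4 + σ * sgn m * coord f ν σ t e m z v * hH -
      t ^ 2 * sgn m * coord f ν σ t e m z v * S.sign

/-- The equation of the model in coordinates adapted to the frame. -/
def modelCoords (a : ℝ) (b : Fin 3 → ℝ) : E4 := !₂[a + b 0, b 1 - b 2, a - b 0, b 1 + b 2]

lemma modelCoords_mem (a : ℝ) (b : Fin 3 → ℝ) : modelCoords a b ∈ model ↔
    ((a + b 0) ^ 2 + (b 1 - b 2) ^ 2) * ((a - b 0) ^ 2 + (b 1 + b 2) ^ 2) = 1 := by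
  simp [model, modelCoords]

/-- The four coordinates form the complex numbers (r + b₀) + i(b₁ - b₂) and (r - b₀) + i(b₁ + b₂).
Along each frame vector the linear system multiplies them by factors with opposite real parts, so
the logarithmic derivatives of their squared moduli cancel. -/
lemma norm_coord_const (S : IsAdaptedOn f ν V H σ l e) {c : E4}
    (hc : ∀ w ∈ V, ν w = -(H • (f w - c))) {t : ℝ} (ht : ∀ w ∈ V, l w = t) (v : E4) :
    ∀ w ∈ V, fderiv ℝ (fun w => ((radial f ν H w v + coord f ν σ t e 0 w v) ^ 2 +
      (coord f ν σ t e 1 w v - coord f ν σ t e 2 w v) ^ 2) *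
      ((radial f ν H w v - coord f ν σ t e 0 w v) ^ 2 +
      (coord f ν σ t e 1 w v + coord f ν σ t e 2 w v) ^ 2)) w = 0 ∧
    DifferentiableAt ℝ (fun w => ((radial f ν H w v + coord f ν σ t e 0 w v) ^ 2 +
      (coord f ν σ t e 1 w v - coord f ν σ t e 2 w v) ^ 2) *
      ((radial f ν H w v - coord f ν σ t e 0 w v) ^ 2 +
      (coord f ν σ t e 1 w v + coord f ν σ t e 2 w v) ^ 2)) w := by
  intro w hw
  have hr := (S.differentiableAt_radial hw v).hasFDerivAt
  have hb := fun k => (S.differentiableAt_coord hw t k v).hasFDerivAt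
  have hd := (((hr.add (hb 0)).pow 2).add (((hb 1).sub (hb 2)).pow 2)).mul
    (((hr.sub (hb 0)).pow 2).add (((hb 1).add (hb 2)).pow 2))
  refine ⟨?_, hd.differentiableAt⟩
  refine hd.fderiv.trans ?_
  ext X
  rw [(S.adapted w hw).expand S.sign X, map_sum]
  refine (Finset.sum_eq_zero fun m _ => ?_).trans rfl
  rw [map_smul]
  obtain ⟨h1, h2⟩ := S.fderiv_coord hw hc v m
  rw [ht w hw] at h1 h2
  simp only [add_apply, sub_apply, smul_apply, h1, h2, smul_eq_mul, Fin.sum_univ_three]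
  refine mul_eq_zero_of_right _ ?_
  fin_cases m <;> simp [structConst, sgn] <;> ring

/-- Near each point the hypersurface is linearly equivalent to the model. -/
theorem exists_local_model (S : IsAdaptedOn f ν V H σ l e) {c : E4}
    (hc : ∀ w ∈ V, ν w = -(H • (f w - c))) (hz : z ∈ V) :
    ∃ B : E4 ≃ₗ[ℝ] E4, ∀ᶠ w in 𝓝 z, B (f w - c) ∈ model := by
  obtain ⟨r, hr, hrV⟩ := Metric.isOpen_iff.1 S.sphere.isOpen z hz
  have hpre : IsPreconnected (Metric.ball z r) := (convex_ball z r).isPreconnected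
  have hzr : z ∈ Metric.ball z r := Metric.mem_ball_self hr
  have hconst : ∀ w ∈ Metric.ball z r, l w = l z := fun w hw =>
    Metric.isOpen_ball.is_const_of_fderiv_eq_zero hpre
      (fun x hx => (S.diff x (hrV hx)).differentiableWithinAt)
      (fun x hx => (S.parallel (hrV hx)).2) hw hzr
  have S' : IsAdaptedOn f ν (Metric.ball z r) H σ l e :=
    { sphere := ⟨Metric.isOpen_ball, fun y hy => S.sphere.smooth y (hrV hy),
        fun y hy => S.sphere.smooth_normal y (hrV hy),
        fun y hy => S.sphere.indefinite y (hrV hy), fun y hy => S.sphere.weingarten y (hrV hy)⟩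
      sign := S.sign
      smooth := fun y hy => S.smooth y (hrV hy)
      diff := fun y hy => S.diff y (hrV hy)
      ne_zero := fun y hy => S.ne_zero y (hrV hy)
      adapted := fun y hy => S.adapted y (hrV hy) }
  have hN := S'.norm_coord_const (fun w hw => hc w (hrV hw)) hconst
  let B₀ : E4 →ₗ[ℝ] E4 :=
    { toFun := fun v => modelCoords (radial f ν H z v) fun k => coord f ν σ (l z) e k z v
      map_add' := fun v w => by
        ext i; fin_cases i <;> simp [modelCoords] <;> ring
      map_smul' := fun a v => by
        ext i; fin_cases i <;> simp [modelCoords] <;> ring }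
  have hB₀ : ∀ v, B₀ v = modelCoords (radial f ν H z v) fun k => coord f ν σ (l z) e k z v :=
    fun v => rfl
  have hinj : Function.Injective B₀ := by
    rw [injective_iff_map_eq_zero]
    intro v hv
    rw [hB₀] at hv
    have h0 := congrFun (congrArg (fun x : E4 => (x : Fin 4 → ℝ)) hv) 0
    have h1 := congrFun (congrArg (fun x : E4 => (x : Fin 4 → ℝ)) hv) 1
    have h2 := congrFun (congrArg (fun x : E4 => (x : Fin 4 → ℝ)) hv) 2
    have h3 := congrFun (congrArg (fun x : E4 => (x : Fin 4 → ℝ)) hv) 3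
    simp [modelCoords] at h0 h1 h2 h3
    rw [S.expand_coord hz (hc z hz) (S.ne_zero z hz) v, Fin.sum_univ_three,
      show coord f ν σ (l z) e 0 z v = 0 by linarith,
      show coord f ν σ (l z) e 1 z v = 0 by linarith,
      show coord f ν σ (l z) e 2 z v = 0 by linarith,
      show radial f ν H z v = 0 by linarith]
    simp
  refine ⟨LinearEquiv.ofInjectiveEndo B₀ hinj, ?_⟩
  filter_upwards [Metric.ball_mem_nhds z hr] with w hw
  -- The fixed vector `f w - c` is measured in the frames at `z` and at `w`. At `w` its radial
  -- coordinate is 1 and the others vanish, so the value of the first integral is 1.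
  have h1 := Metric.isOpen_ball.is_const_of_fderiv_eq_zero hpre
    (fun x hx => ((hN (f w - c) x hx).2).differentiableWithinAt)
    (fun x hx => (hN (f w - c) x hx).1) hzr hw
  simp only [S.coord_center (hrV hw) (hc w (hrV hw)), S.radial_center (hrV hw) (hc w (hrV hw))]
    at h1
  change B₀ (f w - c) ∈ model
  rw [hB₀, modelCoords_mem]
  exact h1.trans (by norm_num)

end IsAdaptedOn

/-! ### From local to global -/

/-- The quartic polynomial whose level set is the model. -/
def quartic (x : E4) : ℝ := (x 0 ^ 2 + x 1 ^ 2) * (x 2 ^ 2 + x 3 ^ 2)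

lemma mem_model_iff (x : E4) : x ∈ model ↔ quartic x = 1 := Iff.rfl

lemma quartic_smul (t : ℝ) (x : E4) : quartic (t • x) = t ^ 4 * quartic x := by
  simp [quartic]; ring

/-- Both sides are polynomial, so the identity theorem for analytic functions applies. -/
lemma quartic_comp_eq_of_eventuallyEq {B B' : E4 ≃ₗ[ℝ] E4} {x : E4}
    (h : (fun v => quartic (B v)) =ᶠ[𝓝 x] fun v => quartic (B' v)) (v : E4) :
    quartic (B v) = quartic (B' v) := by
  have key : ∀ B : E4 ≃ₗ[ℝ] E4, AnalyticOnNhd ℝ (fun v => quartic (B v)) Set.univ := by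
    intro B w _
    have hl : ∀ i : Fin 4, AnalyticAt ℝ (fun v => (B v) i) w := fun i =>
      ((EuclideanSpace.proj i : E4 →L[ℝ] ℝ).comp
        (B.toContinuousLinearEquiv : E4 →L[ℝ] E4)).analyticAt w
    exact (((hl 0).pow 2).add ((hl 1).pow 2)).mul (((hl 2).pow 2).add ((hl 3).pow 2))
  exact congrFun ((key B).eq_of_eventuallyEq (key B') h) v

/-- The cone over a piece of a hypersurface transverse to the position vector is open. -/
lemma eventually_mem_cone {f ν : E3 → E4} {y : E3} {c : E4} {H : ℝ} (hf : ContDiffAt ℝ ∞ f y)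
    (hi : (frame f ν y).IsInvertible) (hν : ν y = -(H • (f y - c))) {S : Set E3} (hS : S ∈ 𝓝 y) :
    ∀ᶠ x in 𝓝 (f y - c), ∃ z ∈ S, ∃ t : ℝ, 0 < t ∧ x = t • (f z - c) := by
  let g : E3 × ℝ → E4 := fun p => p.2 • (f p.1 - c)
  have hf' : HasStrictFDerivAt f (fderiv ℝ f y) y := hf.hasStrictFDerivAt (by simp)
  have hf1 : HasStrictFDerivAt (fun p : E3 × ℝ => f p.1)
      ((fderiv ℝ f y).comp (ContinuousLinearMap.fst ℝ E3 ℝ)) (y, 1) :=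
    HasStrictFDerivAt.comp (y, (1 : ℝ)) (g := f) (f := Prod.fst) hf' hasStrictFDerivAt_fst
  have hg := (hasStrictFDerivAt_snd (𝕜 := ℝ) (p := (y, (1 : ℝ)))).smul (hf1.sub_const c)
  have hmap := hg.map_nhds_eq_of_surj (by
    rw [LinearMap.range_eq_top]
    intro v
    obtain ⟨⟨X, r⟩, h⟩ := hi.surjective v
    -- The derivative at `(y, 1)` is the frame map with the normal replaced by the position vector,
    -- and `ν y` is `-H` times the latter.
    refine ⟨(X, -(r * H)), ?_⟩
    rw [frame_apply] at h
    simp only at h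
    rw [hν] at h
    rw [← h]
    simp
    module)
  have h1 : S ×ˢ Set.Ioi (0 : ℝ) ∈ 𝓝 (y, (1 : ℝ)) :=
    prod_mem_nhds hS (Ioi_mem_nhds one_pos)
  have h2 := image_mem_map (m := ((fun p : E3 × ℝ => p.2) • fun p : E3 × ℝ => f p.1 - c)) h1
  rw [hmap] at h2
  simp only [Pi.smul_apply', one_smul] at h2
  filter_upwards [h2] with x hx
  obtain ⟨⟨z, t⟩, ⟨hz, ht⟩, rfl⟩ := hx
  exact ⟨z, hz, t, ht, rfl⟩

lemma eventually_of_chart {M : Type*} [TopologicalSpace M]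
    {e : OpenPartialHomeomorph M E3} {p : M} (hp : p ∈ e.source)
    {P : M → Prop} (h : ∀ᶠ z in 𝓝 (e p), P (e.symm z)) : ∀ᶠ q in 𝓝 p, P q := by
  filter_upwards [(e.continuousAt hp).eventually h, e.open_source.mem_nhds hp] with q hq hqs
  rwa [e.left_inv hqs] at hq

/-! ### Patching the local equations on the manifold. -/

section Global

variable {M : Type*} [TopologicalSpace M] [ChartedSpace E3 M]

lemma contDiffAt_comp_chart_symm [IsManifold (𝓡 3) ∞ M] {φ : M → E4}
    (hφ : ContMDiff (𝓡 3) 𝓘(ℝ, E4) ∞ φ) {e : OpenPartialHomeomorph M E3}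
    (he : e ∈ IsManifold.maximalAtlas (𝓡 3) ∞ M) {y : E3} (hy : y ∈ e.target) :
    ContDiffAt ℝ ∞ (φ ∘ e.symm) y := by
  have h1 := contMDiffAt_symm_of_mem_maximalAtlas he hy
  exact (ContMDiffAt.comp y (hφ (e.symm y)) h1).contDiffAt

/-- The shape operator sees only the tangential part of the derivative of the normal; for a Blaschke
normal this is the whole derivative. -/
lemma IsIndefiniteAffineHypersphere.exists_curvature [IsManifold (𝓡 3) ∞ M] {φ ξ : M → E4}
    (h : IsIndefiniteAffineHypersphere φ ξ) : ∃ H : ℝ,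
    ∀ e ∈ IsManifold.maximalAtlas (𝓡 3) ∞ M,
      IsLocalSphere (φ ∘ e.symm) (ξ ∘ e.symm) e.target H := by
  obtain ⟨H, hH⟩ := h.shape_eq
  refine ⟨H, fun e he => ⟨e.open_target, fun y hy => contDiffAt_comp_chart_symm h.immersion.smooth
    he hy, fun y hy => contDiffAt_comp_chart_symm h.smooth_normal he hy,
    h.indefinite e he, fun y hy X => ?_⟩⟩
  obtain ⟨P, hP⟩ := (h.indefinite e he y hy).exists_pos
  have hi := frame_isInvertible_of_metric_ne_zero hP.ne'
  obtain ⟨W, hW⟩ := (h.blaschke e he y hy).tangent X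
  have hW' : fderiv ℝ (φ ∘ e.symm) y W = fderiv ℝ (ξ ∘ e.symm) y X := hW
  have hs : -(tangential (φ ∘ e.symm) (ξ ∘ e.symm) y (fderiv ℝ (ξ ∘ e.symm) y X)) = H • X :=
    hH e he y hy X
  rw [← hW', tangential_fderiv hi] at hs
  rw [← hW', ← map_smul, ← hs, map_neg, neg_neg]

/-- The affine normals meet at a common center, or are parallel. -/
lemma exists_center [IsManifold (𝓡 3) ∞ M] [ConnectedSpace M] {φ ξ : M → E4} {H : ℝ}
    (h : ∀ e ∈ IsManifold.maximalAtlas (𝓡 3) ∞ M,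
      IsLocalSphere (φ ∘ e.symm) (ξ ∘ e.symm) e.target H) :
    ∃ b : E4, ∀ p, ξ p + H • φ p = b := by
  have hlc : IsLocallyConstant fun p => ξ p + H • φ p := by
    rw [IsLocallyConstant.iff_eventually_eq]
    intro p
    let e := chartAt E3 p
    have he : e ∈ IsManifold.maximalAtlas (𝓡 3) ∞ M := IsManifold.chart_mem_maximalAtlas p
    have hp : p ∈ e.source := mem_chart_source E3 p
    have S := h e he
    obtain ⟨r, hr, hrV⟩ := Metric.isOpen_iff.1 S.isOpen (e p) (e.map_source hp)
    have hd : ∀ z ∈ Metric.ball (e p) r, HasFDerivAt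
        (fun z => (ξ ∘ e.symm) z + H • (φ ∘ e.symm) z) (0 : E3 →L[ℝ] E4) z := by
      intro z hz
      have h1 := ((differentiableAt_of_smooth (S.smooth_normal z (hrV hz))).hasFDerivAt).add
        ((differentiableAt_of_smooth (S.smooth z (hrV hz))).hasFDerivAt.const_smul H)
      convert! h1 using 1
      ext X : 1
      simp [S.weingarten z (hrV hz)]
    refine eventually_of_chart hp ?_
    filter_upwards [Metric.ball_mem_nhds (e p) hr] with z hz
    have := Metric.isOpen_ball.is_const_of_fderiv_eq_zero (convex_ball (e p) r).isPreconnected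
      (fun x hx => (hd x hx).differentiableAt.differentiableWithinAt)
      (fun x hx => (hd x hx).fderiv) hz (Metric.mem_ball_self hr)
    simpa [e.left_inv hp] using this
  obtain ⟨p₀⟩ : Nonempty M := inferInstance
  exact ⟨_, fun p => hlc.apply_eq_of_isPreconnected isPreconnected_univ (Set.mem_univ p)
    (Set.mem_univ p₀)⟩

/-- The pointwise symmetry gives adapted frames. -/
lemma exists_adapted_of_symmetry {f ν : E3 → E4} {U : Set E3} {H : ℝ} (S : IsLocalSphere f ν U H)
    {y : E3} (hy : y ∈ U) (hiso : Nonempty (stabilizer f ν y ≃*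
      Multiplicative (ZMod 2) × Multiplicative (ZMod 2))) :
    ∃ σ l e, (σ = 1 ∨ σ = -1) ∧ l ≠ 0 ∧
      IsAdapted (metric f ν y) (differenceTensor f ν y) σ l e := by
  have hi := S.frame_invertible hy
  have hs : ∀ X, shape f ν y X = H • X := by
    intro X
    change -(tangential f ν y (fderiv ℝ ν y X)) = H • X
    rw [S.weingarten y hy, map_neg, neg_neg, map_smul, tangential_fderiv hi]
  refine exists_adapted (K := differenceBilin f ν y) (S.indefinite y hy).nondegenerate
    (S.indefinite y hy).exists_pos (S.indefinite y hy).exists_neg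
    (fun X Y => S.differenceTensor_symm hy X Y) (fun X Y Z => S.cubic_symm hy X Y Z)
    (stabilizer f ν y) (fun L => ⟨fun h => ⟨h.1, h.2.1, h.2.2.1⟩,
      fun h => ⟨h.1, h.2.1, h.2.2, fun X => by rw [hs, hs, map_smul]⟩⟩) hiso

theorem equivalent_of_symmetry [IsManifold (𝓡 3) ∞ M] [ConnectedSpace M] {φ ξ : M → E4}
    (h : IsIndefiniteAffineHypersphere φ ξ)
    (hsym : HasPointwiseSymmetry (Multiplicative (ZMod 2) × Multiplicative (ZMod 2)) φ ξ) :
    IsAffinelyEquivalentToOpenSubsetOf φ model := by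
  obtain ⟨H, hS⟩ := h.exists_curvature
  obtain ⟨b, hb⟩ := exists_center hS
  have hadapt : ∀ p : M, ∃ (V : Set E3) (σ : ℝ) (l : E3 → ℝ) (E : Fin 3 → E3 → E3),
      V ⊆ (chartAt E3 p).target ∧ chartAt E3 p p ∈ V ∧
      IsAdaptedOn (φ ∘ (chartAt E3 p).symm) (ξ ∘ (chartAt E3 p).symm) V H σ l E := by
    intro p
    have he := IsManifold.chart_mem_maximalAtlas (I := 𝓡 3) (n := ∞) p
    have hy := (chartAt E3 p).map_source (mem_chart_source E3 p)
    have S := hS _ he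
    obtain ⟨σ, l, E, hσ, hE⟩ := exists_smooth_adapted S
      (fun y hy => exists_adapted_of_symmetry S hy (hsym _ he y hy)) hy
    obtain ⟨V, hV, hVo, hyV⟩ := eventually_nhds_iff.1 hE
    refine ⟨V, σ, l, E, fun z hz => (hV z hz).1, hyV, ⟨⟨hVo, ?_, ?_, ?_, ?_⟩, ?_, ?_, ?_, ?_, ?_⟩⟩
    · exact fun z hz => S.smooth z (hV z hz).1
    · exact fun z hz => S.smooth_normal z (hV z hz).1
    · exact fun z hz => S.indefinite z (hV z hz).1
    · exact fun z hz => S.weingarten z (hV z hz).1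
    · rcases hσ with rfl | rfl <;> norm_num
    · exact fun z hz => (hV z hz).2.1
    · exact fun z hz => (hV z hz).2.2.1
    · exact fun z hz => (hV z hz).2.2.2.1
    · exact fun z hz => (hV z hz).2.2.2.2
  obtain ⟨p₀⟩ : Nonempty M := inferInstance
  have hH : H ≠ 0 := by
    obtain ⟨V, σ, l, E, -, hy, A⟩ := hadapt p₀
    exact A.curvature_ne_zero hy
  let c : E4 := H⁻¹ • b
  have hc : ∀ p, ξ p = -(H • (φ p - c)) := by
    intro p
    rw [smul_sub, smul_inv_smul₀ hH, ← hb p]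
    abel
  have hlocal : ∀ p : M, ∃ B : E4 ≃ₗ[ℝ] E4, ∀ᶠ q in 𝓝 p, quartic (B (φ q - c)) = 1 := by
    intro p
    obtain ⟨V, σ, l, E, -, hy, A⟩ := hadapt p
    obtain ⟨B, hB⟩ := A.exists_local_model (fun w _ => hc _) hy
    exact ⟨B, eventually_of_chart (mem_chart_source E3 p) hB⟩
  have hcone : ∀ p : M, ∀ S ∈ 𝓝 p, ∀ᶠ x in 𝓝 (φ p - c), ∃ q ∈ S, ∃ t : ℝ, 0 < t ∧
      x = t • (φ q - c) := by
    intro p S hSp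
    have he := IsManifold.chart_mem_maximalAtlas (I := 𝓡 3) (n := ∞) p
    have hp := mem_chart_source E3 p
    have hy := (chartAt E3 p).map_source hp
    have L := hS _ he
    have := eventually_mem_cone (L.smooth _ hy) (L.frame_invertible hy) (hc _)
      (S := (chartAt E3 p).symm ⁻¹' S) (((chartAt E3 p).continuousAt_symm hy).preimage_mem_nhds
        (by rwa [(chartAt E3 p).left_inv hp]))
    simp only [Function.comp, (chartAt E3 p).left_inv hp] at this
    filter_upwards [this] with x hx
    obtain ⟨z, hz, t, ht, rfl⟩ := hx
    exact ⟨_, hz, t, ht, rfl⟩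
  choose B hB using hlocal
  -- The maps `B p` need not agree at nearby points, since they depend on choices, but the quartics
  -- that they pull back do.
  have hq : IsLocallyConstant fun p => fun v => quartic (B p v) := by
    rw [IsLocallyConstant.iff_eventually_eq]
    intro p
    filter_upwards [eventually_eventually_nhds.2 (hB p)] with p' hp'
    funext v
    refine quartic_comp_eq_of_eventuallyEq (x := φ p' - c) ?_ v
    -- Both pulled-back quartics are 1 on a piece of the hypersurface, so by homogeneity they agree
    -- on the open cone over it.
    filter_upwards [hcone p' _ (hp'.and (hB p'))] with x hx
    obtain ⟨q, hq, t, -, rfl⟩ := hx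
    have hq' : quartic (B p (φ q - c)) = 1 ∧ quartic (B p' (φ q - c)) = 1 := hq
    rw [map_smul, map_smul, quartic_smul, quartic_smul, hq'.1, hq'.2]
  have hglobal : ∀ p, quartic (B p₀ (φ p - c)) = 1 := by
    intro p
    have := congrFun (hq.apply_eq_of_isPreconnected isPreconnected_univ (Set.mem_univ p₀)
      (Set.mem_univ p)) (φ p - c)
    rw [this]
    exact (hB p).self_of_nhds
  let A : E4 ≃ᵃ[ℝ] E4 := (AffineEquiv.constVAdd ℝ E4 (-c)).trans (B p₀).toAffineEquiv
  have hA : ∀ x, A x = B p₀ (x - c) := by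
    intro x
    simp only [A, AffineEquiv.trans_apply, AffineEquiv.constVAdd_apply,
      LinearEquiv.coe_toAffineEquiv, vadd_eq_add]
    rw [neg_add_eq_sub]
  let T : Set E4 := A '' Set.range φ
  have hT : T ⊆ model := by
    rintro _ ⟨_, ⟨p, rfl⟩, rfl⟩
    rw [hA]
    exact hglobal p
  -- This is the largest open set whose intersection with the model is contained in the image.
  refine ⟨A, interior (T ∪ modelᶜ), isOpen_interior, Set.Subset.antisymm ?_ ?_⟩
  · intro x hx
    refine ⟨hT hx, mem_interior_iff_mem_nhds.2 ?_⟩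
    obtain ⟨_, ⟨p, rfl⟩, rfl⟩ := hx
    have hcont : Tendsto (B p₀).symm (𝓝 (A (φ p))) (𝓝 (φ p - c)) := by
      have := (B p₀).symm.toContinuousLinearEquiv.continuous.tendsto (A (φ p))
      rw [hA] at this ⊢
      simpa using this
    -- Points near the image are positive multiples `t` of image points; such a point lies in the
    -- model only if `t ^ 4 = 1`, that is `t = 1`.
    filter_upwards [hcont.eventually (hcone p _ univ_mem)] with u hu
    by_cases hum : u ∈ model
    · left
      obtain ⟨q, -, t, ht, hut⟩ := hu
      have hu' : u = t • B p₀ (φ q - c) := by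
        rw [← map_smul, ← hut, LinearEquiv.apply_symm_apply]
      rw [hu', mem_model_iff, quartic_smul, hglobal q, mul_one] at hum
      have ht1 : t = 1 := (pow_eq_one_iff_of_nonneg ht.le (by norm_num)).1 hum
      refine ⟨φ q, ⟨q, rfl⟩, ?_⟩
      rw [hA, hu', ht1, one_smul]
    · exact Or.inr hum
  · rintro x ⟨hx, hxU⟩
    exact (interior_subset hxU).resolve_right fun h => h hx

end Global

/-! ### Hypersurfaces contained in the model -/

/-- The model metric. -/
def eta (x y : E3) : ℝ := x 0 * y 0 - x 1 * y 1 - x 2 * y 2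

/-- The model difference tensor. -/
def mul3 (x y : E3) : E3 :=
  !₂[x 1 * y 2 + x 2 * y 1, -(x 0 * y 2 + x 2 * y 0), -(x 0 * y 1 + x 1 * y 0)]

/-- The embedding of the model tangent space in `ℂ × ℂ`, first component. -/
def fstC (x : E3) : ℂ := ⟨x 0, x 1 - x 2⟩

/-- The embedding of the model tangent space in `ℂ × ℂ`, second component. -/
def sndC (x : E3) : ℂ := ⟨-x 0, x 1 + x 2⟩

/-- The pair `(fstC, sndC)` identifies `E3` with the hyperplane of ℂ × ℂ where the real parts
cancel, a complement of the real line through the unit (1, 1). With `sndC_mul`, the product of two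
such elements splits into `mul3` and `eta` times the unit. -/
lemma fstC_mul (x y : E3) : fstC x * fstC y = fstC (mul3 x y) + eta x y := by
  apply Complex.ext <;> simp [fstC, mul3, eta] <;> ring

lemma sndC_mul (x y : E3) : sndC x * sndC y = sndC (mul3 x y) + eta x y := by
  apply Complex.ext <;> simp [sndC, mul3, eta] <;> ring

lemma fstC_add (x y : E3) : fstC (x + y) = fstC x + fstC y := by
  apply Complex.ext <;> simp [fstC]; ring

lemma sndC_add (x y : E3) : sndC (x + y) = sndC x + sndC y := by
  apply Complex.ext <;> simp [sndC] <;> ring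

lemma eq_of_fstC_sndC {x y : E3} (h1 : fstC x = fstC y) (h2 : sndC x = sndC y) : x = y := by
  have a := congrArg Complex.re h1
  have b := congrArg Complex.im h1
  have d := congrArg Complex.im h2
  simp only [fstC, sndC] at a b d
  ext i
  fin_cases i <;> simp <;> linarith

/-- The linear map with `fstC (logMap θ ω) = θ` and `sndC (logMap θ ω) = ω` if
`re θ + re ω = 0`. -/
def logMap : ℂ × ℂ →L[ℝ] E3 :=
  LinearMap.toContinuousLinearMap
    { toFun := fun p => !₂[p.1.re, (p.1.im + p.2.im) / 2, (p.2.im - p.1.im) / 2]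
      map_add' := fun p q => by ext i; fin_cases i <;> simp <;> ring
      map_smul' := fun a p => by ext i; fin_cases i <;> simp <;> ring }

lemma fstC_logMap (p : ℂ × ℂ) : fstC (logMap p) = p.1 := by
  apply Complex.ext <;> simp [fstC, logMap]; ring

lemma sndC_logMap {p : ℂ × ℂ} (h : p.1.re + p.2.re = 0) : sndC (logMap p) = p.2 := by
  apply Complex.ext <;> simp [sndC, logMap]
  · linarith
  · ring

/-- The logarithmic derivative of `f - c` with respect to a pair of complex linear coordinates. -/
def logForm (p q : E4 →L[ℝ] ℂ) (f : E3 → E4) (c : E4) (z : E3) : E3 →ₗ[ℝ] E3 where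
  toFun Y := logMap (p (fderiv ℝ f z Y) / p (f z - c), q (fderiv ℝ f z Y) / q (f z - c))
  map_add' X Y := by
    rw [← map_add]; congr 1
    simp only [map_add, add_div, Prod.mk_add_mk]
  map_smul' a X := by
    rw [RingHom.id_apply, ← map_smul]; congr 1
    simp only [map_smul, Prod.smul_mk, smul_div_assoc]

lemma logForm_apply (p q : E4 →L[ℝ] ℂ) (f : E3 → E4) (c : E4) (z Y : E3) : logForm p q f c z Y =
    logMap (p (fderiv ℝ f z Y) / p (f z - c), q (fderiv ℝ f z Y) / q (f z - c)) := rfl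

/-- A parametrized piece of the hypersurface `|p (x - c)|² |q (x - c)|² = 1`, for a pair `(p, q)`
of complex linear coordinates. -/
structure IsModelPatch (p q : E4 →L[ℝ] ℂ) (f : E3 → E4) (c : E4) (U : Set E3) : Prop where
  isOpen : IsOpen U
  coords : ∀ v, p v = 0 → q v = 0 → v = 0
  smooth : ∀ z ∈ U, ContDiffAt ℝ ∞ f z
  immersive : ∀ z ∈ U, Function.Injective (fderiv ℝ f z)
  norm_eq : ∀ z ∈ U, Complex.normSq (p (f z - c)) * Complex.normSq (q (f z - c)) = 1

/-! ### Metric, connection and difference tensor of a patch of the model. -/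

namespace IsModelPatch

variable {p q : E4 →L[ℝ] ℂ} {f : E3 → E4} {c : E4} {U : Set E3} {z : E3}

lemma eventually_mem (S : IsModelPatch p q f c U) (hz : z ∈ U) : ∀ᶠ w in 𝓝 z, w ∈ U :=
  S.isOpen.mem_nhds hz

lemma fst_ne_zero (S : IsModelPatch p q f c U) (hz : z ∈ U) : p (f z - c) ≠ 0 := by
  intro h
  have := S.norm_eq z hz
  simp [h] at this

lemma snd_ne_zero (S : IsModelPatch p q f c U) (hz : z ∈ U) : q (f z - c) ≠ 0 := by
  intro h
  have := S.norm_eq z hz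
  simp [h] at this

lemma ext_coords (S : IsModelPatch p q f c U) {v w : E4} (h1 : p v = p w) (h2 : q v = q w) :
    v = w :=
  sub_eq_zero.1 (S.coords _ (by rw [map_sub, h1, sub_self]) (by rw [map_sub, h2, sub_self]))

lemma hasFDerivAt_coord (S : IsModelPatch p q f c U) (hz : z ∈ U) (r : E4 →L[ℝ] ℂ) :
    HasFDerivAt (fun w => r (f w - c)) (r.comp (fderiv ℝ f z)) z :=
  r.hasFDerivAt.comp z ((differentiableAt_of_smooth (S.smooth z hz)).hasFDerivAt.sub_const c)

lemma hasFDerivAt_coord_fderiv (S : IsModelPatch p q f c U) (hz : z ∈ U) (r : E4 →L[ℝ] ℂ)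
    (Y : E3) : HasFDerivAt (fun w => r (fderiv ℝ f w Y))
      (r.comp ((fderiv ℝ (fderiv ℝ f) z).flip Y)) z := by
  have h1 := (differentiableAt_of_smooth (contDiffAt_fderiv (S.smooth z hz))).hasFDerivAt.clm_apply
    (hasFDerivAt_const Y z)
  have h2 := r.hasFDerivAt.comp z h1
  convert! h2 using 1
  ext X
  simp

/-- Half the logarithmic derivative of the equation of the model. -/
lemma re_add_re (S : IsModelPatch p q f c U) (hz : z ∈ U) (Y : E3) :
    (p (fderiv ℝ f z Y) / p (f z - c)).re + (q (fderiv ℝ f z Y) / q (f z - c)).re = 0 := by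
  have hn : ∀ r : E4 →L[ℝ] ℂ, HasFDerivAt (fun w => Complex.normSq (r (f w - c))) _ z := fun r => by
    have h := S.hasFDerivAt_coord hz r
    have h1 := Complex.reCLM.hasFDerivAt.comp z h
    have h2 := Complex.imCLM.hasFDerivAt.comp z h
    exact (h1.mul h1).add (h2.mul h2)
  have hc : (fun w => Complex.normSq (p (f w - c)) * Complex.normSq (q (f w - c))) =ᶠ[𝓝 z]
      fun _ => 1 := by
    filter_upwards [S.eventually_mem hz] with w hw using S.norm_eq w hw
  have h := congrArg (fun L => L Y)
    (((hn p).mul (hn q)).unique ((hasFDerivAt_const (1 : ℝ) z).congr_of_eventuallyEq hc))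
  simp at h
  have h1 := S.norm_eq z hz
  have hp : Complex.normSq (p (f z - c)) ≠ 0 :=
    left_ne_zero_of_mul (by rw [h1]; exact one_ne_zero)
  have hq : Complex.normSq (q (f z - c)) ≠ 0 :=
    right_ne_zero_of_mul (by rw [h1]; exact one_ne_zero)
  rw [Complex.div_re, Complex.div_re]
  field_simp
  rw [map_sub, map_sub]
  simp only [Complex.sub_re, Complex.sub_im]
  linarith

lemma fst_fderiv (S : IsModelPatch p q f c U) (hz : z ∈ U) (Y : E3) :
    p (fderiv ℝ f z Y) = p (f z - c) * fstC (logForm p q f c z Y) := by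
  rw [logForm_apply, fstC_logMap, mul_div_cancel₀ _ (S.fst_ne_zero hz)]

lemma snd_fderiv (S : IsModelPatch p q f c U) (hz : z ∈ U) (Y : E3) :
    q (fderiv ℝ f z Y) = q (f z - c) * sndC (logForm p q f c z Y) := by
  rw [logForm_apply, sndC_logMap (S.re_add_re hz Y), mul_div_cancel₀ _ (S.snd_ne_zero hz)]

lemma logForm_injective (S : IsModelPatch p q f c U) (hz : z ∈ U) :
    Function.Injective (logForm p q f c z) := by
  rw [injective_iff_map_eq_zero]
  intro Y hY
  apply S.immersive z hz
  rw [map_zero]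
  apply S.coords
  · rw [S.fst_fderiv hz, hY]; apply Complex.ext <;> simp [fstC]
  · rw [S.snd_fderiv hz, hY]; apply Complex.ext <;> simp [sndC]

lemma logForm_surjective (S : IsModelPatch p q f c U) (hz : z ∈ U) :
    Function.Surjective (logForm p q f c z) :=
  LinearMap.injective_iff_surjective.1 (S.logForm_injective hz)

lemma differentiableAt_logForm (S : IsModelPatch p q f c U) (hz : z ∈ U) (Y : E3) :
    DifferentiableAt ℝ (fun w => logForm p q f c w Y) z := by
  have h1 := (S.hasFDerivAt_coord_fderiv hz p Y).differentiableAt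
  have h2 := (S.hasFDerivAt_coord_fderiv hz q Y).differentiableAt
  have h3 := (S.hasFDerivAt_coord hz p).differentiableAt
  have h4 := (S.hasFDerivAt_coord hz q).differentiableAt
  have h5 : DifferentiableAt ℝ (fun w => p (fderiv ℝ f w Y) / p (f w - c)) z := by
    simp only [div_eq_mul_inv]
    exact h1.mul (h3.inv (S.fst_ne_zero hz))
  have h6 : DifferentiableAt ℝ (fun w => q (fderiv ℝ f w Y) / q (f w - c)) z := by
    simp only [div_eq_mul_inv]
    exact h2.mul (h4.inv (S.snd_ne_zero hz))
  exact logMap.differentiableAt.comp z (h5.prodMk h6)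

/-- This is the product rule applied to `fst_fderiv`, which holds on a neighbourhood. -/
lemma fst_fderiv_fderiv (S : IsModelPatch p q f c U) (hz : z ∈ U) (X Y : E3) :
    p (fderiv ℝ (fderiv ℝ f) z X Y) = p (f z - c) * (fstC (logForm p q f c z X) *
      fstC (logForm p q f c z Y) + fstC (fderiv ℝ (fun w => logForm p q f c w Y) z X)) := by
  let F : E3 →L[ℝ] ℂ := LinearMap.toContinuousLinearMap
    { toFun := fstC, map_add' := fstC_add
      map_smul' := fun a x => by apply Complex.ext <;> simp [fstC]; ring }
  have hF : ∀ x, F x = fstC x := fun x => rfl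
  have h1 := (S.hasFDerivAt_coord hz p).mul
    (F.hasFDerivAt.comp z (S.differentiableAt_logForm hz Y).hasFDerivAt)
  have he : (fun w => p (fderiv ℝ f w Y)) =ᶠ[𝓝 z]
      (fun w => p (f w - c)) * (F ∘ fun w => logForm p q f c w Y) := by
    filter_upwards [S.eventually_mem hz] with w hw using S.fst_fderiv hw Y
  have := congrArg (fun L => L X)
    ((S.hasFDerivAt_coord_fderiv hz p Y).unique (h1.congr_of_eventuallyEq he))
  simp [hF, -map_sub] at this
  rw [this, S.fst_fderiv hz X]
  ring

lemma snd_fderiv_fderiv (S : IsModelPatch p q f c U) (hz : z ∈ U) (X Y : E3) :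
    q (fderiv ℝ (fderiv ℝ f) z X Y) = q (f z - c) * (sndC (logForm p q f c z X) *
      sndC (logForm p q f c z Y) + sndC (fderiv ℝ (fun w => logForm p q f c w Y) z X)) := by
  let F : E3 →L[ℝ] ℂ := LinearMap.toContinuousLinearMap
    { toFun := sndC, map_add' := sndC_add
      map_smul' := fun a x => by apply Complex.ext <;> simp [sndC]; ring }
  have hF : ∀ x, F x = sndC x := fun x => rfl
  have h1 := (S.hasFDerivAt_coord hz q).mul
    (F.hasFDerivAt.comp z (S.differentiableAt_logForm hz Y).hasFDerivAt)
  have he : (fun w => q (fderiv ℝ f w Y)) =ᶠ[𝓝 z]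
      (fun w => q (f w - c)) * (F ∘ fun w => logForm p q f c w Y) := by
    filter_upwards [S.eventually_mem hz] with w hw using S.snd_fderiv hw Y
  have := congrArg (fun L => L X)
    ((S.hasFDerivAt_coord_fderiv hz q Y).unique (h1.congr_of_eventuallyEq he))
  simp [hF, -map_sub] at this
  rw [this, S.snd_fderiv hz X]
  ring

/-- The logarithmic derivative is closed. -/
lemma fderiv_logForm_symm (S : IsModelPatch p q f c U) (hz : z ∈ U) (X Y : E3) :
    fderiv ℝ (fun w => logForm p q f c w Y) z X = fderiv ℝ (fun w => logForm p q f c w X) z Y := by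
  have hs := fderiv_fderiv_symm (S.smooth z hz) X Y
  apply eq_of_fstC_sndC
  · have h := congrArg p hs
    rw [S.fst_fderiv_fderiv hz, S.fst_fderiv_fderiv hz] at h
    linear_combination mul_left_cancel₀ (S.fst_ne_zero hz) h
  · have h := congrArg q hs
    rw [S.snd_fderiv_fderiv hz, S.snd_fderiv_fderiv hz] at h
    linear_combination mul_left_cancel₀ (S.snd_ne_zero hz) h

variable {κ : ℝ}

/-- If the position vector were tangent, both logarithmic derivatives would have real part `κ`,
while these parts cancel on tangent vectors. -/
lemma transverse (S : IsModelPatch p q f c U) (hz : z ∈ U) (hκ : κ ≠ 0) :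
    κ • (f z - c) ∉ (fderiv ℝ f z).range := by
  rintro ⟨X, hX⟩
  have hX' : fderiv ℝ f z X = κ • (f z - c) := hX
  have h1 := congrArg p hX'
  have h2 := congrArg q hX'
  rw [S.fst_fderiv hz, map_smul, Complex.real_smul, mul_comm] at h1
  rw [S.snd_fderiv hz, map_smul, Complex.real_smul, mul_comm] at h2
  have h1' := congrArg Complex.re (mul_right_cancel₀ (S.fst_ne_zero hz) h1)
  have h2' := congrArg Complex.re (mul_right_cancel₀ (S.snd_ne_zero hz) h2)
  simp [fstC, sndC] at h1' h2'
  exact hκ (by linarith)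

lemma frame_invertible (S : IsModelPatch p q f c U) (hz : z ∈ U) (hκ : κ ≠ 0) :
    (frame f (fun w => κ • (f w - c)) z).IsInvertible :=
  frame_isInvertible (S.immersive z hz) (S.transverse hz hκ)

lemma smooth_normal (S : IsModelPatch p q f c U) (hz : z ∈ U) :
    ContDiffAt ℝ ∞ (fun w => κ • (f w - c)) z :=
  ((S.smooth z hz).sub contDiffAt_const).const_smul κ

lemma fderiv_normal (S : IsModelPatch p q f c U) (hz : z ∈ U) (X : E3) :
    fderiv ℝ (fun w => κ • (f w - c)) z X = κ • fderiv ℝ f z X := by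
  have h : HasFDerivAt (fun w => κ • (f w - c)) (κ • fderiv ℝ f z) z :=
    ((differentiableAt_of_smooth (S.smooth z hz)).hasFDerivAt.sub_const c).const_smul κ
  rw [h.fderiv]
  rfl

/-- In `fst_fderiv_fderiv` and `snd_fderiv_fderiv` the product splits: its hyperplane part is
tangential and its multiple of the unit is radial. -/
lemma gauss (S : IsModelPatch p q f c U) (hz : z ∈ U) {X Y Z : E3}
    (hZ : logForm p q f c z Z = fderiv ℝ (fun w => logForm p q f c w Y) z X +
      mul3 (logForm p q f c z X) (logForm p q f c z Y)) :
    fderiv ℝ (fderiv ℝ f) z X Y = fderiv ℝ f z Z +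
      eta (logForm p q f c z X) (logForm p q f c z Y) • (f z - c) := by
  apply S.ext_coords
  · rw [S.fst_fderiv_fderiv hz, map_add, S.fst_fderiv hz, hZ, fstC_add, fstC_mul, map_smul,
      Complex.real_smul]
    ring
  · rw [S.snd_fderiv_fderiv hz, map_add, S.snd_fderiv hz, hZ, sndC_add, sndC_mul, map_smul,
      Complex.real_smul]
    ring

lemma metric_christoffel (S : IsModelPatch p q f c U) (hz : z ∈ U) (hκ : κ ≠ 0) (X Y : E3) :
    metric f (fun w => κ • (f w - c)) z X Y =
      κ⁻¹ * eta (logForm p q f c z X) (logForm p q f c z Y) ∧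
    logForm p q f c z (inducedChristoffel f (fun w => κ • (f w - c)) z X Y) =
      fderiv ℝ (fun w => logForm p q f c w Y) z X +
      mul3 (logForm p q f c z X) (logForm p q f c z Y) := by
  obtain ⟨Z, hZ⟩ := S.logForm_surjective hz (fderiv ℝ (fun w => logForm p q f c w Y) z X +
      mul3 (logForm p q f c z X) (logForm p q f c z Y))
  have hi := S.frame_invertible hz hκ
  have hg : fderiv ℝ (fderiv ℝ f) z X Y = fderiv ℝ f z Z +
      (κ⁻¹ * eta (logForm p q f c z X) (logForm p q f c z Y)) • (fun w => κ • (f w - c)) z := by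
    rw [S.gauss hz hZ, smul_smul, mul_right_comm, inv_mul_cancel₀ hκ, one_mul]
  rw [metric_apply, inducedChristoffel_apply, hg, transversal_frame hi, tangential_frame hi]
  exact ⟨rfl, hZ⟩

lemma nondegenerate (S : IsModelPatch p q f c U) (hz : z ∈ U) (hκ : κ ≠ 0) (X : E3)
    (h : ∀ Y : E3, metric f (fun w => κ • (f w - c)) z X Y = 0) : X = 0 := by
  apply S.logForm_injective hz
  rw [map_zero]
  have h' : ∀ v, eta (logForm p q f c z X) v = 0 := by
    intro v
    obtain ⟨Y, rfl⟩ := S.logForm_surjective hz v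
    have := h Y
    rw [(S.metric_christoffel hz hκ X Y).1] at this
    exact (mul_eq_zero.1 this).resolve_left (inv_ne_zero hκ)
  have h0 := h' (EuclideanSpace.single 0 1)
  have h1 := h' (EuclideanSpace.single 1 1)
  have h2 := h' (EuclideanSpace.single 2 1)
  simp [eta] at h0 h1 h2
  ext i
  fin_cases i <;> simp [h0, h1, h2]

lemma isIndefiniteAt (S : IsModelPatch p q f c U) (hz : z ∈ U) (hκ : κ ≠ 0) :
    IsIndefiniteAt f (fun w => κ • (f w - c)) z := by
  obtain ⟨X, hX⟩ := S.logForm_surjective hz (EuclideanSpace.single 0 1)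
  obtain ⟨Y, hY⟩ := S.logForm_surjective hz (EuclideanSpace.single 1 1)
  have h1 := (S.metric_christoffel hz hκ X X).1
  have h2 := (S.metric_christoffel hz hκ Y Y).1
  rw [hX] at h1
  rw [hY] at h2
  simp [eta] at h1 h2
  refine ⟨S.nondegenerate hz hκ, ?_, ?_⟩
  · rcases lt_or_gt_of_ne (inv_ne_zero hκ) with h | h
    · exact ⟨Y, by rw [h2]; linarith⟩
    · exact ⟨X, by rw [h1]; linarith⟩
  · rcases lt_or_gt_of_ne (inv_ne_zero hκ) with h | h
    · exact ⟨X, by rw [h1]; linarith⟩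
    · exact ⟨Y, by rw [h2]; linarith⟩

lemma fderiv_metric (S : IsModelPatch p q f c U) (hz : z ∈ U) (hκ : κ ≠ 0) (X Y Z : E3) :
    fderiv ℝ (metric f (fun w => κ • (f w - c))) z X Y Z =
      κ⁻¹ * (eta (fderiv ℝ (fun w => logForm p q f c w Y) z X) (logForm p q f c z Z) +
        eta (logForm p q f c z Y) (fderiv ℝ (fun w => logForm p q f c w Z) z X)) := by
  have hm := (differentiableAt_of_smooth (contDiffAt_metric (S.smooth z hz) (S.smooth_normal hz)
    (S.frame_invertible hz hκ))).hasFDerivAt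
  have h1 := (hm.clm_apply (hasFDerivAt_const Y z)).clm_apply (hasFDerivAt_const Z z)
  have hl : ∀ (Y : E3) (i : Fin 3), HasFDerivAt (fun w => logForm p q f c w Y i)
      ((EuclideanSpace.proj i : E3 →L[ℝ] ℝ).comp (fderiv ℝ (fun w => logForm p q f c w Y) z)) z :=
    fun Y i => (EuclideanSpace.proj i : E3 →L[ℝ] ℝ).hasFDerivAt.comp z
      (S.differentiableAt_logForm hz Y).hasFDerivAt
  have h2 := ((((hl Y 0).mul (hl Z 0)).sub ((hl Y 1).mul (hl Z 1))).sub
    ((hl Y 2).mul (hl Z 2))).const_mul κ⁻¹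
  have he : (fun w => metric f (fun w => κ • (f w - c)) w Y Z) =ᶠ[𝓝 z] fun w =>
      κ⁻¹ * eta (logForm p q f c w Y) (logForm p q f c w Z) := by
    filter_upwards [S.eventually_mem hz] with w hw using (S.metric_christoffel hw hκ Y Z).1
  have h := congrArg (fun L => L X) (h1.unique (h2.congr_of_eventuallyEq he))
  simp at h
  rw [h]
  simp only [eta]
  ring

lemma eta_symm (x y : E3) : eta x y = eta y x := by simp only [eta]; ring

/-- The difference tensor of a hypersurface in the model. -/
lemma logForm_differenceTensor (S : IsModelPatch p q f c U) (hz : z ∈ U) (hκ : κ ≠ 0)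
    (X Y : E3) : logForm p q f c z (differenceTensor f (fun w => κ • (f w - c)) z X Y) =
      mul3 (logForm p q f c z X) (logForm p q f c z Y) := by
  -- `W` is the connection for which `logForm` is parallel. It preserves the metric, and closedness
  -- of `logForm` makes it torsion-free, so it is the Levi-Civita connection.
  obtain ⟨W, hW⟩ := S.logForm_surjective hz (fderiv ℝ (fun w => logForm p q f c w Y) z X)
  have hn := S.nondegenerate hz hκ
  have hLC : leviCivitaChristoffel (metric f fun w => κ • (f w - c)) z X Y = W := by
    rw [← sub_eq_zero]
    refine hn _ fun Z => ?_
    rw [map_sub, sub_apply, metric_leviCivita hn, (S.metric_christoffel hz hκ W Z).1,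
      koszul_apply, S.fderiv_metric hz hκ, S.fderiv_metric hz hκ, S.fderiv_metric hz hκ, hW,
      S.fderiv_logForm_symm hz Y X, S.fderiv_logForm_symm hz Z X, S.fderiv_logForm_symm hz Z Y,
      eta_symm (logForm p q f c z X), eta_symm (logForm p q f c z Y)]
    ring
  rw [differenceTensor, map_sub, (S.metric_christoffel hz hκ X Y).2, hLC, hW]
  abel

lemma shape_eq (S : IsModelPatch p q f c U) (hz : z ∈ U) (hκ : κ ≠ 0) (X : E3) :
    shape f (fun w => κ • (f w - c)) z X = (-κ) • X := by
  change -(tangential f (fun w => κ • (f w - c)) z (fderiv ℝ (fun w => κ • (f w - c)) z X)) = _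
  rw [S.fderiv_normal hz, map_smul, tangential_fderiv (S.frame_invertible hz hκ), neg_smul]

end IsModelPatch

/-! ### The symmetries of the model -/

/-- The standard basis vector of the model tangent space. -/
abbrev stdVec (i : Fin 3) : E3 := EuclideanSpace.single i 1

lemma det_eq_entries (M : E3 →ₗ[ℝ] E3) : LinearMap.det M =
    (Matrix.of fun i j => M (stdVec j) i).det := by
  rw [← LinearMap.det_toMatrix (EuclideanSpace.basisFun (Fin 3) ℝ).toBasis]
  congr 1

lemma eq_sum_stdVec (x : E3) : x = x 0 • stdVec 0 + x 1 • stdVec 1 + x 2 • stdVec 2 := by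
  ext i; fin_cases i <;> simp

/-- The diagonal map with signs `a * b`, `a`, `b`. -/
def signMap (s : ℤˣ × ℤˣ) : E3 ≃ₗ[ℝ] E3 :=
  LinearEquiv.ofInvolutive
    { toFun := fun x => !₂[((s.1 * s.2 : ℤˣ) : ℤ) * x 0, (s.1 : ℤ) * x 1, (s.2 : ℤ) * x 2]
      map_add' := fun x y => by ext i; fin_cases i <;> simp <;> ring
      map_smul' := fun a x => by ext i; fin_cases i <;> simp <;> ring }
    fun x => by
      obtain ⟨a, b⟩ := s
      rcases Int.units_eq_one_or a with rfl | rfl <;>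
        rcases Int.units_eq_one_or b with rfl | rfl <;>
        ext i <;> fin_cases i <;> simp

lemma signMap_apply (s : ℤˣ × ℤˣ) (x : E3) : signMap s x =
    !₂[((s.1 * s.2 : ℤˣ) : ℤ) * x 0, (s.1 : ℤ) * x 1, (s.2 : ℤ) * x 2] := rfl

lemma signMap_mul (s t : ℤˣ × ℤˣ) (x : E3) : signMap (s * t) x = signMap s (signMap t x) := by
  ext i; fin_cases i <;> simp [signMap_apply] <;> ring

lemma signMap_injective : Function.Injective signMap := by
  rintro ⟨a, b⟩ ⟨c, d⟩ h
  have h1 := congrArg (fun L : E3 ≃ₗ[ℝ] E3 => L (stdVec 1) 1) h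
  have h2 := congrArg (fun L : E3 ≃ₗ[ℝ] E3 => L (stdVec 2) 2) h
  simp [signMap_apply] at h1 h2
  exact Prod.ext (Units.ext h1) (Units.ext h2)

lemma units_eq_cases (s : ℤˣ × ℤˣ) : s = (1, 1) ∨ s = (1, -1) ∨ s = (-1, 1) ∨ s = (-1, -1) := by
  obtain ⟨a, b⟩ := s
  rcases Int.units_eq_one_or a with rfl | rfl <;> rcases Int.units_eq_one_or b with rfl | rfl <;>
    simp

lemma det_signMap (s : ℤˣ × ℤˣ) : LinearMap.det (signMap s : E3 →ₗ[ℝ] E3) = 1 := by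
  rw [det_eq_entries, Matrix.det_fin_three]
  rcases units_eq_cases s with rfl | rfl | rfl | rfl <;> simp [signMap_apply]

lemma eta_signMap (s : ℤˣ × ℤˣ) (x y : E3) : eta (signMap s x) (signMap s y) = eta x y := by
  rcases units_eq_cases s with rfl | rfl | rfl | rfl <;> simp [signMap_apply, eta]

lemma mul3_signMap (s : ℤˣ × ℤˣ) (x y : E3) :
    mul3 (signMap s x) (signMap s y) = signMap s (mul3 x y) := by
  rcases units_eq_cases s with rfl | rfl | rfl | rfl <;> ext i <;> fin_cases i <;>
    simp [signMap_apply, mul3] <;> ring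

lemma mul3_self_eq_zero {x : E3} (h : mul3 x x = 0) :
    x 1 * x 2 = 0 ∧ x 0 * x 2 = 0 ∧ x 0 * x 1 = 0 := by
  have h0 := congrArg (fun v : E3 => v 0) h
  have h1 := congrArg (fun v : E3 => v 1) h
  have h2 := congrArg (fun v : E3 => v 2) h
  simp [mul3] at h0 h1 h2
  refine ⟨?_, ?_, ?_⟩
  · linarith [mul_comm (x 1) (x 2)]
  · linarith [mul_comm (x 0) (x 2)]
  · linarith [mul_comm (x 0) (x 1)]

lemma exists_units_of_sq {x : ℝ} (h : x * x = 1) : ∃ a : ℤˣ, x = ((a : ℤ) : ℝ) := by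
  rcases mul_self_eq_one_iff.1 h with h | h
  · exact ⟨1, by simp [h]⟩
  · exact ⟨-1, by simp [h]⟩

/-- The special isometries of the model metric that preserve the model difference tensor are the
diagonal maps with signs. -/
lemma exists_signMap (M : E3 →ₗ[ℝ] E3) (hdet : LinearMap.det M = 1)
    (heta : ∀ x y, eta (M x) (M y) = eta x y) (hmul : ∀ x y, mul3 (M x) (M y) = M (mul3 x y)) :
    ∃ s, ∀ x, M x = signMap s x := by
  -- Isotropic vectors go to isotropic vectors, so `M` permutes the axes up to factors; the rest
  -- excludes nontrivial permutations.
  have hz : ∀ i, mul3 (M (stdVec i)) (M (stdVec i)) = 0 := fun i => by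
    have h0 : mul3 (stdVec i) (stdVec i) = 0 := by
      ext j; fin_cases i <;> fin_cases j <;> simp [mul3]
    rw [hmul, h0, map_zero]
  have hd := hdet
  rw [det_eq_entries, Matrix.det_fin_three] at hd
  have h12 := hmul (stdVec 1) (stdVec 2)
  have e12 : mul3 (stdVec 1) (stdVec 2) = stdVec 0 := by
    ext j; fin_cases j <;> simp [mul3]
  rw [e12] at h12
  have k := congrArg (fun v : E3 => v 0) h12
  have e00 := heta (stdVec 0) (stdVec 0)
  have e01 := heta (stdVec 0) (stdVec 1)
  have e02 := heta (stdVec 0) (stdVec 2)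
  have e11 := heta (stdVec 1) (stdVec 1)
  have e12 := heta (stdVec 1) (stdVec 2)
  have e22 := heta (stdVec 2) (stdVec 2)
  obtain ⟨-, u2, u1⟩ := mul3_self_eq_zero (hz 0)
  obtain ⟨v1, -, -⟩ := mul3_self_eq_zero (hz 1)
  simp [mul3, eta] at k e00 e01 e02 e11 e12 e22 hd
  have hM : ∀ x, M x = x 0 • M (stdVec 0) + x 1 • M (stdVec 1) + x 2 • M (stdVec 2) := fun x => by
    conv_lhs => rw [eq_sum_stdVec x]
    simp only [map_add, map_smul]
  generalize M (stdVec 0) = u at *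
  generalize M (stdVec 1) = v at *
  generalize M (stdVec 2) = w at *
  -- The metric is positive on the first axis and negative on the other two.
  have hu : u 0 ≠ 0 := fun h => by
    rw [h] at e00; nlinarith [mul_self_nonneg (u 1), mul_self_nonneg (u 2)]
  replace u1 := (mul_eq_zero.1 u1).resolve_left hu
  replace u2 := (mul_eq_zero.1 u2).resolve_left hu
  simp [u1, u2, hu] at e00 e01 e02 hd
  simp [e01, e02] at e11 e12 e22 hd
  rcases mul_eq_zero.1 v1 with h | h
  -- Here `M` would interchange the last two axes. Multiplicativity gives `u 0 = v 2 * w 1`, and the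
  -- determinant becomes minus a square.
  · exfalso
    simp [h] at e11 e12 hd k
    have hv : v 2 ≠ 0 := fun h => by rw [h] at e11; norm_num at e11
    replace e12 := e12.resolve_left hv
    rw [← k] at hd
    simp [e12] at e22
    nlinarith [mul_self_nonneg (v 2 * w 1)]
  · simp [h] at e11 e12 hd k
    have hv : v 1 ≠ 0 := fun h => by rw [h] at e11; norm_num at e11
    replace e12 := e12.resolve_left hv
    simp [e12] at e22
    obtain ⟨a, ha⟩ := exists_units_of_sq e11
    obtain ⟨b, hb⟩ := exists_units_of_sq e22
    refine ⟨(a, b), fun x => ?_⟩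
    rw [hM]
    ext i
    fin_cases i <;> simp [signMap_apply, u1, u2, h, e01, e02, e12, ← k, ha, hb] <;> ring

/-- A group of linear maps that is conjugate to the group of diagonal maps with signs is a Klein
four-group. -/
lemma nonempty_mulEquiv_of_signMap (G : Subgroup (E3 ≃ₗ[ℝ] E3)) (Θ : E3 ≃ₗ[ℝ] E3)
    (hG : ∀ L, L ∈ G ↔ ∃ s, ∀ x, Θ (L x) = signMap s (Θ x)) :
    Nonempty (G ≃* Multiplicative (ZMod 2) × Multiplicative (ZMod 2)) := by
  have hs : ∀ s, (Θ.trans (signMap s)).trans Θ.symm ∈ G := fun s =>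
    (hG _).2 ⟨s, fun x => by simp⟩
  let F : ℤˣ × ℤˣ →* G :=
    MonoidHom.mk' (fun s => ⟨(Θ.trans (signMap s)).trans Θ.symm, hs s⟩) fun s t => by
      apply Subtype.ext
      ext1 x
      change Θ.symm (signMap (s * t) (Θ x)) = Θ.symm (signMap s (Θ (Θ.symm (signMap t (Θ x)))))
      rw [signMap_mul, LinearEquiv.apply_symm_apply]
  have hF : Function.Bijective F := by
    constructor
    · intro s t h
      apply signMap_injective
      ext1 x
      have h1 := congrArg (fun L : G => (L : E3 ≃ₗ[ℝ] E3) (Θ.symm x)) h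
      change Θ.symm (signMap s (Θ (Θ.symm x))) = Θ.symm (signMap t (Θ (Θ.symm x))) at h1
      rwa [LinearEquiv.apply_symm_apply, Θ.symm.injective.eq_iff] at h1
    · rintro ⟨L, hL⟩
      obtain ⟨s, hs⟩ := (hG L).1 hL
      refine ⟨s, Subtype.ext ?_⟩
      ext1 x
      change Θ.symm (signMap s (Θ x)) = L x
      rw [← hs, LinearEquiv.symm_apply_apply]
  have h1 : IsKleinFour (ℤˣ × ℤˣ) :=
    ⟨by simp, by
      refine ((Nat.dvd_prime Nat.prime_two).1
        (Monoid.exponent_dvd_of_forall_pow_eq_one (by decide))).resolve_left fun h => ?_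
      have h1 := (Monoid.exp_eq_one_iff.1 h).elim (1 : ℤˣ × ℤˣ) (-1, 1)
      revert h1
      decide⟩
  have h2 : IsKleinFour (Multiplicative (ZMod 2) × Multiplicative (ZMod 2)) :=
    ⟨by simp, by
      rw [Monoid.exponent_prod]
      simp⟩
  obtain ⟨e⟩ := IsKleinFour.nonempty_mulEquiv (G₁ := ℤˣ × ℤˣ)
    (G₂ := Multiplicative (ZMod 2) × Multiplicative (ZMod 2))
  exact ⟨(MulEquiv.ofBijective F hF).symm.trans e⟩

/-- The special isometries preserving the difference tensor of a hypersurface in the model form a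
Klein four-group. -/
lemma IsModelPatch.stabilizer_equiv {p q : E4 →L[ℝ] ℂ} {f : E3 → E4} {c : E4} {U : Set E3} {z : E3}
    {κ : ℝ} (S : IsModelPatch p q f c U) (hz : z ∈ U) (hκ : κ ≠ 0) :
    Nonempty (stabilizer f (fun w => κ • (f w - c)) z ≃*
      Multiplicative (ZMod 2) × Multiplicative (ZMod 2)) := by
  let Θ : E3 ≃ₗ[ℝ] E3 := LinearEquiv.ofBijective (logForm p q f c z)
    ⟨S.logForm_injective hz, S.logForm_surjective hz⟩
  have hΘ : ∀ x, Θ x = logForm p q f c z x := fun x => rfl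
  have hm : ∀ X Y, metric f (fun w => κ • (f w - c)) z X Y = κ⁻¹ * eta (Θ X) (Θ Y) :=
    fun X Y => (S.metric_christoffel hz hκ X Y).1
  have hK : ∀ X Y, Θ (differenceTensor f (fun w => κ • (f w - c)) z X Y) = mul3 (Θ X) (Θ Y) :=
    fun X Y => S.logForm_differenceTensor hz hκ X Y
  apply nonempty_mulEquiv_of_signMap _ Θ
  intro L
  constructor
  · rintro ⟨hd, h1, h2, -⟩
    obtain ⟨s, hs⟩ := exists_signMap ((Θ : E3 →ₗ[ℝ] E3) ∘ₗ (L : E3 →ₗ[ℝ] E3) ∘ₗ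
      (Θ.symm : E3 →ₗ[ℝ] E3)) (by rw [LinearMap.det_conj, hd])
      (fun x y => by
        have := h1 (Θ.symm x) (Θ.symm y)
        rw [hm, hm] at this
        simpa using mul_left_cancel₀ (inv_ne_zero hκ) this)
      (fun x y => by
        have := congrArg Θ (h2 (Θ.symm x) (Θ.symm y))
        rw [hK] at this
        simp only [LinearMap.comp_apply, LinearEquiv.coe_coe]
        rw [this]
        congr 2
        rw [LinearEquiv.eq_symm_apply, hK]
        simp)
    exact ⟨s, fun x => by simpa using hs (Θ x)⟩
  · rintro ⟨s, hs⟩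
    refine ⟨?_, fun X Y => ?_, fun X Y => ?_, fun X => ?_⟩
    · have h : (signMap s : E3 →ₗ[ℝ] E3) = (Θ : E3 →ₗ[ℝ] E3) ∘ₗ (L : E3 →ₗ[ℝ] E3) ∘ₗ
          (Θ.symm : E3 →ₗ[ℝ] E3) := by
        ext1 x
        simp [hs]
      rw [← det_signMap s, h, LinearMap.det_conj]
    · rw [hm, hm, hs, hs, eta_signMap]
    · apply Θ.injective
      rw [hK, hs, hs, hs, hK, mul3_signMap]
    · rw [S.shape_eq hz hκ, S.shape_eq hz hκ, map_smul]

/-! ### The volume condition -/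

lemma vol_eq_basis_det (a b c d : E4) :
    vol a b c d = (EuclideanSpace.basisFun (Fin 4) ℝ).toBasis.det ![a, b, c, d] := by
  rw [Module.Basis.det_apply, vol, ← Matrix.det_transpose]
  congr 1
  ext i j
  fin_cases i <;> fin_cases j <;> simp [Module.Basis.toMatrix_apply]

lemma vol_map (T : E4 →ₗ[ℝ] E4) (a b c d : E4) :
    vol (T a) (T b) (T c) (T d) = LinearMap.det T * vol a b c d := by
  rw [vol_eq_basis_det, vol_eq_basis_det, ← Module.Basis.det_comp]
  congr 1
  ext i
  fin_cases i <;> rfl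

lemma vol_stdBasis : vol (EuclideanSpace.single 0 1) (EuclideanSpace.single 1 1)
    (EuclideanSpace.single 2 1) (EuclideanSpace.single 3 1) = 1 := by
  simp [vol, Matrix.det_succ_row_zero, Fin.sum_univ_succ, Fin.succAbove]

/-- The linear map with components `p` and `q`. -/
def coordMap (p q : E4 →L[ℝ] ℂ) : E4 →ₗ[ℝ] E4 where
  toFun v := !₂[(p v).re, (p v).im, (q v).re, (q v).im]
  map_add' v w := by ext i; fin_cases i <;> simp
  map_smul' a v := by ext i; fin_cases i <;> simp

lemma coordMap_apply (p q : E4 →L[ℝ] ℂ) (v : E4) :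
    coordMap p q v = !₂[(p v).re, (p v).im, (q v).re, (q v).im] := rfl

/-- Multiplication by a pair of complex numbers. -/
def mulMap (a b : ℂ) : E4 →ₗ[ℝ] E4 where
  toFun v := !₂[a.re * v 0 - a.im * v 1, a.re * v 1 + a.im * v 0,
    b.re * v 2 - b.im * v 3, b.re * v 3 + b.im * v 2]
  map_add' v w := by ext i; fin_cases i <;> simp <;> ring
  map_smul' s v := by ext i; fin_cases i <;> simp <;> ring

lemma mulMap_apply (a b : ℂ) (v : E4) : mulMap a b v = !₂[a.re * v 0 - a.im * v 1,
    a.re * v 1 + a.im * v 0, b.re * v 2 - b.im * v 3, b.re * v 3 + b.im * v 2] := rfl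

lemma det_mulMap (a b : ℂ) :
    LinearMap.det (mulMap a b) = Complex.normSq a * Complex.normSq b := by
  have h := vol_map (mulMap a b) (EuclideanSpace.single 0 1) (EuclideanSpace.single 1 1)
    (EuclideanSpace.single 2 1) (EuclideanSpace.single 3 1)
  rw [vol_stdBasis, mul_one] at h
  rw [← h]
  simp [vol, mulMap_apply, Matrix.det_succ_row_zero, Fin.sum_univ_succ, Fin.succAbove,
    Complex.normSq_apply]
  ring

/-- The vector with complex components `fstC x + t` and `sndC x + t`. -/
def realPair (x : E3) (t : ℝ) : E4 := !₂[x 0 + t, x 1 - x 2, -x 0 + t, x 1 + x 2]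

/-- The pair `(x, t)` enters linearly; the part of the last vector in the hyperplane does not
contribute, because four vectors of `E3` are dependent. -/
lemma vol_realPair (x y w u : E3) (t : ℝ) :
    vol (realPair x 0) (realPair y 0) (realPair w 0) (realPair u t) =
      -4 * t * (Matrix.of ![x, y, w]).det := by
  rw [Matrix.det_fin_three]
  simp [vol, realPair, Matrix.det_succ_row_zero, Fin.sum_univ_succ, Fin.succAbove]
  ring

lemma det_eta (s : ℝ) (x : Fin 3 → E3) :
    (Matrix.of fun i j => s * eta (x i) (x j)).det =
      s ^ 3 * (Matrix.of ![x 0, x 1, x 2]).det ^ 2 := by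
  simp [Matrix.det_fin_three, eta]
  ring

namespace IsModelPatch

variable {p q : E4 →L[ℝ] ℂ} {f ν : E3 → E4} {c : E4} {U : Set E3} {z : E3} {t : ℝ} {V : E3}

lemma coordMap_eq (S : IsModelPatch p q f c U) (hz : z ∈ U) (W : E3) (t : ℝ) :
    coordMap p q (fderiv ℝ f z W + t • (f z - c)) =
      mulMap (p (f z - c)) (q (f z - c)) (realPair (logForm p q f c z W) t) := by
  have h1 := S.fst_fderiv hz W
  have h2 := S.snd_fderiv hz W
  rw [coordMap_apply, map_add, map_add, h1, h2, map_smul, map_smul]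
  ext i
  fin_cases i <;> simp [mulMap_apply, realPair, fstC, sndC, -map_sub] <;> ring

/-- In complex coordinates the position vector acts by `mulMap`, whose determinant is the product of
the squared moduli, and this is 1 on the model. -/
lemma vol_eq (S : IsModelPatch p q f c U) (hz : z ∈ U) (X : Fin 3 → E3) (V : E3) (t : ℝ) :
    LinearMap.det (coordMap p q) * vol (fderiv ℝ f z (X 0)) (fderiv ℝ f z (X 1))
      (fderiv ℝ f z (X 2)) (fderiv ℝ f z V + t • (f z - c)) = -4 * t *
      (Matrix.of ![logForm p q f c z (X 0), logForm p q f c z (X 1), logForm p q f c z (X 2)]).det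
      := by
  have h : ∀ W, coordMap p q (fderiv ℝ f z W) = mulMap (p (f z - c)) (q (f z - c))
      (realPair (logForm p q f c z W) 0) := fun W => by
    rw [← S.coordMap_eq hz W 0, zero_smul, add_zero]
  rw [← vol_map, h, h, h, S.coordMap_eq hz, vol_map, det_mulMap, S.norm_eq z hz, one_mul,
    vol_realPair]

lemma det_coordMap_ne_zero (S : IsModelPatch p q f c U) :
    LinearMap.det (coordMap p q) ≠ 0 := by
  rw [← isUnit_iff_ne_zero, ← LinearMap.isUnit_iff_isUnit_det, LinearMap.isUnit_iff_ker_eq_bot,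
    LinearMap.ker_eq_bot']
  intro v hv
  rw [coordMap_apply] at hv
  have h0 := congrArg (fun w : E4 => w 0) hv
  have h1 := congrArg (fun w : E4 => w 1) hv
  have h2 := congrArg (fun w : E4 => w 2) hv
  have h3 := congrArg (fun w : E4 => w 3) hv
  exact S.coords v (Complex.ext h0 h1) (Complex.ext h2 h3)

lemma transverse_of_eq (S : IsModelPatch p q f c U) (hz : z ∈ U) (ht : t ≠ 0)
    (hν : ν z = fderiv ℝ f z V + t • (f z - c)) : ν z ∉ (fderiv ℝ f z).range := by
  rintro ⟨W, hW⟩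
  have hW' : fderiv ℝ f z W = ν z := hW
  refine S.transverse hz ht ⟨W - V, ?_⟩
  change fderiv ℝ f z (W - V) = _
  rw [map_sub, hW', hν, add_sub_cancel_left]

/-- A change of the tangential part of the transverse field is absorbed by the connection; the
metric depends only on `t`. -/
lemma metric_of_eq (S : IsModelPatch p q f c U) (hz : z ∈ U) (ht : t ≠ 0)
    (hν : ν z = fderiv ℝ f z V + t • (f z - c)) (X Y : E3) :
    metric f ν z X Y = t⁻¹ * eta (logForm p q f c z X) (logForm p q f c z Y) := by
  have hi := frame_isInvertible (S.immersive z hz) (S.transverse_of_eq hz ht hν)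
  obtain ⟨Z, hZ⟩ := S.logForm_surjective hz (fderiv ℝ (fun w => logForm p q f c w Y) z X +
      mul3 (logForm p q f c z X) (logForm p q f c z Y))
  have hg : fderiv ℝ (fderiv ℝ f) z X Y =
      fderiv ℝ f z (Z - (t⁻¹ * eta (logForm p q f c z X) (logForm p q f c z Y)) • V) +
      (t⁻¹ * eta (logForm p q f c z X) (logForm p q f c z Y)) • ν z := by
    rw [S.gauss hz hZ, hν, map_sub, map_smul, smul_add, smul_smul, mul_right_comm,
      inv_mul_cancel₀ ht, one_mul]
    abel
  rw [metric_apply, hg, transversal_frame hi]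

/-- The volume condition for a transverse field along a hypersurface in the model. -/
lemma volume_eq_iff (S : IsModelPatch p q f c U) (hz : z ∈ U) (ht : t ≠ 0)
    (hν : ν z = fderiv ℝ f z V + t • (f z - c)) :
    (∀ X : Fin 3 → E3,
      |vol (fderiv ℝ f z (X 0)) (fderiv ℝ f z (X 1)) (fderiv ℝ f z (X 2)) (ν z)| =
        Real.sqrt |(Matrix.of fun i j => metric f ν z (X i) (X j)).det|) ↔
    16 * |t| ^ 5 = LinearMap.det (coordMap p q) ^ 2 := by
  have hd := S.det_coordMap_ne_zero
  have hd2 : 0 < LinearMap.det (coordMap p q) ^ 2 := by positivity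
  have ht' : 0 < |t| := abs_pos.2 ht
  -- After squaring, the volume side scales as `|t| ^ 2` and the metric determinant as `|t|⁻¹ ^ 3`,
  -- whence the fifth power; both carry the squared determinant of `logForm` on `X`.
  have key : ∀ X : Fin 3 → E3,
      |vol (fderiv ℝ f z (X 0)) (fderiv ℝ f z (X 1)) (fderiv ℝ f z (X 2)) (ν z)| =
        Real.sqrt |(Matrix.of fun i j => metric f ν z (X i) (X j)).det| ↔
      16 * |t| ^ 5 * (Matrix.of ![logForm p q f c z (X 0), logForm p q f c z (X 1),
        logForm p q f c z (X 2)]).det ^ 2 = LinearMap.det (coordMap p q) ^ 2 *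
      (Matrix.of ![logForm p q f c z (X 0), logForm p q f c z (X 1),
        logForm p q f c z (X 2)]).det ^ 2 := by
    intro X
    have hv := S.vol_eq hz X V t
    have hm : (Matrix.of fun i j => metric f ν z (X i) (X j)).det = t⁻¹ ^ 3 *
        (Matrix.of ![logForm p q f c z (X 0), logForm p q f c z (X 1),
        logForm p q f c z (X 2)]).det ^ 2 := by
      rw [← det_eta t⁻¹ fun i => logForm p q f c z (X i)]
      congr 1
      ext i j
      exact S.metric_of_eq hz ht hν (X i) (X j)
    rw [hm, hν]
    set D := (Matrix.of ![logForm p q f c z (X 0), logForm p q f c z (X 1),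
        logForm p q f c z (X 2)]).det
    set v := vol (fderiv ℝ f z (X 0)) (fderiv ℝ f z (X 1)) (fderiv ℝ f z (X 2))
      (fderiv ℝ f z V + t • (f z - c))
    set d := LinearMap.det (coordMap p q)
    have h2 : v ^ 2 * d ^ 2 = 16 * |t| ^ 2 * D ^ 2 := by
      rw [sq_abs]
      linear_combination (d * v - 4 * t * D) * hv
    rw [eq_comm, Real.sqrt_eq_iff_eq_sq (abs_nonneg _) (abs_nonneg _), sq_abs, abs_mul, abs_pow,
      abs_inv, abs_of_nonneg (sq_nonneg D), inv_pow]
    have h3 : 0 < |t| ^ 3 := by positivity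
    rw [inv_mul_eq_iff_eq_mul₀ h3.ne']
    constructor
    · intro h
      linear_combination (-d ^ 2) * h - |t| ^ 3 * h2
    · intro h
      apply mul_left_cancel₀ hd2.ne'
      linear_combination -h - |t| ^ 3 * h2
  constructor
  · intro h
    -- Vectors for which that determinant is 1.
    choose X hX using fun i : Fin 3 => S.logForm_surjective hz (stdVec i)
    have := (key X).1 (h X)
    rw [hX, hX, hX, Matrix.det_fin_three] at this
    simpa using this
  · intro h X
    rw [key, h]

/-- The position vector field, suitably scaled, is the affine normal. -/
lemma isBlaschkeNormalAt (S : IsModelPatch p q f c U) (hz : z ∈ U) {κ : ℝ} (hκ : 0 < κ)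
    (h : 16 * κ ^ 5 = LinearMap.det (coordMap p q) ^ 2) :
    IsBlaschkeNormalAt f (fun w => κ • (f w - c)) z := by
  have hv := (S.volume_eq_iff (ν := fun w => κ • (f w - c)) (V := 0) hz hκ.ne'
    (by rw [map_zero, zero_add])).2 (by rwa [abs_of_pos hκ])
  refine ⟨S.transverse hz hκ.ne', fun X => ⟨κ • X, ?_⟩, hv⟩
  rw [S.fderiv_normal hz]
  exact (fderiv ℝ f z).map_smul κ X

/-- The affine normal is a multiple of the position vector field. -/
lemma exists_normal_eq (S : IsModelPatch p q f c U) (hν : ∀ w ∈ U, ContDiffAt ℝ ∞ ν w)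
    (hB : ∀ w ∈ U, IsBlaschkeNormalAt f ν w) (hz : z ∈ U) :
    ∃ κ : ℝ, κ ≠ 0 ∧ ν =ᶠ[𝓝 z] fun w => κ • (f w - c) := by
  set ν₀ : E3 → E4 := fun w => (1 : ℝ) • (f w - c)
  have hν₀ : ∀ w, ν₀ w = f w - c := fun w => one_smul _ _
  have hi : ∀ w ∈ U, (frame f ν₀ w).IsInvertible := fun w hw => S.frame_invertible hw one_ne_zero
  set t : E3 → ℝ := fun w => transversal f ν₀ w (ν w)
  set V : E3 → E3 := fun w => tangential f ν₀ w (ν w)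
  have hdec : ∀ w ∈ U, ν w = fderiv ℝ f w (V w) + t w • (f w - c) := fun w hw => by
    rw [← hν₀]; exact (fderiv_tangential_add (hi w hw) _).symm
  have ht0 : ∀ w ∈ U, t w ≠ 0 := fun w hw h => by
    apply (hB w hw).transverse
    rw [hdec w hw, h, zero_smul, add_zero]
    exact ⟨V w, rfl⟩
  have ht5 : ∀ w ∈ U, 16 * |t w| ^ 5 = LinearMap.det (coordMap p q) ^ 2 := fun w hw =>
    (S.volume_eq_iff hw (ht0 w hw) (hdec w hw)).1 (hB w hw).volume_eq
  have hts : ∀ w ∈ U, ∀ x ∈ U, t w ^ 2 = t x ^ 2 := fun w hw x hx => by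
    have h : |t w| ^ 5 = |t x| ^ 5 := by linarith [ht5 w hw, ht5 x hx]
    rw [sq_eq_sq_iff_abs_eq_abs]
    exact (pow_left_inj₀ (abs_nonneg _) (abs_nonneg _) (by norm_num)).1 h
  have htd : ∀ w ∈ U, DifferentiableAt ℝ t w := fun w hw =>
    differentiableAt_of_smooth ((contDiffAt_transversal (S.smooth w hw) (S.smooth_normal hw)
      (hi w hw)).clm_apply (hν w hw))
  have hVd : ∀ w ∈ U, DifferentiableAt ℝ V w := fun w hw =>
    differentiableAt_of_smooth ((contDiffAt_tangential (S.smooth w hw) (S.smooth_normal hw)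
      (hi w hw)).clm_apply (hν w hw))
  -- `U` need not be connected, but `t ^ 2` is constant on it by the volume condition, and `t` has
  -- no zeros.
  have hDt : ∀ w ∈ U, fderiv ℝ t w = 0 := fun w hw => by
    have h1 := (htd w hw).hasFDerivAt.mul (htd w hw).hasFDerivAt
    have he : (t * t) =ᶠ[𝓝 w] fun _ => t w ^ 2 := by
      filter_upwards [S.eventually_mem hw] with x hx
      rw [hts w hw x hx, Pi.mul_apply, sq]
    have h2 := h1.unique ((hasFDerivAt_const (t w ^ 2) w).congr_of_eventuallyEq he)
    ext X
    have h3 := congrArg (fun L => L X) h2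
    simp at h3
    simpa [ht0 w hw] using h3
  -- As `t` has zero derivative, the transversal part of the derivative of `ν` along `X` is the
  -- metric of `X` and `V`. It vanishes because that derivative is tangential.
  have hV : ∀ w ∈ U, V w = 0 := fun w hw => by
    refine S.nondegenerate hw one_ne_zero _ fun X => ?_
    obtain ⟨W, hW⟩ := (hB w hw).tangent X
    have hW' : fderiv ℝ f w W = fderiv ℝ ν w X := hW
    have h0 := differentiableAt_of_smooth (contDiffAt_fderiv (S.smooth w hw))
    have h1 := (h0.hasFDerivAt.clm_apply
      (hVd w hw).hasFDerivAt).add ((htd w hw).hasFDerivAt.smul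
      ((differentiableAt_of_smooth (S.smooth w hw)).hasFDerivAt.sub_const c))
    have he : ν =ᶠ[𝓝 w] (fun x => fderiv ℝ f x (V x)) + t • fun x => f x - c := by
      filter_upwards [S.eventually_mem hw] with x hx using hdec x hx
    rw [he.fderiv_eq, h1.fderiv, hDt w hw] at hW'
    have h2 := congrArg (transversal f ν₀ w) hW'
    simp only [add_apply, ContinuousLinearMap.flip_apply, ContinuousLinearMap.comp_apply,
      smul_apply, map_add, map_smul, transversal_fderiv (hi w hw),
      ContinuousLinearMap.smulRight_apply, zero_apply, zero_smul, smul_zero, add_zero,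
      zero_add] at h2
    rw [metric_symm (S.smooth w hw)]
    exact h2.symm
  refine ⟨t z, ht0 z hz, ?_⟩
  -- Only the sign of `t` is still free; near `z` it is that of `t z` by continuity.
  filter_upwards [S.eventually_mem hz,
    ((htd z hz).continuousAt.mul continuousAt_const).eventually
      (lt_mem_nhds (mul_self_pos.2 (ht0 z hz)))] with w hw hpos
  rw [hdec w hw, hV w hw, map_zero, zero_add]
  rcases sq_eq_sq_iff_eq_or_eq_neg.1 (hts w hw z hz) with h | h
  · rw [h]
  · rw [Pi.mul_apply, h] at hpos
    nlinarith [mul_self_nonneg (t z)]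

end IsModelPatch

/-! ### Dependence of the tensors on the germ of the normal. -/

lemma metric_congr {f ν ν' : E3 → E4} {z : E3} (h : ν z = ν' z) :
    metric f ν z = metric f ν' z := by
  simp only [metric, transversal, frame, h]

lemma differenceTensor_congr {f ν ν' : E3 → E4} {z : E3} (h : ν =ᶠ[𝓝 z] ν') :
    differenceTensor f ν z = differenceTensor f ν' z := by
  have hm : metric f ν =ᶠ[𝓝 z] metric f ν' := h.mono fun w hw => metric_congr hw
  funext X Y
  simp only [differenceTensor, leviCivitaChristoffel, koszul, hm.fderiv_eq, hm.self_of_nhds,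
    inducedChristoffel, tangential, frame, h.self_of_nhds]

lemma shape_congr {f ν ν' : E3 → E4} {z : E3} (h : ν =ᶠ[𝓝 z] ν') :
    shape f ν z = shape f ν' z := by
  simp only [shape, h.fderiv_eq, tangential, frame, h.self_of_nhds]

lemma stabilizer_congr {f ν ν' : E3 → E4} {z : E3} (h : ν =ᶠ[𝓝 z] ν') :
    stabilizer f ν z = stabilizer f ν' z := by
  ext L
  change (_ ∧ _ ∧ _ ∧ _) ↔ (_ ∧ _ ∧ _ ∧ _)
  rw [metric_congr h.self_of_nhds, differenceTensor_congr h, shape_congr h]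

/-! ### Transfer to the manifold: the converse and the existence of a normal. -/

section Global

variable {M : Type*} [TopologicalSpace M] [ChartedSpace E3 M]

lemma IsSmoothImmersion.fderiv_injective [IsManifold (𝓡 3) ∞ M] {φ : M → E4}
    (hφ : IsSmoothImmersion φ) {e : OpenPartialHomeomorph M E3}
    (he : e ∈ IsManifold.maximalAtlas (𝓡 3) ∞ M) {y : E3} (hy : y ∈ e.target) :
    Function.Injective (fderiv ℝ (φ ∘ e.symm) y) := by
  have hd : e.MDifferentiable (𝓡 3) (𝓡 3) :=
    ⟨(contMDiffOn_of_mem_maximalAtlas he).mdifferentiableOn (by simp),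
      (contMDiffOn_symm_of_mem_maximalAtlas he).mdifferentiableOn (by simp)⟩
  have h1 : Function.Injective (mfderiv (𝓡 3) (𝓡 3) e.symm y) := hd.symm.mfderiv_injective hy
  have h2 := mfderiv_comp y ((hφ.smooth (e.symm y)).mdifferentiableAt (by simp))
    (hd.symm.mdifferentiableAt hy)
  have h3 : fderiv ℝ (φ ∘ e.symm) y = (mfderiv (𝓡 3) 𝓘(ℝ, E4) φ (e.symm y)).comp
      (mfderiv (𝓡 3) (𝓡 3) e.symm y) := by
    rw [← mfderiv_eq_fderiv]
    exact h2
  rw [h3]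
  exact (hφ.immersive (e.symm y)).comp h1

/-- A hypersurface affinely equivalent to a part of the model, in complex coordinates. -/
lemma exists_isModelPatch [IsManifold (𝓡 3) ∞ M] {φ : M → E4} (hφ : IsSmoothImmersion φ)
    (h : IsAffinelyEquivalentToOpenSubsetOf φ model) : ∃ (p q : E4 →L[ℝ] ℂ) (c : E4),
      ∀ e ∈ IsManifold.maximalAtlas (𝓡 3) ∞ M, IsModelPatch p q (φ ∘ e.symm) c e.target := by
  obtain ⟨A, W, -, hA⟩ := h
  have hmem : ∀ m, A (φ m) ∈ model := fun m => by
    have : A (φ m) ∈ model ∩ W := hA ▸ Set.mem_image_of_mem A (Set.mem_range_self m)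
    exact this.1
  let B : E4 ≃L[ℝ] E4 := A.linear.toContinuousLinearEquiv
  let F : Fin 4 → Fin 4 → E4 →L[ℝ] ℂ := fun i j =>
    Complex.equivRealProdCLM.symm.toContinuousLinearMap.comp (((EuclideanSpace.proj i : E4 →L[ℝ] ℝ).comp B.toContinuousLinearMap).prod
      ((EuclideanSpace.proj j : E4 →L[ℝ] ℝ).comp B.toContinuousLinearMap))
  have hre : ∀ i j v, (F i j v).re = B v i := fun i j v => by simp [F]
  have him : ∀ i j v, (F i j v).im = B v j := fun i j v => by simp [F]
  have hB : ∀ x, B (x - A.symm 0) = A x := fun x => by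
    have := A.toAffineMap.linearMap_vsub x (A.symm 0)
    simpa [B] using this
  refine ⟨F 0 1, F 2 3, A.symm 0, fun e he => ⟨e.open_target, fun v h1 h2 => ?_,
    fun y hy => contDiffAt_comp_chart_symm hφ.smooth he hy,
    fun y hy => hφ.fderiv_injective he hy, fun y _ => ?_⟩⟩
  · apply B.injective
    rw [map_zero]
    have a0 := congrArg Complex.re h1
    have a1 := congrArg Complex.im h1
    have a2 := congrArg Complex.re h2
    have a3 := congrArg Complex.im h2
    rw [hre] at a0 a2
    rw [him] at a1 a3
    ext i
    fin_cases i
    exacts [a0, a1, a2, a3]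
  · rw [Complex.normSq_apply, Complex.normSq_apply, hre, hre, him, him, hB]
    have h : (_ * _ : ℝ) = 1 := hmem (e.symm y)
    simp only [← sq]
    exact h

lemma exists_scale {d : ℝ} (hd : d ≠ 0) : ∃ κ : ℝ, 0 < κ ∧ 16 * κ ^ 5 = d ^ 2 := by
  have h : 0 < d ^ 2 / 16 := by positivity
  refine ⟨(d ^ 2 / 16) ^ ((5 : ℕ) : ℝ)⁻¹, Real.rpow_pos_of_pos h _, ?_⟩
  rw [Real.rpow_inv_natCast_pow h.le (by norm_num)]
  ring

theorem symmetry_of_equivalent [IsManifold (𝓡 3) ∞ M] {φ ξ : M → E4}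
    (h : IsIndefiniteAffineHypersphere φ ξ) (hQ : IsAffinelyEquivalentToOpenSubsetOf φ model) :
    HasPointwiseSymmetry (Multiplicative (ZMod 2) × Multiplicative (ZMod 2)) φ ξ := by
  obtain ⟨p, q, c, S⟩ := exists_isModelPatch h.immersion hQ
  intro e he y hy
  obtain ⟨κ, hκ, hν⟩ := (S e he).exists_normal_eq
    (fun w hw => contDiffAt_comp_chart_symm h.smooth_normal he hw) (h.blaschke e he) hy
  rw [stabilizer_congr hν]
  exact (S e he).stabilizer_equiv hy hκ

/-- The normalizing constant depends only on `p` and `q` and not on the chart, so one multiple of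
the position vector works on all of `M`. -/
theorem exists_hypersphere [IsManifold (𝓡 3) ∞ M] {φ : M → E4} (hφ : IsSmoothImmersion φ)
    (hQ : IsAffinelyEquivalentToOpenSubsetOf φ model) :
    ∃ ξ : M → E4, IsIndefiniteAffineHypersphere φ ξ := by
  obtain ⟨p, q, c, S⟩ := exists_isModelPatch hφ hQ
  -- A chart is needed to know that the coordinate determinant is nonzero; on the empty manifold
  -- every condition is vacuous and 0 serves as the curvature.
  rcases isEmpty_or_nonempty M with hM | ⟨⟨m⟩⟩
  · exact ⟨φ, hφ, hφ.smooth, fun e _ y hy => (hM.false (e.symm y)).elim,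
      fun e _ y hy => (hM.false (e.symm y)).elim, 0, fun e _ y hy => (hM.false (e.symm y)).elim⟩
  obtain ⟨κ, hκ, hd⟩ := exists_scale
    (S _ (IsManifold.chart_mem_maximalAtlas m)).det_coordMap_ne_zero
  exact ⟨fun x => κ • (φ x - c), hφ,
    (contDiff_const_smul κ).contMDiff.comp (hφ.smooth.sub contMDiff_const),
    fun e he y hy => (S e he).isBlaschkeNormalAt hy hκ hd,
    fun e he y hy => (S e he).isIndefiniteAt hy hκ.ne',
    -κ, fun e he y hy => (S e he).shape_eq hy hκ.ne'⟩

end Global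

end AffineSphere

end

theorem theorem5p1 {M : Type*} [TopologicalSpace M] [ChartedSpace E3 M]
    [IsManifold (𝓡 3) ∞ M] [T2Space M] [SecondCountableTopology M] [ConnectedSpace M]
    (φ : M → E4) (hφ : IsSmoothImmersion φ) :
    (∀ ξ : M → E4, IsIndefiniteAffineHypersphere φ ξ →
      (HasPointwiseSymmetry (Multiplicative (ZMod 2) × Multiplicative (ZMod 2)) φ ξ ↔
        IsAffinelyEquivalentToOpenSubsetOf φ model)) ∧
    (IsAffinelyEquivalentToOpenSubsetOf φ model →
      ∃ ξ : M → E4, IsIndefiniteAffineHypersphere φ ξ) := by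
  exact ⟨fun _ hξ => ⟨equivalent_of_symmetry hξ, symmetry_of_equivalent hξ⟩, exists_hypersphere hφ⟩
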